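/- Let $s\ge 0$, $n>s$ be integers and let $(w,z,\zeta)\in\mathbb{C}\oplus\mathbb{C}^s\oplus\mathbb{C}^{n-s}$ be coordinates on $\mathbb{C}^{n+1}$. A real hypersurface $M\subset\mathbb{C}^{n+1}$ with CR bundle $\mathcal{H}=\mathcal{K}_1\subset\mathbb{C}TM$ of $(1,0)$-vectors has Levi kernel $\mathcal{K}_2$, the left kernel of the Levi form $(X,Y)\mapsto[X,\overline{Y}]\bmod\mathcal{H}\oplus\overline{\mathcal{H}}$ on $\mathcal{H}$; if $\mathcal{K}_2$ has constant rank, $\mathcal{K}_3\subset\mathcal{K}_2$ denotes the left kernel of $(X,Y,Y')\mapsto[[X,\overline{Y}],\overline{Y'}]\bmod\mathcal{H}\oplus\overline{\mathcal{H}}$ (with $X$ a section of $\mathcal{K}_2$ and $Y,Y'$ sections of $\mathcal{H}$), and $M$ is $2$-nondegenerate if $\mathcal{K}_2\ne0$ and $\mathcal{K}_3=0$ at every point. A *$2$-nondegenerate model* is a real analytic hypersurface, given near $0$ by $$\Re(w)=z^TH(\zeta,\overline{\zeta})\overline{z}+\Re\left(\overline{z}^TS(\zeta,\overline{\zeta})\overline{z}\right),\tag{1}$$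 where $H$ and $S$ are $s\times s$ matrices of real analytic functions of $\zeta$ near $0$, $H$ is Hermitian with $H(0,0)$ nondegenerate, $S$ is symmetric, and, in some neighborhood of $0$, the Levi form has constant rank $s$ and the hypersurface is $2$-nondegenerate at each of its points. Let $\mathbf{H}$ be a nondegenerate Hermitian $s\times s$ matrix, and let $\mathbf{S}(\zeta)$ be a symmetric $s\times s$ matrix of holomorphic functions of $\zeta=(\zeta_1,\dots,\zeta_{n-s})$ near $0$ with $\mathbf{S}(0)=0$ and with linearly independent (over $\mathbb{C}$) partial derivatives $\mathbf{S}_{\zeta_1}(0),\dots,\mathbf{S}_{\zeta_{n-s}}(0)$. Associate with the pair $(\mathbf{H},\mathbf{S})$ the functions (defined for $\zeta$ near $0$) $$H(\zeta,\overline{\zeta})=\tfrac12\left(\mathbf{H}\left(\mathrm{Id}-\overline{\mathbf{S}(\zeta)}\mathbf{H}^T\mathbf{S}(\zeta)\mathbf{H}\right)^{-1}+\left(\mathrm{Id}-\mathbf{H}\overline{\mathbf{S}(\zeta)}\mathbf{H}^T\mathbf{S}(\zeta)\right)^{-1}\mathbf{H}\right),\tag{2}$$ $$S(\zeta,\overline{\zeta})=\mathbf{H}^T\left(\mathrm{Id}-\mathbf{S}(\zeta)\mathbf{H}\overline{\mathbf{S}(\zeta)}\mathbf{H}^T\right)^{-1}\mathbf{S}(\zeta)\mathbf{H}.\tag{3}$$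 **Theorem.** (i) Every $2$-nondegenerate model is locally equivalent, by a biholomorphism between neighborhoods of $0$ fixing $0$, to the hypersurface (1) with $H$ and $S$ given by (2) and (3) for some pair $(\mathbf{H},\mathbf{S})$ as above. (ii) Conversely, for every pair $(\mathbf{H},\mathbf{S})$ as above, (1) with (2) and (3) defines a $2$-nondegenerate model $M$. Moreover, there is a set $\mathfrak{g}$ of holomorphic infinitesimal symmetries of $M$ on a neighborhood of $0$ (holomorphic vector fields whose real parts are tangent to $M$) that acts locally transitively at $0$ on the space of leaves of the Levi kernel: for all $p\in M$ near $0$, the values at $p$ of (twice the real parts of) the elements of $\mathfrak{g}$ span over $\mathbb{R}$ the tangent space $T_pM/\Re(\mathcal{K}_2\oplus\overline{\mathcal{K}_2})_p$ of the leaf space; and inside every neighborhood of $0$, every point of $M$ sufficiently close to $0$ can be joined to $0$ by finitely many successive curves in $M$, each of which is an integral curve of (twice the real part of) an element of $\mathfrak{g}$ or a curve in a leaf of the Levi kernel. -/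

import Mathlib

open scoped Topology ContDiff Matrix

/-! ### CR geometry of a real hypersurface `{ρ = 0}` in a complex vector space -/

section CRGeometry

variable {E : Type*} [NormedAddCommGroup E] [NormedSpace ℂ E]

/-- The maximal complex subspace of the tangent space `ker dρ_p` of `{ρ = 0}` at `p`.
It is identified with the fibre of the CR structure `H ⊆ ℂTM` (vectors of type `(1,0)`)
through the complex linear isomorphism `v ↦ v - i J v`, `J` being multiplication by `i` on `E`. -/
def holTangent (ρ : E → ℝ) (p : E) : Submodule ℂ E where
  carrier := {v | fderiv ℝ ρ p v = 0 ∧ fderiv ℝ ρ p (Complex.I • v) = 0}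
  zero_mem' := by simp
  add_mem' := by
    rintro v u ⟨h1, h2⟩ ⟨h3, h4⟩
    simp [smul_add, h1, h2, h3, h4]
  smul_mem' := by
    rintro c v ⟨h1, h2⟩
    have e1 : c • v = c.re • v + c.im • (Complex.I • v) := by
      conv_lhs => rw [← Complex.re_add_im c, add_smul, mul_smul]
      rfl
    have e2 : Complex.I • c • v = c.re • (Complex.I • v) - c.im • v := by
      conv_lhs => rw [← Complex.re_add_im c]
      rw [smul_smul, mul_add, add_smul, sub_eq_add_neg, mul_comm Complex.I (c.re : ℂ), mul_smul]
      have : Complex.I * ((c.im : ℂ) * Complex.I) = -(c.im : ℂ) := by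
        linear_combination (c.im : ℂ) * Complex.I_mul_I
      rw [this, neg_smul]
      rfl
    refine ⟨?_, ?_⟩
    · rw [e1, map_add, ContinuousLinearMap.map_smul, ContinuousLinearMap.map_smul, h1, h2]; simp
    · rw [e2, map_sub, ContinuousLinearMap.map_smul, ContinuousLinearMap.map_smul, h1, h2]; simp

/-- A complex vector field on `E`, i.e. a section of `ℂ ⊗ TE`, as the pair (real part, imaginary
part) of real vector fields; this is the complex bilinear extension of the Lie bracket. -/
noncomputable def complexBracket (X Y : E → E × E) : E → E × E := fun p =>
  (VectorField.lieBracket ℝ (fun q => (X q).1) (fun q => (Y q).1) p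
      - VectorField.lieBracket ℝ (fun q => (X q).2) (fun q => (Y q).2) p,
    VectorField.lieBracket ℝ (fun q => (X q).1) (fun q => (Y q).2) p
      + VectorField.lieBracket ℝ (fun q => (X q).2) (fun q => (Y q).1) p)

/-- The field `v - i J v` of type `(1,0)` determined by `v`. -/
noncomputable def holField (v : E → E) : E → E × E := fun p => (v p, -(Complex.I • v p))

/-- The field `v + i J v` of type `(0,1)`, the conjugate of `holField v`. -/
noncomputable def antiholField (v : E → E) : E → E × E := fun p => (v p, Complex.I • v p)

/-- `X` is (an extension to the ambient space of) a smooth section near `p` of the bundle `K` over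
`{ρ = 0}`. -/
def IsLocalSection (ρ : E → ℝ) (K : E → Submodule ℂ E) (p : E) (X : E → E) : Prop :=
  (∀ᶠ q in 𝓝 p, ContDiffAt ℝ ∞ X q) ∧ ∀ᶠ q in 𝓝 p, ρ q = 0 → X q ∈ K q

/-- The complex tangent vector `Z` (real part, imaginary part) lies in `H_p ⊕ conj H_p`, the
complexification of `holTangent ρ p`. -/
def InHolPlusConj (ρ : E → ℝ) (p : E) (Z : E × E) : Prop :=
  Z.1 ∈ holTangent ρ p ∧ Z.2 ∈ holTangent ρ p

/-- Multiplication by a complex scalar on `ℂ ⊗ E`, written as pairs (real part, imaginary part). -/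
noncomputable def complexScale (c : ℂ) (Z : E × E) : E × E :=
  (c.re • Z.1 - c.im • Z.2, c.re • Z.2 + c.im • Z.1)

theorem complexBracket_add {X X' Y : E → E × E} {p : E} (hX : DifferentiableAt ℝ X p)
    (hX' : DifferentiableAt ℝ X' p) :
    complexBracket (fun q => X q + X' q) Y p = complexBracket X Y p + complexBracket X' Y p := by
  ext <;> simp only [complexBracket, VectorField.lieBracket, Prod.fst_add, Prod.snd_add,
    fderiv_fun_add hX.fst hX'.fst, fderiv_fun_add hX.snd hX'.snd, map_add,
    _root_.add_apply] <;> abel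

theorem complexBracket_scale {X Y : E → E × E} {p : E} (c : ℂ) (hX : DifferentiableAt ℝ X p) :
    complexBracket (fun q => complexScale c (X q)) Y p
      = complexScale c (complexBracket X Y p) := by
  have h1 : fderiv ℝ (fun q => c.re • (X q).1 - c.im • (X q).2) p
      = c.re • fderiv ℝ (fun q => (X q).1) p - c.im • fderiv ℝ (fun q => (X q).2) p := by
    exact ((hX.fst.hasFDerivAt.const_smul c.re).sub (hX.snd.hasFDerivAt.const_smul c.im)).fderiv
  have h2 : fderiv ℝ (fun q => c.re • (X q).2 + c.im • (X q).1) p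
      = c.re • fderiv ℝ (fun q => (X q).2) p + c.im • fderiv ℝ (fun q => (X q).1) p := by
    exact ((hX.snd.hasFDerivAt.const_smul c.re).add (hX.fst.hasFDerivAt.const_smul c.im)).fderiv
  ext <;> simp only [complexBracket, complexScale, VectorField.lieBracket, h1, h2, map_add, map_sub,
    ContinuousLinearMap.map_smul, _root_.add_apply, _root_.sub_apply,
    _root_.smul_apply, smul_add, smul_sub] <;> abel

theorem complexBracket_congr {X X' Y : E → E × E} {p : E} (h : X =ᶠ[𝓝 p] X') :
    complexBracket X Y p = complexBracket X' Y p := by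
  have h1 : (fun q => (X q).1) =ᶠ[𝓝 p] fun q => (X' q).1 := h.fun_comp Prod.fst
  have h2 : (fun q => (X q).2) =ᶠ[𝓝 p] fun q => (X' q).2 := h.fun_comp Prod.snd
  simp only [complexBracket, VectorField.lieBracket, h1.fderiv_eq, h2.fderiv_eq, h1.eq_of_nhds,
    h2.eq_of_nhds]

theorem holField_add (X X' : E → E) :
    holField (fun q => X q + X' q) = fun q => holField X q + holField X' q := by
  funext q
  simp only [holField, smul_add, neg_add, Prod.mk_add_mk]

theorem complex_smul_split (c : ℂ) (v : E) :
    c • v = c.re • v + c.im • (Complex.I • v) := by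
  conv_lhs => rw [← Complex.re_add_im c, add_smul, mul_smul]
  rfl

theorem holField_smul (c : ℂ) (X : E → E) :
    holField (fun q => c • X q) = fun q => complexScale c (holField X q) := by
  funext q
  simp only [holField, complexScale]
  ext
  · rw [smul_neg, sub_neg_eq_add]
    exact complex_smul_split c (X q)
  · have h : c • Complex.I • X q = c.re • (Complex.I • X q) + c.im • (-X q) := by
      rw [complex_smul_split c (Complex.I • X q), smul_smul Complex.I Complex.I, Complex.I_mul_I,
        neg_one_smul]
    simp only
    rw [smul_comm Complex.I c, h, smul_neg, smul_neg]
    abel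

theorem contDiffAt_holField {X : E → E} {p : E} (hX : ContDiffAt ℝ ∞ X p) :
    ContDiffAt ℝ ∞ (holField X) p := by
  have h : ContDiffAt ℝ ∞ (fun q => Complex.I • X q) p := hX.const_smul Complex.I
  exact hX.prodMk h.neg

theorem contDiffAt_antiholField {X : E → E} {p : E} (hX : ContDiffAt ℝ ∞ X p) :
    ContDiffAt ℝ ∞ (antiholField X) p := by
  have h : ContDiffAt ℝ ∞ (fun q => Complex.I • X q) p := hX.const_smul Complex.I
  exact hX.prodMk h

theorem contDiffAt_complexBracket {X Y : E → E × E} {p : E} (hX : ContDiffAt ℝ ∞ X p)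
    (hY : ContDiffAt ℝ ∞ Y p) : ContDiffAt ℝ ∞ (complexBracket X Y) p := by
  have h := fun (V W : E → E) (hV : ContDiffAt ℝ ∞ V p) (hW : ContDiffAt ℝ ∞ W p) =>
    hV.lieBracket_vectorField (m := ∞) hW (by simp)
  exact ((h _ _ hX.fst hY.fst).sub (h _ _ hX.snd hY.snd)).prodMk
    ((h _ _ hX.fst hY.snd).add (h _ _ hX.snd hY.fst))

theorem InHolPlusConj.add {ρ : E → ℝ} {p : E} {Z W : E × E} (hZ : InHolPlusConj ρ p Z)
    (hW : InHolPlusConj ρ p W) : InHolPlusConj ρ p (Z + W) :=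
  ⟨add_mem hZ.1 hW.1, add_mem hZ.2 hW.2⟩

theorem InHolPlusConj.scale {ρ : E → ℝ} {p : E} {Z : E × E} (c : ℂ) (hZ : InHolPlusConj ρ p Z) :
    InHolPlusConj ρ p (complexScale c Z) := by
  have h := fun (a : ℝ) (v : E) (hv : v ∈ holTangent ρ p) =>
    (holTangent ρ p).smul_mem (a : ℂ) hv
  exact ⟨sub_mem (h _ _ hZ.1) (h _ _ hZ.2), add_mem (h _ _ hZ.2) (h _ _ hZ.1)⟩

theorem IsLocalSection.add {ρ : E → ℝ} {K : E → Submodule ℂ E} {p : E} {X X' : E → E}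
    (hX : IsLocalSection ρ K p X) (hX' : IsLocalSection ρ K p X') :
    IsLocalSection ρ K p (fun q => X q + X' q) := by
  refine ⟨?_, ?_⟩
  · filter_upwards [hX.1, hX'.1] with q h h' using h.add h'
  · filter_upwards [hX.2, hX'.2] with q h h' hq using add_mem (h hq) (h' hq)

theorem IsLocalSection.smul {ρ : E → ℝ} {K : E → Submodule ℂ E} {p : E} {X : E → E} (c : ℂ)
    (hX : IsLocalSection ρ K p X) : IsLocalSection ρ K p (fun q => c • X q) := by
  refine ⟨?_, ?_⟩
  · filter_upwards [hX.1] with q h using h.const_smul c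
  · filter_upwards [hX.2] with q h hq using Submodule.smul_mem _ c (h hq)

theorem IsLocalSection.zero (ρ : E → ℝ) (K : E → Submodule ℂ E) (p : E) :
    IsLocalSection ρ K p (fun _ => 0) :=
  ⟨.of_forall fun _ => contDiffAt_const, .of_forall fun _ _ => zero_mem _⟩

theorem complexBracket_zero (Y : E → E × E) :
    complexBracket (fun _ => 0) Y = fun _ => 0 := by
  funext p
  ext <;> simp [complexBracket, VectorField.lieBracket]

theorem holField_zero : holField (fun _ : E => (0 : E)) = fun _ => 0 := by
  funext p
  ext <;> simp [holField]

/-- The Levi kernel `K₂` at `p`, the left kernel of the Levi form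
`(X_p, Y_p) ↦ [X, conj Y]_p mod H ⊕ conj H`, `X` and `Y` running through the sections of `H = K₁`;
as a subspace of `holTangent ρ p`. -/
noncomputable def leviKernel (ρ : E → ℝ) (p : E) : Submodule ℂ E where
  carrier := {v | ∃ X : E → E, IsLocalSection ρ (holTangent ρ) p X ∧ X p = v ∧ v ∈ holTangent ρ p ∧
    ∀ Y : E → E, IsLocalSection ρ (holTangent ρ) p Y →
      InHolPlusConj ρ p (complexBracket (holField X) (antiholField Y) p)}
  zero_mem' := by
    refine ⟨fun _ => 0, .zero _ _ _, rfl, zero_mem _, fun Y _ => ?_⟩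
    rw [holField_zero, complexBracket_zero]
    exact ⟨zero_mem _, zero_mem _⟩
  add_mem' := by
    rintro _ _ ⟨X, hX, rfl, hv, h⟩ ⟨X', hX', rfl, hv', h'⟩
    refine ⟨_, hX.add hX', rfl, add_mem hv hv', fun Y hY => ?_⟩
    rw [holField_add, complexBracket_add
      ((contDiffAt_holField hX.1.self_of_nhds).differentiableAt (by simp))
      ((contDiffAt_holField hX'.1.self_of_nhds).differentiableAt (by simp))]
    exact (h Y hY).add (h' Y hY)
  smul_mem' := by
    rintro c _ ⟨X, hX, rfl, hv, h⟩
    refine ⟨_, hX.smul c, rfl, Submodule.smul_mem _ c hv, fun Y hY => ?_⟩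
    rw [holField_smul, complexBracket_scale c
      ((contDiffAt_holField hX.1.self_of_nhds).differentiableAt (by simp))]
    exact (h Y hY).scale c

/-- The next term `K₃` of the Freeman filtration at `p`, the left kernel of
`(X_p, Y_p, Y'_p) ↦ [[X, conj Y], conj Y']_p mod H ⊕ conj H`, `X` running through the sections of
the Levi kernel `K₂` and `Y`, `Y'` through those of `H`. -/
noncomputable def secondLeviKernel (ρ : E → ℝ) (p : E) : Submodule ℂ E where
  carrier := {v | ∃ X : E → E, IsLocalSection ρ (leviKernel ρ) p X ∧ X p = v ∧ v ∈ leviKernel ρ p ∧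
    ∀ Y Y' : E → E, IsLocalSection ρ (holTangent ρ) p Y → IsLocalSection ρ (holTangent ρ) p Y' →
      InHolPlusConj ρ p
        (complexBracket (complexBracket (holField X) (antiholField Y)) (antiholField Y') p)}
  zero_mem' := by
    refine ⟨fun _ => 0, .zero _ _ _, rfl, zero_mem _, fun Y Y' _ _ => ?_⟩
    rw [holField_zero, complexBracket_zero, complexBracket_zero]
    exact ⟨zero_mem _, zero_mem _⟩
  add_mem' := by
    rintro _ _ ⟨X, hX, rfl, hv, h⟩ ⟨X', hX', rfl, hv', h'⟩
    refine ⟨_, hX.add hX', rfl, add_mem hv hv', fun Y Y' hY hY' => ?_⟩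
    have e : complexBracket (holField fun q => X q + X' q) (antiholField Y) =ᶠ[𝓝 p]
        fun q => complexBracket (holField X) (antiholField Y) q
          + complexBracket (holField X') (antiholField Y) q := by
      filter_upwards [hX.1, hX'.1] with q h1 h2
      rw [holField_add, complexBracket_add
        ((contDiffAt_holField h1).differentiableAt (by simp))
        ((contDiffAt_holField h2).differentiableAt (by simp))]
    have hd := fun (V : E → E) (hV : IsLocalSection ρ (leviKernel ρ) p V) =>
      (contDiffAt_complexBracket (contDiffAt_holField hV.1.self_of_nhds)
        (contDiffAt_antiholField hY.1.self_of_nhds)).differentiableAt (by simp)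
    rw [complexBracket_congr e, complexBracket_add (hd X hX) (hd X' hX')]
    exact (h Y Y' hY hY').add (h' Y Y' hY hY')
  smul_mem' := by
    rintro c _ ⟨X, hX, rfl, hv, h⟩
    refine ⟨_, hX.smul c, rfl, Submodule.smul_mem _ c hv, fun Y Y' hY hY' => ?_⟩
    have e : complexBracket (holField fun q => c • X q) (antiholField Y) =ᶠ[𝓝 p]
        fun q => complexScale c (complexBracket (holField X) (antiholField Y) q) := by
      filter_upwards [hX.1] with q h1
      rw [holField_smul, complexBracket_scale c
        ((contDiffAt_holField h1).differentiableAt (by simp))]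
    rw [complexBracket_congr e, complexBracket_scale c
      ((contDiffAt_complexBracket (contDiffAt_holField hX.1.self_of_nhds)
        (contDiffAt_antiholField hY.1.self_of_nhds)).differentiableAt (by simp))]
    exact (h Y Y' hY hY').scale c

/-- The Levi form of `{ρ = 0}` at `p` has rank `s`: its kernel has codimension `s` in `H_p`. -/
def HasLeviRank (ρ : E → ℝ) (p : E) (s : ℕ) : Prop :=
  Module.finrank ℂ (leviKernel ρ p) + s = Module.finrank ℂ (holTangent ρ p)

/-- `{ρ = 0}` is `2`-nondegenerate at `p` (where its Levi form has locally constant rank):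
`K₂ ≠ 0` and `K₃ = 0`. -/
def IsTwoNondegenerateAt (ρ : E → ℝ) (p : E) : Prop :=
  leviKernel ρ p ≠ ⊥ ∧ secondLeviKernel ρ p = ⊥

/-- The germs at `0` of the hypersurfaces `{ρ = 0}` and `{ρ' = 0}` are equivalent under a
biholomorphism between neighbourhoods of `0` that fixes `0`. -/
def LocallyEquivalent (ρ ρ' : E → ℝ) : Prop :=
  ∃ φ : OpenPartialHomeomorph E E, 0 ∈ φ.source ∧ φ 0 = 0 ∧
    DifferentiableOn ℂ φ φ.source ∧ DifferentiableOn ℂ φ.symm φ.target ∧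
    ∀ p ∈ φ.source, ρ p = 0 ↔ ρ' (φ p) = 0

/-- `ξ` is a holomorphic vector field on `U` whose real part is tangent to `{ρ = 0}`. (As a real
vector field, twice the real part of `∑ ξⱼ ∂/∂Zⱼ` is `ξ` itself.) -/
def IsHolInfinitesimalSymmetry (ρ : E → ℝ) (U : Set E) (ξ : E → E) : Prop :=
  DifferentiableOn ℂ ξ U ∧ ∀ p ∈ U, ρ p = 0 → fderiv ℝ ρ p (ξ p) = 0

/-- `p` and `q` lie on the same leaf of the Levi kernel of `{ρ = 0} ∩ U`: they are joined in
`{ρ = 0} ∩ U` by a `C¹` curve tangent to the Levi kernel. -/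
def OnSameLeviLeaf (ρ : E → ℝ) (U : Set E) (p q : E) : Prop :=
  ∃ γ : ℝ → E, γ 0 = p ∧ γ 1 = q ∧ ContDiffOn ℝ 1 γ (Set.Icc 0 1) ∧
    ∀ t ∈ Set.Icc (0 : ℝ) 1, γ t ∈ U ∧ ρ (γ t) = 0 ∧
      derivWithin γ (Set.Icc 0 1) t ∈ leviKernel ρ (γ t)

/-- The flow of some `ξ ∈ 𝔤` carries `p` to `q` within `{ρ = 0} ∩ U`. -/
def JoinedByFlow (ρ : E → ℝ) (𝔤 : Set (E → E)) (U : Set E) (p q : E) : Prop :=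
  ∃ ξ ∈ 𝔤, ∃ γ : ℝ → E, γ 0 = p ∧ γ 1 = q ∧
    ∀ t ∈ Set.Icc (0 : ℝ) 1, γ t ∈ U ∧ ρ (γ t) = 0 ∧
      HasDerivWithinAt γ (ξ (γ t)) (Set.Icc 0 1) t

/-- A set `𝔤` of infinitesimal symmetries of `{ρ = 0}` on `U` acts locally transitively at `0` on
the local space of leaves of the Levi kernel. Infinitesimally: near `0`, the values of `𝔤` span the
tangent space `T_pM / K₂(p)` of the leaf space (the real span is taken). Locally: in every
neighbourhood of `0`, all leaves close to the leaf of `0` are in the orbit of that leaf under the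
local flows of the elements of `𝔤`. -/
def ActsLocallyTransitivelyOnLeviLeaves (ρ : E → ℝ) (𝔤 : Set (E → E)) (U : Set E) : Prop :=
  (∀ᶠ p in 𝓝 (0 : E), ρ p = 0 →
    Submodule.span ℝ {v | ∃ ξ ∈ 𝔤, v = ξ p} ⊔ (leviKernel ρ p).restrictScalars ℝ
      = LinearMap.ker (fderiv ℝ ρ p).toLinearMap) ∧
  ∀ W ∈ 𝓝 (0 : E), ∀ᶠ p in 𝓝 (0 : E), ρ p = 0 →
    Relation.ReflTransGen
      (fun q q' => OnSameLeviLeaf ρ (W ∩ U) q q' ∨ JoinedByFlow ρ 𝔤 (W ∩ U) q q') 0 p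

end CRGeometry

/-! ### The models -/

/-- The ambient space `ℂ^{n+1}` with coordinates `(w, z, ζ)`, where `n = s + r`. -/
abbrev ModelSpace (s r : ℕ) : Type := ℂ × (Fin s → ℂ) × (Fin r → ℂ)

/-- Entrywise complex conjugate of a matrix. -/
def conjMatrix {s : ℕ} (A : Matrix (Fin s) (Fin s) ℂ) : Matrix (Fin s) (Fin s) ℂ :=
  A.map (starRingEnd ℂ)

/-- The defining function of `Re w = zᵀ H(ζ, ζ̄) z̄ + Re (z̄ᵀ S(ζ, ζ̄) z̄)`, for functions `H`, `S` of
`ζ` that need not be holomorphic. (The first summand is real when `H` is Hermitian.) -/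
def modelDefiningFunction {s r : ℕ} (H S : (Fin r → ℂ) → Matrix (Fin s) (Fin s) ℂ)
    (p : ModelSpace s r) : ℝ :=
  p.1.re - ((p.2.1 ⬝ᵥ (H p.2.2 *ᵥ star p.2.1)).re
    + (star p.2.1 ⬝ᵥ (S p.2.2 *ᵥ star p.2.1)).re)

/-- `H` and `S` define (near `0`) a `2`-nondegenerate model. -/
structure IsTwoNondegenerateModel {s r : ℕ} (H S : (Fin r → ℂ) → Matrix (Fin s) (Fin s) ℂ) :
    Prop where
  analytic_H : ∀ i j, AnalyticAt ℝ (fun ζ => H ζ i j) 0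
  analytic_S : ∀ i j, AnalyticAt ℝ (fun ζ => S ζ i j) 0
  hermitian : ∀ᶠ ζ in 𝓝 (0 : Fin r → ℂ), (H ζ).IsHermitian
  symmetric : ∀ᶠ ζ in 𝓝 (0 : Fin r → ℂ), (S ζ).IsSymm
  nondegenerate : IsUnit (H 0).det
  levi_rank : ∀ᶠ p in 𝓝 (0 : ModelSpace s r), modelDefiningFunction H S p = 0 →
    HasLeviRank (modelDefiningFunction H S) p s
  two_nondegenerate : ∀ᶠ p in 𝓝 (0 : ModelSpace s r), modelDefiningFunction H S p = 0 →
    IsTwoNondegenerateAt (modelDefiningFunction H S) p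

/-- The data `H₀`, `S₀(ζ)`: `H₀` is a nondegenerate Hermitian matrix, and `S₀` is a symmetric matrix of
functions holomorphic near `0` that vanish at `0`, whose first partial derivatives at `0` are
linearly independent. -/
structure IsModelData {s r : ℕ} (H₀ : Matrix (Fin s) (Fin s) ℂ)
    (S₀ : (Fin r → ℂ) → Matrix (Fin s) (Fin s) ℂ) : Prop where
  hermitian : H₀.IsHermitian
  nondegenerate : IsUnit H₀.det
  holomorphic : ∀ i j, AnalyticAt ℂ (fun ζ => S₀ ζ i j) 0
  symmetric : ∀ᶠ ζ in 𝓝 (0 : Fin r → ℂ), (S₀ ζ).IsSymm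
  vanishing : S₀ 0 = 0
  independent : LinearIndependent ℂ fun α : Fin r =>
    (Matrix.of fun i j => fderiv ℂ (fun ζ => S₀ ζ i j) 0 (Pi.single α 1) :
      Matrix (Fin s) (Fin s) ℂ)

/-- `H(ζ, ζ̄) = ½ (H₀ (Id - S₀̄ H₀ᵀ S₀ H₀)⁻¹ + (Id - H₀ S₀̄ H₀ᵀ S₀)⁻¹ H₀)`, with `S₀ = S₀(ζ)`. -/
noncomputable def explicitH {s r : ℕ} (H₀ : Matrix (Fin s) (Fin s) ℂ)
    (S₀ : (Fin r → ℂ) → Matrix (Fin s) (Fin s) ℂ) (ζ : Fin r → ℂ) : Matrix (Fin s) (Fin s) ℂ :=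
  (1 / 2 : ℂ) • (H₀ * (1 - conjMatrix (S₀ ζ) * H₀ᵀ * S₀ ζ * H₀)⁻¹
    + (1 - H₀ * conjMatrix (S₀ ζ) * H₀ᵀ * S₀ ζ)⁻¹ * H₀)

/-- `S(ζ, ζ̄) = H₀ᵀ (Id - S₀ H₀ S₀̄ H₀ᵀ)⁻¹ S₀ H₀`, with `S₀ = S₀(ζ)`. -/
noncomputable def explicitS {s r : ℕ} (H₀ : Matrix (Fin s) (Fin s) ℂ)
    (S₀ : (Fin r → ℂ) → Matrix (Fin s) (Fin s) ℂ) (ζ : Fin r → ℂ) : Matrix (Fin s) (Fin s) ℂ :=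
  H₀ᵀ * (1 - S₀ ζ * H₀ * conjMatrix (S₀ ζ) * H₀ᵀ)⁻¹ * S₀ ζ * H₀

/-! On a rigid hypersurface Re w = F(x) a CR vector is determined by its x-component, so both
kernels can be read off the complex Hessian of F. `mem_leviKernel_graph` identifies K₂ with the null
vectors of the Levi form; `mem_secondLeviKernel_graph` says that a section X of K₂ witnesses
membership of its value in K₃ when its ∂̄-derivatives along CR vectors are Levi-null too.

Explicit models. Let k be `leafParam`. The formulas for H and S amount to F = Re zᵀH₀k with z = conj
k - S₀H₀k (`modelFunction_explicit`, `star_leafParam_sub`). Fixing conj k = c and a real constant t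
gives complex leaves ζ ↦ `leafPoint H₀ S₀ c t ζ` that fill the hypersurface (`eq_leafPoint`). Since
H₀ is Hermitian and S₀ symmetric, no derivative of k survives in 2∂F, and k is the only
nonholomorphic ingredient left. Hence v is Levi-null exactly when ∂̄k(v) = 0, that is, when v_z =
-S₀'(v_ζ)H₀k: a kernel of dimension r. Taking ∂̄ of this relation along a section X of K₂ whose
∂̄-derivatives are Levi-null gives S₀'(X_ζ) = 0, and independence of the derivatives of S₀ gives K₃
= 0. Holomorphic Heisenberg fields are tangent to the hypersurface, their flows carry 0 to nearby
leaves, and motion inside a leaf does the rest.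

Arbitrary models. H, S and conj S extend to holomorphic functions h, σ, τ of independent variables
(ζ, ω). As h is invertible, Levi rank s forces the Schur complement of h in the mixed Hessian to
vanish. This holds for ω = conj ζ, hence near 0 by the identity principle for totally real
subspaces. The Schur complement is quadratic in (z, y), and its coefficients yield h_ζω = h_ζ h⁻¹
h_ω + τ_ω h⁻ᵀ σ_ζ and companion equations for σ and τ. In the scalar case with σ = τ = 0 they say
that log h is a function of ζ plus a function of ω. In general, `IsFlatSystem.independent_of_snd`
finds four combinations of first derivatives independent of ω, and from these
`IsFlatSystem.eq_const` finds two expressions independent of ζ, so that a solution is recovered from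
its values on ω = 0 and ζ = 0.

At ω = conj ζ this reads H = h(ζ,0) P⁻¹ h(0, conj ζ), with a similar formula for conj S - τ(ζ,0)
(`normal_form_algebra`). The map (w, z, ζ) ↦ (w - zᵀτ(ζ,0)z, H₀⁻ᵀh(ζ,0)ᵀz, ζ) removes the
pluriharmonic term and normalizes the outer factors, leaving the explicit model of H₀ = H(0) and S₀
= H₀⁻ᵀ(σ(ζ,0) - σ(0))H₀⁻¹. If a derivative of S₀ at 0 in a direction c vanished, the section of K₂
with constant ζ-component c would place a vector with that component in K₃ = 0, so c = 0. -/

/-! ### CR geometry of rigid hypersurfaces: brackets and the Levi form -/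

section GraphGeometry

open Complex

variable {V : Type*} [NormedAddCommGroup V] [NormedSpace ℂ V]

/-- The defining function of the rigid hypersurface `Re w = F x` in `ℂ × V`. -/
def graphFunction (F : V → ℝ) (p : ℂ × V) : ℝ := p.1.re - F p.2

/-- Twice the holomorphic differential `∂F` at `x`. -/
noncomputable def twiceDel (F : V → ℝ) (x v : V) : ℂ :=
  (fderiv ℝ F x v : ℂ) - I * (fderiv ℝ F x (I • v) : ℂ)

/-- The real part of (four times) the complex Hessian of `F` at `x`. -/
noncomputable def leviForm (F : V → ℝ) (x v u : V) : ℝ :=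
  fderiv ℝ (fderiv ℝ F) x v u + fderiv ℝ (fderiv ℝ F) x (I • v) (I • u)

/-- Twice the derivative of `X` along the vector of type `(0,1)` determined by `v`. -/
noncomputable def twiceDbar {W W' : Type*} [NormedAddCommGroup W] [NormedSpace ℂ W]
    [NormedAddCommGroup W'] [NormedSpace ℂ W'] (X : W → W') (q v : W) : W' :=
  fderiv ℝ X q v + I • fderiv ℝ X q (I • v)

variable {F : V → ℝ} {q : ℂ × V}

theorem fderiv_graphFunction (hF : DifferentiableAt ℝ F q.2) (v : ℂ × V) :
    fderiv ℝ (graphFunction F) q v = v.1.re - fderiv ℝ F q.2 v.2 := by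
  have h1 : HasFDerivAt (fun p : ℂ × V => p.1.re)
      (reCLM.comp (ContinuousLinearMap.fst ℝ ℂ V)) q :=
    (reCLM.comp (ContinuousLinearMap.fst ℝ ℂ V)).hasFDerivAt
  have h2 : HasFDerivAt (fun p : ℂ × V => F p.2)
      ((fderiv ℝ F q.2).comp (ContinuousLinearMap.snd ℝ ℂ V)) q :=
    HasFDerivAt.comp q hF.hasFDerivAt (ContinuousLinearMap.snd ℝ ℂ V).hasFDerivAt
  have h3 : fderiv ℝ (graphFunction F) q = _ := (h1.sub h2).fderiv
  rw [h3]
  rfl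

/-- Tangency of `v` fixes the real part of `v.1`, and tangency of `I • v` its imaginary part. -/
theorem mem_holTangent_graph (hF : DifferentiableAt ℝ F q.2) (v : ℂ × V) :
    v ∈ holTangent (graphFunction F) q ↔ v.1 = twiceDel F q.2 v.2 := by
  change (fderiv ℝ (graphFunction F) q v = 0 ∧ fderiv ℝ (graphFunction F) q (I • v) = 0) ↔ _
  rw [fderiv_graphFunction hF, fderiv_graphFunction hF, Complex.ext_iff]
  simp [twiceDel]
  constructor
  · rintro ⟨h1, h2⟩
    constructor <;> linarith
  · rintro ⟨h1, h2⟩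
    constructor <;> linarith

/-- Composing with a retraction onto the hypersurface turns vanishing on the hypersurface into
vanishing near `q`, and the differential of the retraction at `q` fixes tangent vectors. -/
theorem fderiv_eq_zero_of_vanishing {W : Type*} [NormedAddCommGroup W] [NormedSpace ℝ W]
    (hF : DifferentiableAt ℝ F q.2) (hq : graphFunction F q = 0) {f : ℂ × V → W}
    (hf : DifferentiableAt ℝ f q) (h0 : ∀ᶠ p in 𝓝 q, graphFunction F p = 0 → f p = 0)
    {y : ℂ × V} (hy : fderiv ℝ (graphFunction F) q y = 0) : fderiv ℝ f q y = 0 := by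
  -- The retraction keeps `x` and Im w and replaces Re w by `F x`.
  let G : ℂ × V → ℂ × V := fun p => (ofRealCLM (F p.2) + imCLM p.1 • I, p.2)
  have h2 : HasFDerivAt (fun p : ℂ × V => F p.2)
      ((fderiv ℝ F q.2).comp (ContinuousLinearMap.snd ℝ ℂ V)) q :=
    HasFDerivAt.comp q hF.hasFDerivAt (ContinuousLinearMap.snd ℝ ℂ V).hasFDerivAt
  have h3 : HasFDerivAt (fun p : ℂ × V => imCLM p.1)
      (imCLM.comp (ContinuousLinearMap.fst ℝ ℂ V)) q :=
    (imCLM.comp (ContinuousLinearMap.fst ℝ ℂ V)).hasFDerivAt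
  have hG := ((ofRealCLM.hasFDerivAt.comp q h2).add (h3.smul_const I)).prodMk
    (ContinuousLinearMap.snd ℝ ℂ V).hasFDerivAt (x := q)
  have hGG : HasFDerivAt G _ q := hG
  have hqre : q.1.re = F q.2 := sub_eq_zero.mp hq
  have hGq : G q = q := by
    ext
    · simp only [G, ofRealCLM_apply, imCLM_apply, ← hqre, real_smul, re_add_im]
    · rfl
  have hGM : ∀ p, graphFunction F (G p) = 0 := by
    intro p
    simp [G, graphFunction]
  have hcomp : HasFDerivAt (f ∘ G) _ q :=
    HasFDerivAt.comp q (by rw [hGq]; exact hf.hasFDerivAt) hGG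
  have hz : f ∘ G =ᶠ[𝓝 q] fun _ => (0 : W) := by
    have ht : Filter.Tendsto G (𝓝 q) (𝓝 q) := by
      have := hGG.continuousAt
      rwa [ContinuousAt, hGq] at this
    filter_upwards [ht.eventually h0] with p hp using hp (hGM p)
  have hy' := hcomp.unique ((hasFDerivAt_const (0 : W) q).congr_of_eventuallyEq hz)
  have hy2 := congrArg (fun L => L y) hy'
  rw [fderiv_graphFunction hF, sub_eq_zero] at hy
  have hyy : ((fderiv ℝ F q.2 y.2 : ℝ) : ℂ) + (y.1.im : ℂ) * I = y.1 := by
    rw [← hy, re_add_im]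
  simpa [hyy] using hy2

theorem fderiv_twice_symm (hF : ContDiffAt ℝ ∞ F q.2) (v u : V) :
    fderiv ℝ (fderiv ℝ F) q.2 v u = fderiv ℝ (fderiv ℝ F) q.2 u v :=
  (hF.isSymmSndFDerivAt (by simpa using ENat.LEInfty.out)).eq v u

theorem differentiableAt_fderiv (hF : ContDiffAt ℝ ∞ F q.2) :
    DifferentiableAt ℝ (fderiv ℝ F) q.2 :=
  (hF.fderiv_right (m := ∞) (by simp)).differentiableAt (by simp)

/-- The derivative of a tangent vector field along a tangent vector. -/
theorem fderiv_graphFunction_fderiv (hF : ContDiffAt ℝ ∞ F q.2) (hq : graphFunction F q = 0)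
    {X : ℂ × V → ℂ × V} (hX : DifferentiableAt ℝ X q)
    (hXT : ∀ᶠ p in 𝓝 q, graphFunction F p = 0 → fderiv ℝ (graphFunction F) p (X p) = 0)
    {y : ℂ × V} (hy : fderiv ℝ (graphFunction F) q y = 0) :
    fderiv ℝ (graphFunction F) q (fderiv ℝ X q y)
      = fderiv ℝ (fderiv ℝ F) q.2 y.2 (X q).2 := by
  have hF1 : DifferentiableAt ℝ F q.2 := hF.differentiableAt (by simp)
  have hD : HasFDerivAt (fun p : ℂ × V => fderiv ℝ F p.2)
      ((fderiv ℝ (fderiv ℝ F) q.2).comp (ContinuousLinearMap.snd ℝ ℂ V)) q :=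
    HasFDerivAt.comp q (differentiableAt_fderiv hF).hasFDerivAt
      (ContinuousLinearMap.snd ℝ ℂ V).hasFDerivAt
  have h1 : HasFDerivAt (fun p => (X p).1.re)
      (reCLM.comp ((ContinuousLinearMap.fst ℝ ℂ V).comp (fderiv ℝ X q))) q :=
    (reCLM.comp (ContinuousLinearMap.fst ℝ ℂ V)).hasFDerivAt.comp q hX.hasFDerivAt
  have h2 : HasFDerivAt (fun p => (X p).2)
      ((ContinuousLinearMap.snd ℝ ℂ V).comp (fderiv ℝ X q)) q :=
    (ContinuousLinearMap.snd ℝ ℂ V).hasFDerivAt.comp q hX.hasFDerivAt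
  -- Product rule for `p ↦ dρ_p (X p)`. This function vanishes on the hypersurface, so its
  -- derivative along `y` is zero, which leaves the Hessian term.
  have h3 := h1.sub (hD.clm_apply h2)
  have hev : ∀ᶠ p : ℂ × V in 𝓝 q, DifferentiableAt ℝ F p.2 := by
    have : ∀ᶠ x in 𝓝 q.2, DifferentiableAt ℝ F x := by
      filter_upwards [(hF.of_le (m := 1) (by simp)).eventually (by simp)] with x hx
        using hx.differentiableAt (by simp)
    exact continuousAt_snd.eventually this
  have h4 := fderiv_eq_zero_of_vanishing hF1 hq h3.differentiableAt
    (by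
      filter_upwards [hXT, hev] with p hp hFp hMp
      have := hp hMp
      rwa [fderiv_graphFunction hFp] at this) hy
  rw [h3.fderiv] at h4
  rw [fderiv_graphFunction hF1]
  simp at h4
  linarith

variable {X Y : ℂ × V → ℂ × V}

theorem IsLocalSection.differentiableAt {E : Type*} [NormedAddCommGroup E] [NormedSpace ℂ E]
    {ρ : E → ℝ} {K : E → Submodule ℂ E} {p : E} {X : E → E} (h : IsLocalSection ρ K p X) :
    DifferentiableAt ℝ X p :=
  h.1.self_of_nhds.differentiableAt (by simp)

theorem IsLocalSection.eventually {E : Type*} [NormedAddCommGroup E] [NormedSpace ℂ E]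
    {ρ : E → ℝ} {K : E → Submodule ℂ E} {p : E} {X : E → E} (h : IsLocalSection ρ K p X) :
    ∀ᶠ q in 𝓝 p, IsLocalSection ρ K q X := by
  filter_upwards [h.1.eventually_nhds, h.2.eventually_nhds] with q h1 h2 using ⟨h1, h2⟩

theorem fderiv_const_I_smul {E : Type*} [NormedAddCommGroup E] [NormedSpace ℂ E] {X : E → E} {q : E}
    (hX : DifferentiableAt ℝ X q) (y : E) :
    fderiv ℝ (fun p => I • X p) q y = I • fderiv ℝ X q y := by
  rw [fderiv_fun_const_smul hX]
  rfl

/-- The second identity is the first one for `I • X`, which is tangent as well. -/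
theorem fderiv_section (hF : ContDiffAt ℝ ∞ F q.2) (hq : graphFunction F q = 0)
    (hX : IsLocalSection (graphFunction F) (holTangent (graphFunction F)) q X) {y : ℂ × V}
    (hy : fderiv ℝ (graphFunction F) q y = 0) :
    fderiv ℝ (graphFunction F) q (fderiv ℝ X q y)
        = fderiv ℝ (fderiv ℝ F) q.2 y.2 (X q).2 ∧
      fderiv ℝ (graphFunction F) q (I • fderiv ℝ X q y)
        = fderiv ℝ (fderiv ℝ F) q.2 y.2 (I • (X q).2) := by
  refine ⟨fderiv_graphFunction_fderiv hF hq hX.differentiableAt ?_ hy, ?_⟩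
  · filter_upwards [hX.2] with p hp hMp using (hp hMp).1
  · rw [← fderiv_const_I_smul hX.differentiableAt]
    exact fderiv_graphFunction_fderiv hF hq (hX.differentiableAt.const_smul I)
      (by filter_upwards [hX.2] with p hp hMp using (hp hMp).2) hy

theorem leviForm_symm (hF : ContDiffAt ℝ ∞ F q.2) (v u : V) :
    leviForm F q.2 v u = leviForm F q.2 u v := by
  rw [leviForm, leviForm, fderiv_twice_symm hF, fderiv_twice_symm hF (I • v)]

theorem leviForm_I_smul (x v u : V) : leviForm F x (I • v) u = - leviForm F x v (I • u) := by
  simp only [leviForm, smul_smul, I_mul_I, neg_one_smul, map_neg, _root_.neg_apply]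
  ring

/-- The Levi form measures how far ∂̄-differentiation moves a section out of the CR bundle: by
`fderiv_section` the normal part of each derivative of `X` is a Hessian term of `F`, and these terms
assemble into `leviForm`. -/
theorem twiceDbar_mem_holTangent (hF : ContDiffAt ℝ ∞ F q.2) (hq : graphFunction F q = 0)
    (hX : IsLocalSection (graphFunction F) (holTangent (graphFunction F)) q X) {y : ℂ × V}
    (hy : y ∈ holTangent (graphFunction F) q) :
    twiceDbar X q y ∈ holTangent (graphFunction F) q ↔
      leviForm F q.2 y.2 (X q).2 = 0 ∧ leviForm F q.2 (I • y.2) (X q).2 = 0 := by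
  obtain ⟨h1, h2⟩ := fderiv_section hF hq hX hy.1
  obtain ⟨h3, h4⟩ := fderiv_section hF hq hX hy.2
  change (fderiv ℝ (graphFunction F) q _ = 0 ∧ fderiv ℝ (graphFunction F) q (I • _) = 0) ↔ _
  simp only [twiceDbar, smul_add, smul_smul, I_mul_I, neg_one_smul, map_add, map_neg, h1, h2, h3,
    h4, leviForm, Prod.smul_snd, _root_.neg_apply]
  constructor
  · rintro ⟨a, b⟩
    constructor <;> linarith
  · rintro ⟨a, b⟩
    constructor <;> linarith

/-- With `P = twiceDbar Y q (X q)` and `Q = twiceDbar X q (Y q)` the value is `antiholField` of `P`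
plus `holField` of `-Q`, so the two type components are visible. -/
theorem complexBracket_hol_antihol {E : Type*} [NormedAddCommGroup E] [NormedSpace ℂ E]
    {X Y : E → E} {q : E} (hX : DifferentiableAt ℝ X q) (hY : DifferentiableAt ℝ Y q) :
    complexBracket (holField X) (antiholField Y) q =
      (twiceDbar Y q (X q) - twiceDbar X q (Y q),
        I • (twiceDbar Y q (X q) + twiceDbar X q (Y q))) := by
  have h1 : fderiv ℝ (fun p => -(I • X p)) q = -fderiv ℝ (fun p => I • X p) q :=
    fderiv_fun_neg
  ext <;> simp only [complexBracket, holField, antiholField, VectorField.lieBracket, h1,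
    fderiv_const_I_smul hX, fderiv_const_I_smul hY, twiceDbar, _root_.neg_apply, map_neg, smul_add,
    smul_neg, smul_smul, I_mul_I, neg_one_smul] <;> abel

/-- The second component is `I` times the first: the bracket is again of type (0,1). -/
theorem complexBracket_antihol_antihol {E : Type*} [NormedAddCommGroup E] [NormedSpace ℂ E]
    {X Y : E → E} {q : E} (hX : DifferentiableAt ℝ X q) (hY : DifferentiableAt ℝ Y q) :
    complexBracket (antiholField X) (antiholField Y) q =
      ((fderiv ℝ Y q (X q) - fderiv ℝ X q (Y q))
          - (I • fderiv ℝ Y q (I • X q) - I • fderiv ℝ X q (I • Y q)),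
        I • ((fderiv ℝ Y q (X q) - fderiv ℝ X q (Y q))
          - (I • fderiv ℝ Y q (I • X q) - I • fderiv ℝ X q (I • Y q)))) := by
  ext <;> simp only [complexBracket, antiholField, VectorField.lieBracket,
    fderiv_const_I_smul hX, fderiv_const_I_smul hY, smul_sub,
    smul_smul, I_mul_I, neg_one_smul]
  all_goals abel

/-- The (1,0)- and (0,1)-parts of the bracket are tangent under one and the same condition, because
the Levi form is symmetric. -/
theorem inHolPlusConj_hol_antihol_iff (hF : ContDiffAt ℝ ∞ F q.2) (hq : graphFunction F q = 0)
    (hX : IsLocalSection (graphFunction F) (holTangent (graphFunction F)) q X)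
    (hY : IsLocalSection (graphFunction F) (holTangent (graphFunction F)) q Y) :
    InHolPlusConj (graphFunction F) q (complexBracket (holField X) (antiholField Y) q) ↔
      leviForm F q.2 (X q).2 (Y q).2 = 0 ∧ leviForm F q.2 (X q).2 (I • (Y q).2) = 0 := by
  have hXq := hX.2.self_of_nhds hq
  have hYq := hY.2.self_of_nhds hq
  have h1 := twiceDbar_mem_holTangent hF hq hX hYq
  have h2 := twiceDbar_mem_holTangent hF hq hY hXq
  rw [leviForm_symm hF, leviForm_symm hF (I • (Y q).2)] at h1
  rw [leviForm_I_smul, neg_eq_zero] at h2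
  rw [complexBracket_hol_antihol hX.differentiableAt hY.differentiableAt]
  set P := twiceDbar Y q (X q)
  set Q := twiceDbar X q (Y q)
  constructor
  · rintro ⟨a, b⟩
    rw [← h1]
    -- `-I` times the second component is `P + Q`; half its difference with `P - Q` is `Q`.
    have b' := Submodule.smul_mem _ (-I) b
    rw [smul_smul] at b'
    simp only [neg_mul, I_mul_I, neg_neg, one_smul] at b'
    have c := Submodule.smul_mem _ (1 / 2 : ℂ) (sub_mem b' a)
    have e : (1 / 2 : ℂ) • (P + Q - (P - Q)) = Q := by module
    rwa [e] at c
  · intro h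
    have a := h1.mpr h
    have b := h2.mpr h
    exact ⟨sub_mem b a, Submodule.smul_mem _ _ (add_mem b a)⟩

/-- Formal integrability of the CR structure: the normal part is an alternating combination of
second derivatives of `F` and cancels by their symmetry. -/
theorem inHolPlusConj_antihol_antihol (hF : ContDiffAt ℝ ∞ F q.2) (hq : graphFunction F q = 0)
    (hX : IsLocalSection (graphFunction F) (holTangent (graphFunction F)) q X)
    (hY : IsLocalSection (graphFunction F) (holTangent (graphFunction F)) q Y) :
    InHolPlusConj (graphFunction F) q (complexBracket (antiholField X) (antiholField Y) q) := by
  have hXq := hX.2.self_of_nhds hq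
  have hYq := hY.2.self_of_nhds hq
  obtain ⟨h1, h2⟩ := fderiv_section hF hq hX hYq.1
  obtain ⟨h3, h4⟩ := fderiv_section hF hq hX hYq.2
  obtain ⟨k1, k2⟩ := fderiv_section hF hq hY hXq.1
  obtain ⟨k3, k4⟩ := fderiv_section hF hq hY hXq.2
  have hm : (fderiv ℝ Y q (X q) - fderiv ℝ X q (Y q))
          - (I • fderiv ℝ Y q (I • X q) - I • fderiv ℝ X q (I • Y q))
      ∈ holTangent (graphFunction F) q := by
    change fderiv ℝ (graphFunction F) q _ = 0 ∧ fderiv ℝ (graphFunction F) q (I • _) = 0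
    simp only [smul_sub, smul_smul, I_mul_I, neg_one_smul, map_sub, map_neg, h1, h2, h3, h4, k1,
      k2, k3, k4, Prod.smul_snd]
    rw [fderiv_twice_symm hF (Y q).2 (X q).2, fderiv_twice_symm hF (I • (Y q).2) (I • (X q).2),
      fderiv_twice_symm hF (Y q).2 (I • (X q).2), fderiv_twice_symm hF (I • (Y q).2) (X q).2]
    constructor <;> ring
  rw [complexBracket_antihol_antihol hX.differentiableAt hY.differentiableAt]
  exact ⟨hm, Submodule.smul_mem _ _ hm⟩

theorem eventually_contDiffAt_snd (hF : ∀ᶠ x in 𝓝 q.2, ContDiffAt ℝ ∞ F x) :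
    ∀ᶠ p : ℂ × V in 𝓝 q, ContDiffAt ℝ ∞ F p.2 :=
  continuousAt_snd.eventually hF

/-- A smooth map to `V` lifts to a section of the CR bundle. -/
theorem isLocalSection_lift (hF : ∀ᶠ x in 𝓝 q.2, ContDiffAt ℝ ∞ F x) {e : V → V}
    (he : ∀ᶠ x in 𝓝 q.2, ContDiffAt ℝ ∞ e x) :
    IsLocalSection (graphFunction F) (holTangent (graphFunction F)) q
      (fun p => (twiceDel F p.2 (e p.2), e p.2)) := by
  have he' : ∀ᶠ p : ℂ × V in 𝓝 q, ContDiffAt ℝ ∞ e p.2 := continuousAt_snd.eventually he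
  constructor
  · filter_upwards [eventually_contDiffAt_snd hF, he'] with p hp hep
    have h1 : ContDiffAt ℝ ∞ (fun p : ℂ × V => e p.2) p := hep.comp p contDiffAt_snd
    have h2 : ContDiffAt ℝ ∞ (fun p : ℂ × V => fderiv ℝ F p.2) p :=
      ContDiffAt.comp p (hp.fderiv_right (m := ∞) (by simp)) contDiffAt_snd
    refine ContDiffAt.prodMk ?_ h1
    have h3 : ContDiffAt ℝ ∞ (fun p : ℂ × V => fderiv ℝ F p.2 (e p.2)) p := h2.clm_apply h1
    have h4 : ContDiffAt ℝ ∞ (fun p : ℂ × V => fderiv ℝ F p.2 (I • e p.2)) p :=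
      h2.clm_apply (h1.const_smul I)
    exact (ofRealCLM.contDiff.contDiffAt.comp p h3).sub
      (contDiffAt_const.mul (ofRealCLM.contDiff.contDiffAt.comp p h4))
  · filter_upwards [eventually_contDiffAt_snd hF] with p hp _
    rw [mem_holTangent_graph (hp.differentiableAt (by simp))]

/-- The bracket condition only involves values at `q`, so it can be tested on lifts of constant
vectors. -/
theorem mem_leviKernel_graph (hF : ∀ᶠ x in 𝓝 q.2, ContDiffAt ℝ ∞ F x) (hq : graphFunction F q = 0)
    (v : ℂ × V) :
    v ∈ leviKernel (graphFunction F) q ↔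
      v ∈ holTangent (graphFunction F) q ∧ ∀ u, leviForm F q.2 v.2 u = 0 := by
  have hFq := hF.self_of_nhds
  have hs := fun v => isLocalSection_lift hF (e := fun _ => v)
    (Filter.Eventually.of_forall fun _ => contDiffAt_const)
  constructor
  · rintro ⟨X, hX, rfl, hv, h⟩
    refine ⟨hv, fun u => ?_⟩
    exact ((inHolPlusConj_hol_antihol_iff hFq hq hX (hs u)).mp (h _ (hs u))).1
  · rintro ⟨hv, h⟩
    have hv' := (mem_holTangent_graph (hFq.differentiableAt (by simp)) v).mp hv
    refine ⟨_, hs v.2, by ext <;> simp [hv'], hv, fun Y hY => ?_⟩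
    rw [inHolPlusConj_hol_antihol_iff hFq hq (hs v.2) hY]
    exact ⟨h _, h _⟩

theorem IsLocalSection.of_leviKernel
    (hX : IsLocalSection (graphFunction F) (leviKernel (graphFunction F)) q X) :
    IsLocalSection (graphFunction F) (holTangent (graphFunction F)) q X := by
  refine ⟨hX.1, ?_⟩
  filter_upwards [hX.2] with p hp hMp
  obtain ⟨_, _, _, h, _⟩ := hp hMp
  exact h

/-- The double bracket in the definition of `K₃` in terms of the Levi form. -/
theorem inHolPlusConj_double_bracket_iff (hF : ∀ᶠ x in 𝓝 q.2, ContDiffAt ℝ ∞ F x)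
    (hq : graphFunction F q = 0)
    (hX : IsLocalSection (graphFunction F) (leviKernel (graphFunction F)) q X)
    (hY : IsLocalSection (graphFunction F) (holTangent (graphFunction F)) q Y)
    {Y' : ℂ × V → ℂ × V}
    (hY' : IsLocalSection (graphFunction F) (holTangent (graphFunction F)) q Y') :
    InHolPlusConj (graphFunction F) q
        (complexBracket (complexBracket (holField X) (antiholField Y)) (antiholField Y') q) ↔
      leviForm F q.2 (twiceDbar X q (Y q)).2 (Y' q).2 = 0 ∧
      leviForm F q.2 (twiceDbar X q (Y q)).2 (I • (Y' q).2) = 0 := by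
  have hXH := hX.of_leviKernel
  set Z := complexBracket (holField X) (antiholField Y) with hZ
  -- `U` and `T` represent the (1,0)- and (0,1)-parts of the first bracket. They are CR sections
  -- because `X` lies in the Levi kernel at all nearby points of the hypersurface.
  let U : ℂ × V → ℂ × V := fun p => (1 / 2 : ℂ) • ((Z p).1 + I • (Z p).2)
  let T : ℂ × V → ℂ × V := fun p => (1 / 2 : ℂ) • ((Z p).1 - I • (Z p).2)
  have hZs : ∀ᶠ p in 𝓝 q, ContDiffAt ℝ ∞ Z p := by
    filter_upwards [hX.1, hY.1] with p h1 h2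
    exact contDiffAt_complexBracket (contDiffAt_holField h1) (contDiffAt_antiholField h2)
  have hZM : ∀ᶠ p in 𝓝 q, graphFunction F p = 0 → InHolPlusConj (graphFunction F) p (Z p) := by
    filter_upwards [hX.2, hX.eventually, hY.eventually, continuousAt_snd.eventually
      hF.eventually_nhds] with p h1 h2 h3 h4 hMp
    rw [hZ, inHolPlusConj_hol_antihol_iff h4.self_of_nhds hMp h2.of_leviKernel h3]
    have h5 := ((mem_leviKernel_graph h4 hMp _).mp (h1 hMp)).2
    exact ⟨h5 _, h5 _⟩
  have hU : IsLocalSection (graphFunction F) (holTangent (graphFunction F)) q U := by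
    constructor
    · filter_upwards [hZs] with p hp
      exact (hp.fst.add (hp.snd.const_smul I)).const_smul _
    · filter_upwards [hZM] with p hp hMp
      exact Submodule.smul_mem _ _ (add_mem (hp hMp).1 (Submodule.smul_mem _ _ (hp hMp).2))
  have hT : IsLocalSection (graphFunction F) (holTangent (graphFunction F)) q T := by
    constructor
    · filter_upwards [hZs] with p hp
      exact (hp.fst.sub (hp.snd.const_smul I)).const_smul _
    · filter_upwards [hZM] with p hp hMp
      exact Submodule.smul_mem _ _ (sub_mem (hp hMp).1 (Submodule.smul_mem _ _ (hp hMp).2))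
  have hsplit : Z = fun p => holField U p + antiholField T p := by
    funext p
    refine Prod.ext ?_ ?_
    · change (Z p).1 = U p + T p
      simp only [U, T]
      module
    · change (Z p).2 = -(I • U p) + I • T p
      have e : -(I • U p) + I • T p = -((I * I) • (Z p).2) := by
        simp only [U, T]
        module
      rw [e, I_mul_I]
      simp
  have hFq := hF.self_of_nhds
  have hUq : U q = -twiceDbar X q (Y q) := by
    simp only [U, hZ, complexBracket_hol_antihol hX.differentiableAt hY.differentiableAt]
    rw [smul_smul, I_mul_I]
    module
  -- The (0,1)-part contributes nothing modulo H ⊕ conj H, so only `U` matters, and its value at `q`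
  -- is `-twiceDbar X q (Y q)`.
  have h2 := inHolPlusConj_antihol_antihol hFq hq hT hY'
  have h3 := inHolPlusConj_hol_antihol_iff hFq hq hU hY'
  have hneg : ∀ u, leviForm F q.2 (U q).2 u
      = - leviForm F q.2 (twiceDbar X q (Y q)).2 u := by
    intro u
    simp only [leviForm, hUq, Prod.snd_neg, smul_neg, map_neg, _root_.neg_apply]
    ring
  rw [hneg, hneg, neg_eq_zero, neg_eq_zero] at h3
  rw [← h3, hsplit, complexBracket_add
    ((contDiffAt_holField hU.1.self_of_nhds).differentiableAt (by simp))
    ((contDiffAt_antiholField hT.1.self_of_nhds).differentiableAt (by simp))]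
  constructor
  · rintro ⟨a, b⟩
    refine ⟨?_, ?_⟩
    · have := sub_mem a h2.1
      rwa [Prod.fst_add, add_sub_cancel_right] at this
    · have := sub_mem b h2.2
      rwa [Prod.snd_add, add_sub_cancel_right] at this
  · intro h
    exact h.add h2

/-- `Y` and `Y'` enter the double bracket only through their values at `q`, so constant lifts
suffice. `X` enters through its first derivative and stays quantified. -/
theorem mem_secondLeviKernel_graph (hF : ∀ᶠ x in 𝓝 q.2, ContDiffAt ℝ ∞ F x)
    (hq : graphFunction F q = 0) (v : ℂ × V) :
    v ∈ secondLeviKernel (graphFunction F) q ↔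
      ∃ X, IsLocalSection (graphFunction F) (leviKernel (graphFunction F)) q X ∧ X q = v ∧
        ∀ y ∈ holTangent (graphFunction F) q, ∀ u, leviForm F q.2 (twiceDbar X q y).2 u = 0 := by
  have hFq := hF.self_of_nhds
  have hs := fun v => isLocalSection_lift hF (e := fun _ => v)
    (Filter.Eventually.of_forall fun _ => contDiffAt_const)
  have hv' := fun v => mem_holTangent_graph (hFq.differentiableAt (by simp)) v
  constructor
  · rintro ⟨X, hX, rfl, -, h⟩
    refine ⟨X, hX, rfl, fun y hy u => ?_⟩
    have h1 := ((inHolPlusConj_double_bracket_iff hF hq hX (hs y.2) (hs u)).mp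
      (h _ _ (hs y.2) (hs u))).1
    have h2 : y = (twiceDel F q.2 y.2, y.2) := by
      rw [← (hv' y).mp hy]
    rwa [← h2] at h1
  · rintro ⟨X, hX, rfl, h⟩
    refine ⟨X, hX, rfl, hX.2.self_of_nhds hq, fun Y Y' hY hY' => ?_⟩
    rw [inHolPlusConj_double_bracket_iff hF hq hX hY hY']
    have := h (Y q) (hY.2.self_of_nhds hq)
    exact ⟨this _, this _⟩

end GraphGeometry

/-! ### Calculus of matrix-valued functions -/

section MatrixCalculus

open scoped Matrix.Norms.Operator

variable {𝕜 : Type*} [NontriviallyNormedField 𝕜] [NormedAlgebra 𝕜 ℂ] {E : Type*}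
  [NormedAddCommGroup E] [NormedSpace 𝕜 E] {s : ℕ} {p : E}

theorem isBoundedBilinearMap_mulVec :
    IsBoundedBilinearMap 𝕜
      (fun x : Matrix (Fin s) (Fin s) ℂ × (Fin s → ℂ) => x.1 *ᵥ x.2) where
  add_left := fun _ _ _ => Matrix.add_mulVec _ _ _
  smul_left := fun _ _ _ => Matrix.smul_mulVec _ _ _
  add_right := fun _ _ _ => Matrix.mulVec_add _ _ _
  smul_right := fun _ _ _ => Matrix.mulVec_smul _ _ _
  bound := ⟨1, one_pos, fun A v => by simpa using Matrix.linfty_opNorm_mulVec A v⟩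

theorem isBoundedBilinearMap_dotProduct :
    IsBoundedBilinearMap 𝕜 (fun x : (Fin s → ℂ) × (Fin s → ℂ) => x.1 ⬝ᵥ x.2) where
  add_left := fun _ _ _ => add_dotProduct _ _ _
  smul_left := fun _ _ _ => smul_dotProduct _ _ _
  add_right := fun _ _ _ => dotProduct_add _ _ _
  smul_right := fun _ _ _ => dotProduct_smul _ _ _
  -- `s + 1` instead of `s` keeps the constant positive when `s = 0`.
  bound := ⟨s + 1, by positivity, fun u v => by
    calc ‖u ⬝ᵥ v‖ ≤ ∑ i : Fin s, ‖u‖ * ‖v‖ := by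
          refine norm_sum_le_of_le _ fun i _ => ?_
          rw [norm_mul]
          exact mul_le_mul (norm_le_pi_norm u i) (norm_le_pi_norm v i) (norm_nonneg _)
            (norm_nonneg _)
      _ = s * (‖u‖ * ‖v‖) := by simp
      _ ≤ (s + 1) * ‖u‖ * ‖v‖ := by
          nlinarith [mul_nonneg (norm_nonneg u) (norm_nonneg v)]⟩

theorem IsBoundedBilinearMap.analyticAt {𝕝 : Type*} [NontriviallyNormedField 𝕝] {F G W : Type*}
    [NormedAddCommGroup F] [NormedSpace 𝕝 F] [NormedAddCommGroup G] [NormedSpace 𝕝 G] [NormedAddCommGroup W] [NormedSpace 𝕝 W]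
    {b : F × G → W} (hb : IsBoundedBilinearMap 𝕝 b) (x : F × G) : AnalyticAt 𝕝 b x :=
  hb.toContinuousLinearMap.analyticAt_bilinear x

section

variable {A : E → Matrix (Fin s) (Fin s) ℂ} {f g : E → Fin s → ℂ}

theorem AnalyticAt.mulVec (hA : AnalyticAt 𝕜 A p) (hf : AnalyticAt 𝕜 f p) :
    AnalyticAt 𝕜 (fun x => A x *ᵥ f x) p :=
  AnalyticAt.fun_comp (g := fun x : Matrix (Fin s) (Fin s) ℂ × (Fin s → ℂ) => x.1 *ᵥ x.2)
    (isBoundedBilinearMap_mulVec.analyticAt _) (hA.prod hf)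

theorem AnalyticAt.dotProduct (hg : AnalyticAt 𝕜 g p) (hf : AnalyticAt 𝕜 f p) :
    AnalyticAt 𝕜 (fun x => g x ⬝ᵥ f x) p :=
  AnalyticAt.fun_comp (g := fun x : (Fin s → ℂ) × (Fin s → ℂ) => x.1 ⬝ᵥ x.2)
    (isBoundedBilinearMap_dotProduct.analyticAt _) (hg.prod hf)

theorem DifferentiableAt.mulVec (hA : DifferentiableAt 𝕜 A p) (hf : DifferentiableAt 𝕜 f p) :
    DifferentiableAt 𝕜 (fun x => A x *ᵥ f x) p :=
  DifferentiableAt.comp (g := fun x : Matrix (Fin s) (Fin s) ℂ × (Fin s → ℂ) => x.1 *ᵥ x.2) p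
    (isBoundedBilinearMap_mulVec.differentiableAt _) (hA.prodMk hf)

theorem DifferentiableAt.dotProduct (hg : DifferentiableAt 𝕜 g p) (hf : DifferentiableAt 𝕜 f p) :
    DifferentiableAt 𝕜 (fun x => g x ⬝ᵥ f x) p :=
  DifferentiableAt.comp (g := fun x : (Fin s → ℂ) × (Fin s → ℂ) => x.1 ⬝ᵥ x.2) p
    (isBoundedBilinearMap_dotProduct.differentiableAt _) (hg.prodMk hf)

theorem fderiv_mulVec (hA : DifferentiableAt 𝕜 A p) (hf : DifferentiableAt 𝕜 f p) (v : E) :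
    fderiv 𝕜 (fun x => A x *ᵥ f x) p v = A p *ᵥ fderiv 𝕜 f p v + fderiv 𝕜 A p v *ᵥ f p := by
  have h := HasFDerivAt.comp p
    ((isBoundedBilinearMap_mulVec (𝕜 := 𝕜) (s := s)).hasFDerivAt (A p, f p))
    (hA.hasFDerivAt.prodMk hf.hasFDerivAt)
  have h' : HasFDerivAt (fun x => A x *ᵥ f x) _ p := h
  rw [h'.fderiv]
  rfl

theorem fderiv_dotProduct (hg : DifferentiableAt 𝕜 g p) (hf : DifferentiableAt 𝕜 f p) (v : E) :
    fderiv 𝕜 (fun x => g x ⬝ᵥ f x) p v = g p ⬝ᵥ fderiv 𝕜 f p v + fderiv 𝕜 g p v ⬝ᵥ f p := by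
  have h := HasFDerivAt.comp p
    ((isBoundedBilinearMap_dotProduct (𝕜 := 𝕜) (s := s)).hasFDerivAt (g p, f p))
    (hg.hasFDerivAt.prodMk hf.hasFDerivAt)
  have h' : HasFDerivAt (fun x => g x ⬝ᵥ f x) _ p := h
  rw [h'.fderiv]
  rfl

/-- An entry, as a continuous linear functional of the matrix. -/
noncomputable def matrixEntry (𝕜 : Type*) [NontriviallyNormedField 𝕜] [NormedAlgebra 𝕜 ℂ] {s : ℕ}
    (i j : Fin s) : Matrix (Fin s) (Fin s) ℂ →L[𝕜] ℂ :=
  (Matrix.entryLinearMap 𝕜 ℂ i j).mkContinuous 1 fun A => by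
    have h := Matrix.linfty_opNorm_mulVec A (Pi.single j 1)
    have h2 := norm_le_pi_norm (A *ᵥ Pi.single j 1) i
    have h3 : ‖(Pi.single j 1 : Fin s → ℂ)‖ ≤ 1 := by
      refine (pi_norm_le_iff_of_nonneg zero_le_one).mpr fun k => ?_
      by_cases hk : k = j
      · subst hk; simp
      · simp [hk]
    have h4 : (A *ᵥ Pi.single j 1) i = A i j := by simp
    rw [h4] at h2
    rw [one_mul]
    exact h2.trans (h.trans (mul_le_of_le_one_right (norm_nonneg _) h3))

theorem analyticAt_matrix_iff :
    AnalyticAt 𝕜 A p ↔ ∀ i j, AnalyticAt 𝕜 (fun x => A x i j) p := by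
  constructor
  · intro h i j
    exact ((matrixEntry 𝕜 i j).analyticAt _).fun_comp h
  · intro h
    have e : A = fun x => ∑ i, ∑ j, A x i j • Matrix.single i j (1 : ℂ) := by
      funext x
      conv_lhs => rw [Matrix.matrix_eq_sum_single (A x)]
      simp
    rw [e]
    refine Finset.analyticAt_fun_sum _ fun i _ => Finset.analyticAt_fun_sum _ fun j _ => ?_
    exact AnalyticAt.smul (h i j) analyticAt_const

theorem fderiv_matrix_entry (hA : DifferentiableAt 𝕜 A p) (v : E) (i j : Fin s) :
    fderiv 𝕜 (fun x => A x i j) p v = fderiv 𝕜 A p v i j := by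
  have h : HasFDerivAt (fun x => A x i j) ((matrixEntry 𝕜 i j).comp (fderiv 𝕜 A p)) p :=
    (matrixEntry 𝕜 i j).hasFDerivAt.comp p hA.hasFDerivAt
  rw [h.fderiv]
  rfl

theorem AnalyticAt.matrix_transpose (hA : AnalyticAt 𝕜 A p) :
    AnalyticAt 𝕜 (fun x => (A x)ᵀ) p :=
  analyticAt_matrix_iff.mpr fun i j => analyticAt_matrix_iff.mp hA j i

theorem fderiv_matrix_transpose (hA : AnalyticAt 𝕜 A p) (v : E) :
    fderiv 𝕜 (fun x => (A x)ᵀ) p v = (fderiv 𝕜 A p v)ᵀ := by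
  ext i j
  rw [← fderiv_matrix_entry hA.matrix_transpose.differentiableAt, Matrix.transpose_apply,
    ← fderiv_matrix_entry hA.differentiableAt]
  rfl

/-- Inversion is analytic at the units of a complete normed algebra; the operator norm supplies that
structure on matrices. -/
theorem AnalyticAt.matrix_inv (hA : AnalyticAt 𝕜 A p) (h : IsUnit (A p).det) :
    AnalyticAt 𝕜 (fun x => (A x)⁻¹) p := by
  obtain ⟨u, hu⟩ := (Matrix.isUnit_iff_isUnit_det _).mpr h
  have h1 : AnalyticAt 𝕜 Ring.inverse (A p) := by
    rw [← hu]
    exact analyticAt_inverse u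
  have := h1.fun_comp hA
  simpa only [← Matrix.nonsing_inv_eq_ringInverse] using this

theorem eventually_isUnit_det (hA : ContinuousAt A p) (h : IsUnit (A p).det) :
    ∀ᶠ x in 𝓝 p, IsUnit (A x).det := by
  have h1 : IsUnit (A p) := (Matrix.isUnit_iff_isUnit_det _).mpr h
  filter_upwards [hA.eventually (Units.isOpen.mem_nhds h1)] with x hx
  exact (Matrix.isUnit_iff_isUnit_det _).mp hx

end

section Conjugation

theorem analyticAt_star_vec {n : Type*} [Fintype n] {E : Type*} [NormedAddCommGroup E]
    [NormedSpace ℝ E] {f : E → n → ℂ} {p : E} (hf : AnalyticAt ℝ f p) :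
    AnalyticAt ℝ (fun x => star (f x)) p :=
  ((starL' ℝ : (n → ℂ) ≃L[ℝ] (n → ℂ)).toContinuousLinearMap.analyticAt _).fun_comp hf

theorem fderiv_star_vec {n : Type*} [Fintype n] {E : Type*} [NormedAddCommGroup E]
    [NormedSpace ℝ E] {f : E → n → ℂ} {p : E} (hf : DifferentiableAt ℝ f p) (v : E) :
    fderiv ℝ (fun x => star (f x)) p v = star (fderiv ℝ f p v) := by
  have h : HasFDerivAt (fun x => star (f x)) _ p :=
    (starL' ℝ : (n → ℂ) ≃L[ℝ] (n → ℂ)).toContinuousLinearMap.hasFDerivAt.comp p hf.hasFDerivAt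
  rw [h.fderiv]
  rfl

theorem analyticAt_conjMatrix {E : Type*} [NormedAddCommGroup E]
    [NormedSpace ℝ E] {A : E → Matrix (Fin s) (Fin s) ℂ} {p : E} (hA : AnalyticAt ℝ A p) :
    AnalyticAt ℝ (fun x => conjMatrix (A x)) p :=
  analyticAt_matrix_iff.mpr fun i j =>
    (Complex.conjCLE.toContinuousLinearMap.analyticAt _).fun_comp (analyticAt_matrix_iff.mp hA i j)

end Conjugation

/-! ### Entrywise conjugation and nondegeneracy -/

section Algebra

theorem conjMatrix_mul (A B : Matrix (Fin s) (Fin s) ℂ) :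
    conjMatrix (A * B) = conjMatrix A * conjMatrix B :=
  Matrix.map_mul

theorem conjMatrix_one : conjMatrix (1 : Matrix (Fin s) (Fin s) ℂ) = 1 :=
  Matrix.map_one _ (map_zero _) (map_one _)

theorem conjMatrix_sub (A B : Matrix (Fin s) (Fin s) ℂ) :
    conjMatrix (A - B) = conjMatrix A - conjMatrix B :=
  Matrix.map_sub _ (map_sub _) _ _

theorem conjMatrix_conjMatrix (A : Matrix (Fin s) (Fin s) ℂ) : conjMatrix (conjMatrix A) = A := by
  ext i j
  simp [conjMatrix]

theorem conjMatrix_transpose (A : Matrix (Fin s) (Fin s) ℂ) :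
    conjMatrix Aᵀ = (conjMatrix A)ᵀ := rfl

theorem conjMatrix_det (A : Matrix (Fin s) (Fin s) ℂ) :
    (conjMatrix A).det = (starRingEnd ℂ) A.det := by
  rw [conjMatrix, RingHom.map_det]
  rfl

theorem isUnit_det_conjMatrix {A : Matrix (Fin s) (Fin s) ℂ} (h : IsUnit A.det) :
    IsUnit (conjMatrix A).det := by
  rw [conjMatrix_det]
  exact h.map _

theorem conjMatrix_inv (A : Matrix (Fin s) (Fin s) ℂ) :
    conjMatrix A⁻¹ = (conjMatrix A)⁻¹ := by
  by_cases h : IsUnit A.det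
  · refine (Matrix.inv_eq_left_inv ?_).symm
    rw [← conjMatrix_mul, Matrix.nonsing_inv_mul _ h, conjMatrix_one]
  · have h' : ¬ IsUnit (conjMatrix A).det := fun h2 => h (by
      simpa [conjMatrix_conjMatrix] using isUnit_det_conjMatrix h2)
    rw [Matrix.nonsing_inv_apply_not_isUnit _ h, Matrix.nonsing_inv_apply_not_isUnit _ h']
    ext i j
    simp [conjMatrix]

theorem conjMatrix_of_isHermitian {A : Matrix (Fin s) (Fin s) ℂ} (h : A.IsHermitian) :
    conjMatrix A = Aᵀ := by
  ext i j
  exact h.apply j i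

theorem star_mulVec_conjMatrix (A : Matrix (Fin s) (Fin s) ℂ) (v : Fin s → ℂ) :
    star (A *ᵥ v) = conjMatrix A *ᵥ star v := by
  ext i
  simp [Matrix.mulVec, dotProduct, conjMatrix]

theorem star_dotProduct_star' (u v : Fin s → ℂ) : star (u ⬝ᵥ v) = star u ⬝ᵥ star v := by
  simp [dotProduct]

theorem dotProduct_mulVec_transpose (A : Matrix (Fin s) (Fin s) ℂ) (u v : Fin s → ℂ) :
    u ⬝ᵥ (A *ᵥ v) = v ⬝ᵥ (Aᵀ *ᵥ u) := by
  rw [Matrix.mulVec_transpose, Matrix.dotProduct_mulVec, dotProduct_comm]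

/-- Testing with the conjugate of `w` gives the sum of the squared moduli of its entries. -/
theorem eq_zero_of_re_dotProduct {w : Fin s → ℂ} (h : ∀ u : Fin s → ℂ, (u ⬝ᵥ w).re = 0) :
    w = 0 := by
  have h1 := h (star w)
  have h2 : star w ⬝ᵥ w = ∑ i, ((Complex.normSq (w i) : ℝ) : ℂ) := by
    simp [dotProduct, Complex.normSq_eq_conj_mul_self]
  rw [h2, ← Complex.ofReal_sum, Complex.ofReal_re,
    Finset.sum_eq_zero_iff_of_nonneg fun i _ => Complex.normSq_nonneg _] at h1
  ext i
  exact Complex.normSq_eq_zero.mp (h1 i (Finset.mem_univ i))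

theorem eq_zero_of_mulVec_eq_zero {A : Matrix (Fin s) (Fin s) ℂ} (hA : IsUnit A.det)
    {v : Fin s → ℂ} (h : A *ᵥ v = 0) : v = 0 := by
  have := congrArg (A⁻¹ *ᵥ ·) h
  simpa [Matrix.mulVec_mulVec, Matrix.nonsing_inv_mul _ hA] using this

end Algebra

/-! ### Rules for ∂̄-derivatives -/

section Dbar

open Complex

variable {E : Type*} [NormedAddCommGroup E] [NormedSpace ℂ E] {p : E}
  {A : E → Matrix (Fin s) (Fin s) ℂ} {f g : E → Fin s → ℂ}

theorem twiceDbar_mulVec (hA : DifferentiableAt ℝ A p) (hf : DifferentiableAt ℝ f p) (v : E) :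
    twiceDbar (fun x => A x *ᵥ f x) p v = A p *ᵥ twiceDbar f p v + twiceDbar A p v *ᵥ f p := by
  simp only [twiceDbar, fderiv_mulVec hA hf, Matrix.mulVec_add, Matrix.add_mulVec, smul_add,
    Matrix.mulVec_smul, Matrix.smul_mulVec]
  exact add_add_add_comm _ _ _ _

theorem twiceDbar_dotProduct (hg : DifferentiableAt ℝ g p) (hf : DifferentiableAt ℝ f p) (v : E) :
    twiceDbar (fun x => g x ⬝ᵥ f x) p v = g p ⬝ᵥ twiceDbar f p v + twiceDbar g p v ⬝ᵥ f p := by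
  simp only [twiceDbar, fderiv_dotProduct hg hf, dotProduct_add, add_dotProduct, smul_add,
    dotProduct_smul, smul_dotProduct]
  abel

theorem twiceDbar_eq_zero {W : Type*} [NormedAddCommGroup W] [NormedSpace ℂ W] {f : E → W}
    (hf : DifferentiableAt ℂ f p) (v : E) : twiceDbar f p v = 0 := by
  rw [twiceDbar, hf.fderiv_restrictScalars ℝ]
  simp [smul_smul]

theorem twiceDbar_const {W : Type*} [NormedAddCommGroup W] [NormedSpace ℂ W] (c : W) (v : E) :
    twiceDbar (fun _ => c) p v = 0 :=
  twiceDbar_eq_zero (differentiableAt_const c) v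

theorem twiceDbar_add {W : Type*} [NormedAddCommGroup W] [NormedSpace ℂ W] {f g : E → W}
    (hf : DifferentiableAt ℝ f p) (hg : DifferentiableAt ℝ g p) (v : E) :
    twiceDbar (fun x => f x + g x) p v = twiceDbar f p v + twiceDbar g p v := by
  simp only [twiceDbar, fderiv_fun_add hf hg, _root_.add_apply, smul_add]
  abel

/-- If `DF` is the real part of a family of complex linear functionals, then the Levi form is
given by the `(0,1)`-derivatives of that family. -/
theorem leviForm_eq_re_twiceDbar {F : E → ℝ} {x : E} (hF : ContDiffAt ℝ ∞ F x) {Θ : E → E → ℂ}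
    (h1 : ∀ᶠ y in 𝓝 x, ∀ v, fderiv ℝ F y v = (Θ y v).re)
    (h2 : ∀ y v, Θ y (I • v) = I * Θ y v) (u : E)
    (h3 : DifferentiableAt ℝ (fun y => Θ y u) x) (v : E) :
    leviForm F x v u = (twiceDbar (fun y => Θ y u) x v).re := by
  have hd : DifferentiableAt ℝ (fderiv ℝ F) x := differentiableAt_fderiv (q := (0, x)) hF
  have key : ∀ u' v', DifferentiableAt ℝ (fun y => Θ y u') x →
      fderiv ℝ (fderiv ℝ F) x v' u' = (fderiv ℝ (fun y => Θ y u') x v').re := by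
    intro u' v' hu'
    have e1 : HasFDerivAt (fun y => fderiv ℝ F y u') _ x :=
      hd.hasFDerivAt.clm_apply (hasFDerivAt_const u' x)
    have e2 : HasFDerivAt (fun y => (Θ y u').re) _ x :=
      reCLM.hasFDerivAt.comp x hu'.hasFDerivAt
    have e3 := e1.unique (e2.congr_of_eventuallyEq
      (by filter_upwards [h1] with y hy using hy u'))
    have e4 := congrArg (fun L => L v') e3
    simpa using e4
  -- By complex linearity of `Θ` the Hessian term at `(I • v, I • u)` is the derivative of `I * Θ y
  -- u` along `I • v`, the other half of `twiceDbar`.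
  have h4 : (fun y => Θ y (I • u)) = fun y => I * Θ y u := by
    funext y
    exact h2 y u
  have h5 : DifferentiableAt ℝ (fun y => I * Θ y u) x := h3.const_mul I
  rw [leviForm, key u v h3, key (I • u) (I • v) (by rw [h4]; exact h5), h4, twiceDbar,
    fderiv_const_mul h3]
  simp

end Dbar

end MatrixCalculus

/-! ### Dimension of the CR bundle -/

section Dimensions

variable {V : Type*} [NormedAddCommGroup V] [NormedSpace ℂ V] {F : V → ℝ} {q : ℂ × V}

theorem twiceDel_injOn_holTangent (hF : DifferentiableAt ℝ F q.2) {v u : ℂ × V}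
    (hv : v ∈ holTangent (graphFunction F) q) (hu : u ∈ holTangent (graphFunction F) q)
    (h : v.2 = u.2) : v = u := by
  rw [mem_holTangent_graph hF] at hv hu
  exact Prod.ext (by rw [hv, hu, h]) h

theorem finrank_holTangent (hF : DifferentiableAt ℝ F q.2) :
    Module.finrank ℂ (holTangent (graphFunction F) q) = Module.finrank ℂ V := by
  refine LinearEquiv.finrank_eq (LinearEquiv.ofBijective
    ((LinearMap.snd ℂ ℂ V) ∘ₗ (holTangent (graphFunction F) q).subtype) ⟨?_, ?_⟩)
  · intro v u h
    exact Subtype.ext (twiceDel_injOn_holTangent hF v.2 u.2 h)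
  · intro x
    exact ⟨⟨(twiceDel F q.2 x, x), (mem_holTangent_graph hF _).mpr rfl⟩, rfl⟩

end Dimensions

/-! ### Algebra of the explicit models -/

section ExplicitModel

open Complex
open scoped Matrix.Norms.Operator

variable {s r : ℕ}

/-- The function `F` of `(z, ζ)` with `Re w = F` on the hypersurface determined by `H` and `S`. -/
noncomputable def modelFunction (H S : (Fin r → ℂ) → Matrix (Fin s) (Fin s) ℂ)
    (x : (Fin s → ℂ) × (Fin r → ℂ)) : ℝ :=
  (x.1 ⬝ᵥ (H x.2 *ᵥ star x.1)).re + (star x.1 ⬝ᵥ (S x.2 *ᵥ star x.1)).re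

theorem modelDefiningFunction_eq (H S : (Fin r → ℂ) → Matrix (Fin s) (Fin s) ℂ) :
    modelDefiningFunction H S = graphFunction (modelFunction H S) := rfl

variable (H₀ : Matrix (Fin s) (Fin s) ℂ) (S₀ : (Fin r → ℂ) → Matrix (Fin s) (Fin s) ℂ)

/-- The matrix whose inverse enters the explicit models. -/
noncomputable def pivot (ζ : Fin r → ℂ) : Matrix (Fin s) (Fin s) ℂ :=
  1 - conjMatrix (S₀ ζ * H₀) * (S₀ ζ * H₀)

/-- The conjugate of the leaf parameter: `(z, ζ)` lies on the leaf of the Levi kernel that passes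
through the conjugate of `leafParam (z, ζ)` at `ζ = 0`. -/
noncomputable def leafParam (x : (Fin s → ℂ) × (Fin r → ℂ)) : Fin s → ℂ :=
  (pivot H₀ S₀ x.2)⁻¹ *ᵥ (star x.1 + conjMatrix (S₀ x.2 * H₀) *ᵥ x.1)

/-- A point `ζ` at which the data are regular. -/
structure IsRegularPoint (ζ : Fin r → ℂ) : Prop where
  analytic : AnalyticAt ℂ S₀ ζ
  symmetric : ∀ᶠ ζ' in 𝓝 ζ, (S₀ ζ').IsSymm
  unit : IsUnit (pivot H₀ S₀ ζ).det
  independent : ∀ c, fderiv ℂ S₀ ζ c = 0 → c = 0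

variable {H₀ S₀}

/-- Invertibility of `H` makes `P` and `Q` similar, so the identity also holds for the default value
of the inverse and neither of them has to be invertible. -/
theorem inv_mul_eq_mul_inv {H P Q : Matrix (Fin s) (Fin s) ℂ} (hH : IsUnit H.det)
    (h : H * P = Q * H) : Q⁻¹ * H = H * P⁻¹ := by
  have hQ : Q = H * P * H⁻¹ := by
    rw [h, Matrix.mul_assoc, Matrix.mul_nonsing_inv _ hH, Matrix.mul_one]
  rw [hQ, Matrix.mul_inv_rev, Matrix.mul_inv_rev, Matrix.nonsing_inv_nonsing_inv _ hH,
    Matrix.mul_assoc, Matrix.mul_assoc, Matrix.nonsing_inv_mul _ hH, Matrix.mul_one]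

theorem mul_inv_eq_inv_mul {S P Q : Matrix (Fin s) (Fin s) ℂ} (hP : IsUnit P.det)
    (hQ : IsUnit Q.det) (h : S * Q = P * S) : S * Q⁻¹ = P⁻¹ * S := by
  calc S * Q⁻¹ = P⁻¹ * (P * S) * Q⁻¹ := by
        rw [← Matrix.mul_assoc, Matrix.nonsing_inv_mul _ hP, Matrix.one_mul]
    _ = P⁻¹ * S := by
        rw [← h, Matrix.mul_assoc, Matrix.mul_assoc, Matrix.mul_nonsing_inv _ hQ, Matrix.mul_one]

variable (hH : H₀.IsHermitian) (hU : IsUnit H₀.det)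

include hH in
theorem pivot_eq (ζ : Fin r → ℂ) :
    pivot H₀ S₀ ζ = 1 - conjMatrix (S₀ ζ) * H₀ᵀ * S₀ ζ * H₀ := by
  rw [pivot, conjMatrix_mul, conjMatrix_of_isHermitian hH]
  noncomm_ring

include hH hU in
-- The two summands of `explicitH` are equal by pushing `H₀` through the inverse; their average only
-- displays the Hermitian symmetry.
theorem explicitH_eq (ζ : Fin r → ℂ) : explicitH H₀ S₀ ζ = H₀ * (pivot H₀ S₀ ζ)⁻¹ := by
  have h : H₀ * (1 - conjMatrix (S₀ ζ) * H₀ᵀ * S₀ ζ * H₀)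
      = (1 - H₀ * conjMatrix (S₀ ζ) * H₀ᵀ * S₀ ζ) * H₀ := by noncomm_ring
  rw [explicitH, inv_mul_eq_mul_inv hU h, pivot_eq hH]
  module

include hH in
theorem conjMatrix_explicitS (ζ : Fin r → ℂ) :
    conjMatrix (explicitS H₀ S₀ ζ)
      = H₀ * (pivot H₀ S₀ ζ)⁻¹ * conjMatrix (S₀ ζ * H₀) := by
  have h : conjMatrix H₀ᵀ = H₀ := by
    rw [← conjMatrix_of_isHermitian hH, conjMatrix_conjMatrix]
  simp only [explicitS, conjMatrix_mul, conjMatrix_inv, conjMatrix_sub, conjMatrix_one,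
    conjMatrix_conjMatrix, h, conjMatrix_of_isHermitian hH, pivot, Matrix.mul_assoc]

include hH hU in
-- The real part of the `S`-term is that of its conjugate, a quadratic form in `z`. Both terms then
-- have the left factor `H₀ * (pivot H₀ S₀ ζ)⁻¹`, and what it multiplies adds up to the vector in
-- `leafParam`.
theorem modelFunction_explicit (x : (Fin s → ℂ) × (Fin r → ℂ)) :
    modelFunction (explicitH H₀ S₀) (explicitS H₀ S₀) x
      = (x.1 ⬝ᵥ (H₀ *ᵥ leafParam H₀ S₀ x)).re := by
  have h1 : (star x.1 ⬝ᵥ (explicitS H₀ S₀ x.2 *ᵥ star x.1)).re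
      = (x.1 ⬝ᵥ (conjMatrix (explicitS H₀ S₀ x.2) *ᵥ x.1)).re := by
    rw [← conj_re]
    change (star (_ : ℂ)).re = _
    rw [star_dotProduct_star', star_mulVec_conjMatrix, star_star]
  rw [modelFunction, h1, conjMatrix_explicitS hH, explicitH_eq hH hU, ← add_re, ← dotProduct_add,
    leafParam]
  simp only [Matrix.mulVec_add, Matrix.mulVec_mulVec, Matrix.mul_assoc]

theorem pivot_mulVec_leafParam {x : (Fin s → ℂ) × (Fin r → ℂ)}
    (hx : IsUnit (pivot H₀ S₀ x.2).det) :
    pivot H₀ S₀ x.2 *ᵥ leafParam H₀ S₀ x = star x.1 + conjMatrix (S₀ x.2 * H₀) *ᵥ x.1 := by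
  rw [leafParam, Matrix.mulVec_mulVec, Matrix.mul_nonsing_inv _ hx, Matrix.one_mulVec]

/-- Applying the antilinear relation twice gives `v = conjMatrix B *ᵥ (B *ᵥ v)`. -/
theorem eq_zero_of_star_eq {B : Matrix (Fin s) (Fin s) ℂ}
    (hB : IsUnit (1 - conjMatrix B * B).det) {v : Fin s → ℂ} (h : star v = B *ᵥ v) : v = 0 := by
  have h1 : v = conjMatrix B *ᵥ (B *ᵥ v) := by
    conv_lhs => rw [← star_star v, h, star_mulVec_conjMatrix, h]
  refine eq_zero_of_mulVec_eq_zero hB ?_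
  rw [Matrix.sub_mulVec, ← Matrix.mulVec_mulVec, ← h1, Matrix.one_mulVec, sub_self]

/-- This solves the defining equation of the leaf parameter for `z`. After multiplication by the
invertible matrix `1 - B * conjMatrix B` it reduces to that equation and its conjugate. -/
theorem star_leafParam_sub {x : (Fin s → ℂ) × (Fin r → ℂ)}
    (hx : IsUnit (pivot H₀ S₀ x.2).det) :
    star (leafParam H₀ S₀ x) - (S₀ x.2 * H₀) *ᵥ leafParam H₀ S₀ x = x.1 := by
  set B := S₀ x.2 * H₀ with hB
  have h1 := pivot_mulVec_leafParam hx
  have hc := isUnit_det_conjMatrix hx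
  rw [pivot, ← hB, conjMatrix_sub, conjMatrix_mul, conjMatrix_one, conjMatrix_conjMatrix] at hc
  set k := leafParam H₀ S₀ x
  have h2 := congrArg star h1
  rw [star_mulVec_conjMatrix, pivot, ← hB, conjMatrix_sub, conjMatrix_mul, conjMatrix_one,
    conjMatrix_conjMatrix, star_add, star_star, star_mulVec_conjMatrix,
    conjMatrix_conjMatrix] at h2
  rw [pivot, ← hB] at h1
  rw [← sub_eq_zero]
  refine eq_zero_of_mulVec_eq_zero hc ?_
  have h3 : (1 - B * conjMatrix B) *ᵥ (B *ᵥ k) = B *ᵥ ((1 - conjMatrix B * B) *ᵥ k) := by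
    rw [Matrix.mulVec_mulVec, Matrix.mulVec_mulVec]
    congr 1
    noncomm_ring
  rw [Matrix.mulVec_sub, Matrix.mulVec_sub, h2, h3, h1]
  simp only [Matrix.sub_mulVec, Matrix.one_mulVec, Matrix.mulVec_add, Matrix.mulVec_mulVec]
  abel

include hH in
-- For symmetric `S₀ ζ` the two summands of `explicitH` are adjoint to each other.
theorem isHermitian_explicitH {ζ : Fin r → ℂ} (hS : (S₀ ζ).IsSymm) :
    (explicitH H₀ S₀ ζ).IsHermitian := by
  have e1 : (S₀ ζ)ᴴ = conjMatrix (S₀ ζ) := by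
    rw [Matrix.conjTranspose, hS.eq]; rfl
  have e2 : (conjMatrix (S₀ ζ))ᴴ = S₀ ζ := by
    rw [← e1, Matrix.conjTranspose_conjTranspose]
  have e3 : (H₀ᵀ)ᴴ = H₀ᵀ := by
    rw [← conjMatrix_of_isHermitian hH]
    ext i j
    simp [conjMatrix]
    rw [← hH.apply, star_def]
  have e4 : (1 - conjMatrix (S₀ ζ) * H₀ᵀ * S₀ ζ * H₀)ᴴ
      = 1 - H₀ * conjMatrix (S₀ ζ) * H₀ᵀ * S₀ ζ := by
    simp only [Matrix.conjTranspose_sub, Matrix.conjTranspose_one, Matrix.conjTranspose_mul, e1,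
      e2, e3, hH.eq, Matrix.mul_assoc]
  rw [Matrix.IsHermitian, explicitH, ← e4, Matrix.conjTranspose_smul, Matrix.conjTranspose_add,
    Matrix.conjTranspose_mul, Matrix.conjTranspose_mul, Matrix.conjTranspose_nonsing_inv,
    Matrix.conjTranspose_nonsing_inv, Matrix.conjTranspose_conjTranspose, hH.eq, add_comm]
  simp

include hH in
theorem isSymm_explicitS {ζ : Fin r → ℂ} (hS : (S₀ ζ).IsSymm)
    (hu : IsUnit (pivot H₀ S₀ ζ).det) : (explicitS H₀ S₀ ζ).IsSymm := by
  have hc := isUnit_det_conjMatrix hu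
  rw [pivot, conjMatrix_sub, conjMatrix_mul, conjMatrix_one, conjMatrix_conjMatrix, conjMatrix_mul,
    conjMatrix_of_isHermitian hH, ← Matrix.mul_assoc] at hc
  have e1 : (conjMatrix (S₀ ζ))ᵀ = conjMatrix (S₀ ζ) := by
    rw [← conjMatrix_transpose, hS.eq]
  have e2 : (1 - S₀ ζ * H₀ * conjMatrix (S₀ ζ) * H₀ᵀ)ᵀ
      = 1 - H₀ * conjMatrix (S₀ ζ) * H₀ᵀ * S₀ ζ := by
    simp only [Matrix.transpose_sub, Matrix.transpose_one, Matrix.transpose_mul, e1, hS.eq,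
      Matrix.transpose_transpose, Matrix.mul_assoc]
  have hc' : IsUnit (1 - H₀ * conjMatrix (S₀ ζ) * H₀ᵀ * S₀ ζ).det := by
    rw [← e2, Matrix.det_transpose]; exact hc
  have e3 : S₀ ζ * (1 - H₀ * conjMatrix (S₀ ζ) * H₀ᵀ * S₀ ζ)⁻¹
      = (1 - S₀ ζ * H₀ * conjMatrix (S₀ ζ) * H₀ᵀ)⁻¹ * S₀ ζ := by
    have h : S₀ ζ * (1 - H₀ * conjMatrix (S₀ ζ) * H₀ᵀ * S₀ ζ)
        = (1 - S₀ ζ * H₀ * conjMatrix (S₀ ζ) * H₀ᵀ) * S₀ ζ := by noncomm_ring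
    exact mul_inv_eq_inv_mul hc hc' h
  rw [Matrix.IsSymm, explicitS, Matrix.transpose_mul, Matrix.transpose_mul, Matrix.transpose_mul,
    Matrix.transpose_nonsing_inv, e2, hS.eq, Matrix.transpose_transpose, ← Matrix.mul_assoc (S₀ ζ), e3]
  simp only [Matrix.mul_assoc]

end ExplicitModel

/-! ### The Levi form of the explicit models -/

section ExplicitKernel

open Complex
open scoped Matrix.Norms.Operator

variable {s r : ℕ} {H₀ : Matrix (Fin s) (Fin s) ℂ} {S₀ : (Fin r → ℂ) → Matrix (Fin s) (Fin s) ℂ}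

theorem continuous_fderiv_single {A : (Fin r → ℂ) → Matrix (Fin s) (Fin s) ℂ} {ζ : Fin r → ℂ}
    (hA : AnalyticAt ℂ A ζ) :
    ContinuousAt (fun ζ' => fun α : Fin r => fderiv ℂ A ζ' (Pi.single α 1)) ζ := by
  refine continuousAt_pi.mpr fun α => ?_
  exact (hA.fderiv.continuousAt).clm_apply continuousAt_const

theorem fderiv_injective_iff (L : (Fin r → ℂ) →L[ℂ] Matrix (Fin s) (Fin s) ℂ) :
    (∀ c, L c = 0 → c = 0) ↔ LinearIndependent ℂ fun α : Fin r => L (Pi.single α 1) := by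
  have h : ∀ c, L c = ∑ α, c α • L (Pi.single α 1) := by
    intro c
    conv_lhs => rw [pi_eq_sum_univ' c]
    simp only [map_sum, map_smul]
  rw [Fintype.linearIndependent_iff]
  constructor
  · intro hL c hc α
    rw [hL c (by rw [h]; exact hc)]
    rfl
  · intro hL c hc
    funext α
    exact hL c (by rw [← h]; exact hc) α

theorem IsModelData.analyticAt (h : IsModelData H₀ S₀) : AnalyticAt ℂ S₀ 0 :=
  analyticAt_matrix_iff.mpr h.holomorphic

theorem analyticAt_pivot {ζ : Fin r → ℂ} (h : AnalyticAt ℂ S₀ ζ) :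
    AnalyticAt ℝ (pivot H₀ S₀) ζ := by
  have h1 : AnalyticAt ℝ (fun ζ => S₀ ζ * H₀) ζ := (h.restrictScalars).mul analyticAt_const
  exact analyticAt_const.sub ((analyticAt_conjMatrix h1).mul h1)

/-- Each condition is open, linear independence of the derivatives included, and holds at `0`, where
the pivot is the identity. -/
theorem IsModelData.eventually_isRegularPoint (h : IsModelData H₀ S₀) :
    ∀ᶠ ζ in 𝓝 0, IsRegularPoint H₀ S₀ ζ := by
  have h1 := h.analyticAt.eventually_analyticAt
  have h2 := h.symmetric.eventually_nhds
  have h3 : IsUnit (pivot H₀ S₀ 0).det := by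
    simp [pivot, h.vanishing]
  have h4 := eventually_isUnit_det (analyticAt_pivot (H₀ := H₀) h.analyticAt).continuousAt h3
  have h5 : ∀ᶠ ζ in 𝓝 0, LinearIndependent ℂ fun α : Fin r => fderiv ℂ S₀ ζ (Pi.single α 1) := by
    refine (continuous_fderiv_single h.analyticAt).eventually
      (isOpen_setOfPred_linearIndependent.mem_nhds ?_)
    have e : (fun α : Fin r => fderiv ℂ S₀ 0 (Pi.single α 1)) = fun α : Fin r =>
        (Matrix.of fun i j => fderiv ℂ (fun ζ => S₀ ζ i j) 0 (Pi.single α 1) :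
          Matrix (Fin s) (Fin s) ℂ) := by
      funext α
      ext i j
      rw [Matrix.of_apply, fderiv_matrix_entry h.analyticAt.differentiableAt]
    change LinearIndependent ℂ (fun α : Fin r => fderiv ℂ S₀ 0 (Pi.single α 1))
    rw [e]
    exact h.independent
  filter_upwards [h1, h2, h4, h5] with ζ a1 a2 a4 a5
  exact ⟨a1, a2, a4, (fderiv_injective_iff _).mpr a5⟩

variable {x : (Fin s → ℂ) × (Fin r → ℂ)}

theorem analyticAt_leafParam (hx : IsRegularPoint H₀ S₀ x.2) :
    AnalyticAt ℝ (leafParam H₀ S₀) x := by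
  have h1 : AnalyticAt ℝ (fun ζ => S₀ ζ * H₀) x.2 :=
    (hx.analytic.restrictScalars).mul analyticAt_const
  have h2 := (analyticAt_conjMatrix h1).fun_comp (analyticAt_snd (p := x))
  have h3 := ((analyticAt_pivot (H₀ := H₀) hx.analytic).matrix_inv hx.unit).fun_comp
    (analyticAt_snd (p := x))
  exact h3.mulVec ((analyticAt_star_vec analyticAt_fst).add (h2.mulVec analyticAt_fst))

theorem IsRegularPoint.eventually (hx : IsRegularPoint H₀ S₀ x.2) :
    ∀ᶠ y : (Fin s → ℂ) × (Fin r → ℂ) in 𝓝 x, AnalyticAt ℂ S₀ y.2 ∧ (S₀ y.2).IsSymm ∧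
      IsUnit (pivot H₀ S₀ y.2).det ∧ AnalyticAt ℝ (leafParam H₀ S₀) y := by
  have h4 := eventually_isUnit_det (analyticAt_pivot (H₀ := H₀) hx.analytic).continuousAt hx.unit
  filter_upwards [continuousAt_snd.eventually hx.analytic.eventually_analyticAt,
    continuousAt_snd.eventually hx.symmetric, continuousAt_snd.eventually h4,
    (analyticAt_leafParam hx).eventually_analyticAt] with y a b c d using ⟨a, b, c, d⟩

theorem fderiv_comp_snd {W : Type*} [NormedAddCommGroup W] [NormedSpace ℂ W]
    {E : Type*} [NormedAddCommGroup E] [NormedSpace ℂ E]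
    {E' : Type*} [NormedAddCommGroup E'] [NormedSpace ℂ E'] {x : E × E'}
    {A : E' → W} (hA : DifferentiableAt ℂ A x.2) (v : E × E') :
    fderiv ℝ (fun y : E × E' => A y.2) x v = fderiv ℂ A x.2 v.2 := by
  have h : HasFDerivAt (fun y : E × E' => A y.2) _ x :=
    HasFDerivAt.comp x hA.hasFDerivAt hasFDerivAt_snd
  rw [(h.restrictScalars ℝ).fderiv]
  rfl

theorem fderiv_comp_snd_real {W : Type*} [NormedAddCommGroup W] [NormedSpace ℝ W]
    {E : Type*} [NormedAddCommGroup E] [NormedSpace ℝ E]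
    {E' : Type*} [NormedAddCommGroup E'] [NormedSpace ℝ E'] {x : E × E'}
    {A : E' → W} (hA : DifferentiableAt ℝ A x.2) (v : E × E') :
    fderiv ℝ (fun y : E × E' => A y.2) x v = fderiv ℝ A x.2 v.2 := by
  have h : HasFDerivAt (fun y : E × E' => A y.2) _ x :=
    HasFDerivAt.comp x hA.hasFDerivAt hasFDerivAt_snd
  rw [h.fderiv]
  rfl

/-- The differential of the relation between `z` and the leaf parameter. -/
theorem fderiv_leafParam (ha : AnalyticAt ℂ S₀ x.2) (hk : AnalyticAt ℝ (leafParam H₀ S₀) x)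
    (hu : ∀ᶠ y : (Fin s → ℂ) × (Fin r → ℂ) in 𝓝 x, IsUnit (pivot H₀ S₀ y.2).det)
    (v : (Fin s → ℂ) × (Fin r → ℂ)) :
    star (fderiv ℝ (leafParam H₀ S₀) x v) - (S₀ x.2 *ᵥ (H₀ *ᵥ fderiv ℝ (leafParam H₀ S₀) x v)
      + fderiv ℂ S₀ x.2 v.2 *ᵥ (H₀ *ᵥ leafParam H₀ S₀ x)) = v.1 := by
  have hkd := hk.differentiableAt
  have hS : DifferentiableAt ℝ (fun y : (Fin s → ℂ) × (Fin r → ℂ) => S₀ y.2) x :=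
    (ha.differentiableAt.restrictScalars ℝ).comp x differentiableAt_snd
  have hHk : DifferentiableAt ℝ (fun y => H₀ *ᵥ leafParam H₀ S₀ y) x :=
    (differentiableAt_const H₀).mulVec hkd
  -- Differentiating the relation `star_leafParam_sub` avoids the derivative of the inverse pivot.
  have e : (fun y => star (leafParam H₀ S₀ y) - S₀ y.2 *ᵥ (H₀ *ᵥ leafParam H₀ S₀ y))
      =ᶠ[𝓝 x] fun y => y.1 := by
    filter_upwards [hu] with y hy
    rw [Matrix.mulVec_mulVec]
    exact star_leafParam_sub hy
  have h1 := congrArg (fun L => L v) (e.fderiv_eq (𝕜 := ℝ))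
  have h2 : fderiv ℝ (fun y : (Fin s → ℂ) × (Fin r → ℂ) => y.1) x v = v.1 := by
    rw [fderiv_fst]; rfl
  have h3 : fderiv ℝ (fun y : (Fin s → ℂ) × (Fin r → ℂ) => S₀ y.2) x v
      = fderiv ℂ S₀ x.2 v.2 := fderiv_comp_snd ha.differentiableAt v
  rw [← h2, ← h1]
  rw [fderiv_fun_sub (analyticAt_star_vec hk).differentiableAt (hS.mulVec hHk)]
  rw [_root_.sub_apply, fderiv_star_vec hkd, fderiv_mulVec hS hHk,
    fderiv_mulVec (differentiableAt_const H₀) hkd, h3]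
  simp

/-- The complex linear functional whose real part is the differential of the model function. -/
noncomputable def explicitDel (H₀ : Matrix (Fin s) (Fin s) ℂ)
    (S₀ : (Fin r → ℂ) → Matrix (Fin s) (Fin s) ℂ) (x v : (Fin s → ℂ) × (Fin r → ℂ)) : ℂ :=
  2 * (v.1 ⬝ᵥ (H₀ *ᵥ leafParam H₀ S₀ x))
    + (H₀ *ᵥ leafParam H₀ S₀ x) ⬝ᵥ (fderiv ℂ S₀ x.2 v.2 *ᵥ (H₀ *ᵥ leafParam H₀ S₀ x))

theorem re_dotProduct_hermitian (hH : H₀.IsHermitian) (u v : Fin s → ℂ) :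
    (star u ⬝ᵥ (H₀ *ᵥ v)).re = (star v ⬝ᵥ (H₀ *ᵥ u)).re := by
  rw [← conj_re]
  change (star (_ : ℂ)).re = _
  rw [star_dotProduct_star', star_star, star_mulVec_conjMatrix, conjMatrix_of_isHermitian hH,
    ← dotProduct_mulVec_transpose]

/-- Let κ be the derivative of k along `v`. The derivative of Re zᵀH₀k is Re (v_zᵀH₀k + zᵀH₀κ).
Substituting z = conj k - S₀H₀k and its differential, the Hermitian symmetry of `H₀` and the
symmetry of `S₀` exchange the κ-term for terms in `v` and k alone. -/
theorem fderiv_modelFunction_explicit (hH : H₀.IsHermitian) (hU : IsUnit H₀.det)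
    (ha : AnalyticAt ℂ S₀ x.2) (hsymm : (S₀ x.2).IsSymm)
    (hk : AnalyticAt ℝ (leafParam H₀ S₀) x)
    (hu : ∀ᶠ y : (Fin s → ℂ) × (Fin r → ℂ) in 𝓝 x, IsUnit (pivot H₀ S₀ y.2).det)
    (v : (Fin s → ℂ) × (Fin r → ℂ)) :
    fderiv ℝ (modelFunction (explicitH H₀ S₀) (explicitS H₀ S₀)) x v
      = (explicitDel H₀ S₀ x v).re := by
  have hkd := hk.differentiableAt
  have hHk : DifferentiableAt ℝ (fun y => H₀ *ᵥ leafParam H₀ S₀ y) x :=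
    (differentiableAt_const H₀).mulVec hkd
  have hd : DifferentiableAt ℝ (fun y : (Fin s → ℂ) × (Fin r → ℂ) =>
      y.1 ⬝ᵥ (H₀ *ᵥ leafParam H₀ S₀ y)) x := differentiableAt_fst.dotProduct hHk
  have e : modelFunction (explicitH H₀ S₀) (explicitS H₀ S₀)
      = fun y => reCLM (y.1 ⬝ᵥ (H₀ *ᵥ leafParam H₀ S₀ y)) :=
    funext fun y => modelFunction_explicit hH hU y
  have h1 : HasFDerivAt (fun y : (Fin s → ℂ) × (Fin r → ℂ) =>
      reCLM (y.1 ⬝ᵥ (H₀ *ᵥ leafParam H₀ S₀ y))) _ x := reCLM.hasFDerivAt.comp x hd.hasFDerivAt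
  rw [e, h1.fderiv, ContinuousLinearMap.comp_apply,
    fderiv_dotProduct differentiableAt_fst hHk, fderiv_mulVec (differentiableAt_const H₀) hkd]
  have h2 := fderiv_leafParam ha hk hu v
  have h3 : fderiv ℝ (fun y : (Fin s → ℂ) × (Fin r → ℂ) => y.1) x v = v.1 := by
    rw [fderiv_fst]; rfl
  have h4 := star_leafParam_sub hu.self_of_nhds
  rw [← Matrix.mulVec_mulVec] at h4
  rw [h3, explicitDel]
  set k := leafParam H₀ S₀ x
  set κ := fderiv ℝ (leafParam H₀ S₀) x v
  have h5 := re_dotProduct_hermitian hH k κ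
  have h6 : (H₀ *ᵥ k) ⬝ᵥ (S₀ x.2 *ᵥ (H₀ *ᵥ κ)) = (H₀ *ᵥ κ) ⬝ᵥ (S₀ x.2 *ᵥ (H₀ *ᵥ k)) := by
    rw [dotProduct_mulVec_transpose, hsymm.eq]
  have h7 : x.1 ⬝ᵥ (H₀ *ᵥ κ) = star k ⬝ᵥ (H₀ *ᵥ κ) - (H₀ *ᵥ κ) ⬝ᵥ (S₀ x.2 *ᵥ (H₀ *ᵥ k)) := by
    rw [← h4, sub_dotProduct, dotProduct_comm (S₀ x.2 *ᵥ (H₀ *ᵥ k))]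
  have h8 : v.1 ⬝ᵥ (H₀ *ᵥ k) = star κ ⬝ᵥ (H₀ *ᵥ k) - ((H₀ *ᵥ k) ⬝ᵥ (S₀ x.2 *ᵥ (H₀ *ᵥ κ))
      + (H₀ *ᵥ k) ⬝ᵥ (fderiv ℂ S₀ x.2 v.2 *ᵥ (H₀ *ᵥ k))) := by
    rw [← h2, sub_dotProduct, add_dotProduct, dotProduct_comm (S₀ x.2 *ᵥ (H₀ *ᵥ κ)),
      dotProduct_comm (fderiv ℂ S₀ x.2 v.2 *ᵥ (H₀ *ᵥ k))]
  have h9 := congrArg re h8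
  simp only [sub_re, add_re] at h9
  simp only [fderiv_fun_const, Pi.zero_apply, _root_.zero_apply, Matrix.zero_mulVec, add_zero,
    reCLM_apply, add_re, h7, sub_re, mul_re, re_ofNat, im_ofNat, zero_mul, sub_zero]
  rw [h6] at h9
  linarith

theorem contDiffAt_modelFunction_explicit (hH : H₀.IsHermitian) (hU : IsUnit H₀.det)
    (hk : AnalyticAt ℝ (leafParam H₀ S₀) x) :
    ContDiffAt ℝ ∞ (modelFunction (explicitH H₀ S₀) (explicitS H₀ S₀)) x := by
  have e : modelFunction (explicitH H₀ S₀) (explicitS H₀ S₀)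
      = fun y => reCLM (y.1 ⬝ᵥ (H₀ *ᵥ leafParam H₀ S₀ y)) :=
    funext fun y => modelFunction_explicit hH hU y
  rw [e]
  exact ((reCLM.analyticAt _).fun_comp
    (analyticAt_fst.dotProduct (analyticAt_const.mulVec hk))).contDiffAt

/-- In `explicitDel` the base point enters holomorphically except through the leaf parameter, so ∂̄
falls only on the latter. -/
theorem leviForm_explicit (hH : H₀.IsHermitian) (hU : IsUnit H₀.det)
    (hx : IsRegularPoint H₀ S₀ x.2) (v u : (Fin s → ℂ) × (Fin r → ℂ)) :
    leviForm (modelFunction (explicitH H₀ S₀) (explicitS H₀ S₀)) x v u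
      = (2 * (u.1 ⬝ᵥ (H₀ *ᵥ twiceDbar (leafParam H₀ S₀) x v))
        + ((H₀ *ᵥ leafParam H₀ S₀ x) ⬝ᵥ
            (fderiv ℂ S₀ x.2 u.2 *ᵥ (H₀ *ᵥ twiceDbar (leafParam H₀ S₀) x v))
          + (H₀ *ᵥ twiceDbar (leafParam H₀ S₀) x v) ⬝ᵥ
            (fderiv ℂ S₀ x.2 u.2 *ᵥ (H₀ *ᵥ leafParam H₀ S₀ x)))).re := by
  have hev := hx.eventually
  have hk := hev.self_of_nhds.2.2.2
  have hkd := hk.differentiableAt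
  have hHk : DifferentiableAt ℝ (fun y => H₀ *ᵥ leafParam H₀ S₀ y) x :=
    (differentiableAt_const H₀).mulVec hkd
  have hS' : DifferentiableAt ℂ (fun y : (Fin s → ℂ) × (Fin r → ℂ) => fderiv ℂ S₀ y.2 u.2) x := by
    have h1 : DifferentiableAt ℂ (fderiv ℂ S₀) x.2 := hx.analytic.fderiv.differentiableAt
    exact (h1.comp x differentiableAt_snd).clm_apply (differentiableAt_const _)
  have hS'' := hS'.restrictScalars ℝ
  have hd1 : DifferentiableAt ℝ (fun y : (Fin s → ℂ) × (Fin r → ℂ) =>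
      u.1 ⬝ᵥ (H₀ *ᵥ leafParam H₀ S₀ y)) x := (differentiableAt_const _).dotProduct hHk
  have hd2 : DifferentiableAt ℝ (fun y : (Fin s → ℂ) × (Fin r → ℂ) =>
      (H₀ *ᵥ leafParam H₀ S₀ y) ⬝ᵥ (fderiv ℂ S₀ y.2 u.2 *ᵥ (H₀ *ᵥ leafParam H₀ S₀ y))) x :=
    hHk.dotProduct (hS''.mulVec hHk)
  have hd3 : DifferentiableAt ℝ (fun y : (Fin s → ℂ) × (Fin r → ℂ) =>
      2 * (u.1 ⬝ᵥ (H₀ *ᵥ leafParam H₀ S₀ y))) x := hd1.const_mul 2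
  have h2 : twiceDbar (fun y => H₀ *ᵥ leafParam H₀ S₀ y) x v
      = H₀ *ᵥ twiceDbar (leafParam H₀ S₀) x v := by
    rw [twiceDbar_mulVec (differentiableAt_const H₀) hkd, twiceDbar_const, Matrix.zero_mulVec,
      add_zero]
  have h3 : twiceDbar (fun y : (Fin s → ℂ) × (Fin r → ℂ) =>
      2 * (u.1 ⬝ᵥ (H₀ *ᵥ leafParam H₀ S₀ y))) x v
      = 2 * (u.1 ⬝ᵥ (H₀ *ᵥ twiceDbar (leafParam H₀ S₀) x v)) := by
    rw [← h2]
    have := twiceDbar_dotProduct (differentiableAt_const u.1) hHk v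
    rw [twiceDbar_const, zero_dotProduct, add_zero] at this
    rw [← this]
    simp only [twiceDbar, fderiv_const_mul hd1, _root_.smul_apply, smul_eq_mul]
    ring
  have key := leviForm_eq_re_twiceDbar (contDiffAt_modelFunction_explicit hH hU hk)
    (Θ := explicitDel H₀ S₀)
    (by
      filter_upwards [hev, hev.eventually_nhds] with y hy hy' v
      exact fderiv_modelFunction_explicit hH hU hy.1 hy.2.1 hy.2.2.2
        (hy'.mono fun _ h => h.2.2.1) v)
    (by
      intro y v
      simp only [explicitDel, Prod.smul_fst, Prod.smul_snd, smul_dotProduct, map_smul,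
        Matrix.smul_mulVec, dotProduct_smul, smul_eq_mul]
      ring) u (hd3.add hd2) v
  rw [key]
  congr 1
  change twiceDbar (fun y => 2 * (u.1 ⬝ᵥ (H₀ *ᵥ leafParam H₀ S₀ y))
    + (H₀ *ᵥ leafParam H₀ S₀ y) ⬝ᵥ (fderiv ℂ S₀ y.2 u.2 *ᵥ (H₀ *ᵥ leafParam H₀ S₀ y))) x v = _
  rw [twiceDbar_add hd3 hd2, h3, twiceDbar_dotProduct hHk (hS''.mulVec hHk),
    twiceDbar_mulVec hS'' hHk, twiceDbar_eq_zero hS', h2, Matrix.zero_mulVec, add_zero]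

/-- Test vectors with vanishing ζ-component isolate `H₀ *ᵥ twiceDbar (leafParam H₀ S₀) x v`, and
`H₀` is invertible. -/
theorem leviForm_explicit_eq_zero_iff (hH : H₀.IsHermitian) (hU : IsUnit H₀.det)
    (hx : IsRegularPoint H₀ S₀ x.2) (v : (Fin s → ℂ) × (Fin r → ℂ)) :
    (∀ u, leviForm (modelFunction (explicitH H₀ S₀) (explicitS H₀ S₀)) x v u = 0)
      ↔ twiceDbar (leafParam H₀ S₀) x v = 0 := by
  constructor
  · intro h
    refine eq_zero_of_mulVec_eq_zero hU (eq_zero_of_re_dotProduct fun u => ?_)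
    have := h (u, 0)
    rw [leviForm_explicit hH hU hx] at this
    simpa using this
  · intro h u
    rw [leviForm_explicit hH hU hx, h]
    simp

/-- For fixed ζ only the summand conj z of the defining formula is not holomorphic in z. -/
theorem twiceDbar_leafParam_fst (hx : IsRegularPoint H₀ S₀ x.2) (u : Fin s → ℂ) :
    twiceDbar (leafParam H₀ S₀) x (u, 0) = (2 : ℂ) • ((pivot H₀ S₀ x.2)⁻¹ *ᵥ star u) := by
  have hB : AnalyticAt ℝ (fun ζ => S₀ ζ * H₀) x.2 :=
    (hx.analytic.restrictScalars).mul analyticAt_const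
  have h1 : DifferentiableAt ℝ (fun ζ => conjMatrix (S₀ ζ * H₀)) x.2 :=
    (analyticAt_conjMatrix hB).differentiableAt
  have h2 : DifferentiableAt ℝ (fun ζ => (pivot H₀ S₀ ζ)⁻¹) x.2 :=
    ((analyticAt_pivot (H₀ := H₀) hx.analytic).matrix_inv hx.unit).differentiableAt
  have hz : ∀ A : (Fin r → ℂ) → Matrix (Fin s) (Fin s) ℂ, DifferentiableAt ℝ A x.2 →
      DifferentiableAt ℝ (fun y : (Fin s → ℂ) × (Fin r → ℂ) => A y.2) x ∧
      ∀ u, fderiv ℝ (fun y : (Fin s → ℂ) × (Fin r → ℂ) => A y.2) x (u, 0) = 0 := by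
    intro A hA
    refine ⟨hA.comp x differentiableAt_snd, fun u => ?_⟩
    have h := fderiv_comp_snd_real hA ((u, 0) : (Fin s → ℂ) × (Fin r → ℂ))
    rwa [map_zero] at h
  obtain ⟨a1, b1⟩ := hz _ h1
  obtain ⟨a2, b2⟩ := hz _ h2
  have hfst : DifferentiableAt ℝ (fun y : (Fin s → ℂ) × (Fin r → ℂ) => y.1) x :=
    differentiableAt_fst
  have hst : DifferentiableAt ℝ (fun y : (Fin s → ℂ) × (Fin r → ℂ) => star y.1) x :=
    (analyticAt_star_vec analyticAt_fst).differentiableAt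
  have key : ∀ u, fderiv ℝ (leafParam H₀ S₀) x (u, 0)
      = (pivot H₀ S₀ x.2)⁻¹ *ᵥ (star u + conjMatrix (S₀ x.2 * H₀) *ᵥ u) := by
    intro u
    change fderiv ℝ (fun y : (Fin s → ℂ) × (Fin r → ℂ) => (pivot H₀ S₀ y.2)⁻¹ *ᵥ
      (star y.1 + conjMatrix (S₀ y.2 * H₀) *ᵥ y.1)) x (u, 0) = _
    rw [fderiv_mulVec a2 (hst.fun_add (a1.mulVec hfst)), b2, fderiv_fun_add hst (a1.mulVec hfst),
      _root_.add_apply, fderiv_star_vec hfst, fderiv_mulVec a1 hfst, b1, fderiv_fst]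
    simp
  have e : I • ((u, 0) : (Fin s → ℂ) × (Fin r → ℂ)) = (I • u, 0) := by simp
  rw [twiceDbar, e, key, key, ← Matrix.mulVec_smul, ← Matrix.mulVec_smul, ← Matrix.mulVec_add,
    star_smul, Matrix.mulVec_smul, smul_add, smul_smul, smul_smul]
  congr 1
  simp only [star_def, conj_I, mul_neg, I_mul_I, neg_neg]
  module

theorem twiceDbar_sub_arg {E W : Type*} [NormedAddCommGroup E] [NormedSpace ℂ E]
    [NormedAddCommGroup W] [NormedSpace ℂ W] (f : E → W) (p v u : E) :
    twiceDbar f p (v - u) = twiceDbar f p v - twiceDbar f p u := by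
  simp only [twiceDbar, smul_sub, map_sub]
  abel

/-- The vectors (-S₀'(η)H₀k, η) are tangent to the leaves, along which k is constant. Modulo them
only vectors `(u, 0)` remain, and on these ∂̄k is injective. -/
theorem twiceDbar_leafParam_eq_zero_iff (hx : IsRegularPoint H₀ S₀ x.2)
    (v : (Fin s → ℂ) × (Fin r → ℂ)) :
    twiceDbar (leafParam H₀ S₀) x v = 0
      ↔ v.1 = -(fderiv ℂ S₀ x.2 v.2 *ᵥ (H₀ *ᵥ leafParam H₀ S₀ x)) := by
  have hev := hx.eventually
  have hk := hev.self_of_nhds.2.2.2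
  have h1 : ∀ η : Fin r → ℂ, fderiv ℝ (leafParam H₀ S₀) x
      (-(fderiv ℂ S₀ x.2 η *ᵥ (H₀ *ᵥ leafParam H₀ S₀ x)), η) = 0 := by
    intro η
    have h2 := fderiv_leafParam hx.analytic hk (hev.mono fun _ h => h.2.2.1)
      (-(fderiv ℂ S₀ x.2 η *ᵥ (H₀ *ᵥ leafParam H₀ S₀ x)), η)
    -- In such a direction the derivative κ of k satisfies conj κ = S₀H₀κ, which forces κ = 0.
    refine eq_zero_of_star_eq hx.unit ?_
    rw [← sub_eq_zero, ← Matrix.mulVec_mulVec]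
    simp only at h2
    rw [← sub_sub, sub_eq_neg_self] at h2
    exact h2
  have h2 : ∀ η : Fin r → ℂ, twiceDbar (leafParam H₀ S₀) x
      (-(fderiv ℂ S₀ x.2 η *ᵥ (H₀ *ᵥ leafParam H₀ S₀ x)), η) = 0 := by
    intro η
    have e : I • ((-(fderiv ℂ S₀ x.2 η *ᵥ (H₀ *ᵥ leafParam H₀ S₀ x)), η) :
        (Fin s → ℂ) × (Fin r → ℂ))
        = (-(fderiv ℂ S₀ x.2 (I • η) *ᵥ (H₀ *ᵥ leafParam H₀ S₀ x)), I • η) := by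
      simp [Matrix.smul_mulVec]
    rw [twiceDbar, e, h1, h1, smul_zero, add_zero]
  constructor
  · intro h
    have e : v - (-(fderiv ℂ S₀ x.2 v.2 *ᵥ (H₀ *ᵥ leafParam H₀ S₀ x)), v.2)
        = (v.1 - -(fderiv ℂ S₀ x.2 v.2 *ᵥ (H₀ *ᵥ leafParam H₀ S₀ x)), 0) := by
      ext <;> simp
    have h3 := twiceDbar_sub_arg (leafParam H₀ S₀) x v
      (-(fderiv ℂ S₀ x.2 v.2 *ᵥ (H₀ *ᵥ leafParam H₀ S₀ x)), v.2)
    rw [h, h2, sub_zero, e, twiceDbar_leafParam_fst hx,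
      smul_eq_zero_iff_right (two_ne_zero' ℂ)] at h3
    have h4 := eq_zero_of_mulVec_eq_zero (Matrix.isUnit_nonsing_inv_det _ hx.unit) h3
    rwa [star_eq_zero, sub_eq_zero] at h4
  · intro h
    have h3 := h2 v.2
    rwa [← h] at h3

end ExplicitKernel

/-! ### The explicit models are 2-nondegenerate -/

section ExplicitModelIsModel

open Complex
open scoped Matrix.Norms.Operator

variable {s r : ℕ} {H₀ : Matrix (Fin s) (Fin s) ℂ} {S₀ : (Fin r → ℂ) → Matrix (Fin s) (Fin s) ℂ}

theorem twiceDbar_comp {E E' W : Type*} [NormedAddCommGroup E] [NormedSpace ℂ E]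
    [NormedAddCommGroup E'] [NormedSpace ℂ E'] [NormedAddCommGroup W] [NormedSpace ℂ W]
    {f : E' → W} {g : E → E'} {p : E} (hf : DifferentiableAt ℂ f (g p))
    (hg : DifferentiableAt ℝ g p) (v : E) :
    twiceDbar (fun x => f (g x)) p v = fderiv ℂ f (g p) (twiceDbar g p v) := by
  have h : HasFDerivAt (fun x => f (g x)) _ p :=
    (hf.hasFDerivAt.restrictScalars ℝ).comp p hg.hasFDerivAt
  rw [twiceDbar, h.fderiv, twiceDbar, map_add, (fderiv ℂ f (g p)).map_smul]
  rfl

/-- Along a section both the base point and the direction vary, so the derivative of `f` is needed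
as a joint holomorphic function, linear in the direction. -/
theorem fderiv_uncurry_fderiv {E' W : Type*} [NormedAddCommGroup E'] [NormedSpace ℂ E']
    [NormedAddCommGroup W] [NormedSpace ℂ W] [CompleteSpace W] {f : E' → W} {ζ c : E'}
    (ha : AnalyticAt ℂ f ζ) :
    DifferentiableAt ℂ (fun y : E' × E' => fderiv ℂ f y.1 y.2) (ζ, c) ∧
    ∀ c', fderiv ℂ (fun y : E' × E' => fderiv ℂ f y.1 y.2) (ζ, c) (0, c')
      = fderiv ℂ f ζ c' := by
  have h1 : HasFDerivAt (fun y : E' × E' => fderiv ℂ f y.1) _ (ζ, c) :=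
    HasFDerivAt.comp (g := fderiv ℂ f) (f := Prod.fst) (ζ, c)
      (ha.fderiv.differentiableAt.hasFDerivAt) hasFDerivAt_fst
  have h2 := h1.clm_apply (hasFDerivAt_snd (𝕜 := ℂ) (p := ((ζ, c) : E' × E')))
  refine ⟨h2.differentiableAt, fun c' => ?_⟩
  rw [h2.fderiv]
  simp

section Kernel

variable {p : ModelSpace s r} (hH : H₀.IsHermitian) (hU : IsUnit H₀.det)
  (hx : IsRegularPoint H₀ S₀ p.2.2)

include hH hU hx

theorem eventually_contDiffAt_modelFunction :
    ∀ᶠ x in 𝓝 p.2, ContDiffAt ℝ ∞ (modelFunction (explicitH H₀ S₀) (explicitS H₀ S₀)) x := by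
  filter_upwards [hx.eventually] with y hy
    using contDiffAt_modelFunction_explicit hH hU hy.2.2.2

theorem differentiableAt_modelFunction :
    DifferentiableAt ℝ (modelFunction (explicitH H₀ S₀) (explicitS H₀ S₀)) p.2 :=
  (eventually_contDiffAt_modelFunction hH hU hx).self_of_nhds.differentiableAt (by simp)

theorem fderiv_modelFunction_regular (v : (Fin s → ℂ) × (Fin r → ℂ)) :
    fderiv ℝ (modelFunction (explicitH H₀ S₀) (explicitS H₀ S₀)) p.2 v
      = (explicitDel H₀ S₀ p.2 v).re := by
  have h := hx.eventually
  exact fderiv_modelFunction_explicit hH hU hx.analytic h.self_of_nhds.2.1 h.self_of_nhds.2.2.2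
    (h.mono fun _ h => h.2.2.1) v

theorem twiceDel_explicit (v : (Fin s → ℂ) × (Fin r → ℂ)) :
    twiceDel (modelFunction (explicitH H₀ S₀) (explicitS H₀ S₀)) p.2 v
      = explicitDel H₀ S₀ p.2 v := by
  have h : explicitDel H₀ S₀ p.2 (I • v) = I * explicitDel H₀ S₀ p.2 v := by
    simp only [explicitDel, Prod.smul_fst, Prod.smul_snd, smul_dotProduct, map_smul,
      Matrix.smul_mulVec, dotProduct_smul, smul_eq_mul]
    ring
  rw [twiceDel, fderiv_modelFunction_regular hH hU hx, fderiv_modelFunction_regular hH hU hx, h]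
  apply Complex.ext <;> simp

theorem mem_leviKernel_explicit
    (hp : graphFunction (modelFunction (explicitH H₀ S₀) (explicitS H₀ S₀)) p = 0)
    (v : ModelSpace s r) :
    v ∈ leviKernel (graphFunction (modelFunction (explicitH H₀ S₀) (explicitS H₀ S₀))) p ↔
      v.1 = explicitDel H₀ S₀ p.2 v.2 ∧
        v.2.1 = -(fderiv ℂ S₀ p.2.2 v.2.2 *ᵥ (H₀ *ᵥ leafParam H₀ S₀ p.2)) := by
  rw [mem_leviKernel_graph (eventually_contDiffAt_modelFunction hH hU hx) hp,
    mem_holTangent_graph (differentiableAt_modelFunction hH hU hx), twiceDel_explicit hH hU hx,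
    leviForm_explicit_eq_zero_iff hH hU hx, twiceDbar_leafParam_eq_zero_iff hx]

theorem finrank_leviKernel_explicit
    (hp : graphFunction (modelFunction (explicitH H₀ S₀) (explicitS H₀ S₀)) p = 0) :
    Module.finrank ℂ
      (leviKernel (graphFunction (modelFunction (explicitH H₀ S₀) (explicitS H₀ S₀))) p) = r := by
  have hm := mem_leviKernel_explicit hH hU hx hp
  have e := LinearEquiv.finrank_eq (LinearEquiv.ofBijective
    ((LinearMap.snd ℂ (Fin s → ℂ) (Fin r → ℂ)) ∘ₗ (LinearMap.snd ℂ ℂ _) ∘ₗ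
      (leviKernel (graphFunction
        (modelFunction (explicitH H₀ S₀) (explicitS H₀ S₀))) p).subtype) ⟨?_, ?_⟩)
  · rw [e]
    simp
  · rintro ⟨⟨v1, v2, v3⟩, hv⟩ ⟨⟨u1, u2, u3⟩, hu⟩ h
    obtain ⟨a1, a2⟩ := (hm _).mp hv
    obtain ⟨b1, b2⟩ := (hm _).mp hu
    simp only at a1 a2 b1 b2
    have h3 : v3 = u3 := h
    subst h3
    have h2 : v2 = u2 := by rw [a2, b2]
    subst h2
    have h1 : v1 = u1 := by rw [a1, b1]
    subst h1
    rfl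
  · intro η
    exact ⟨⟨(explicitDel H₀ S₀ p.2 (-(fderiv ℂ S₀ p.2.2 η *ᵥ (H₀ *ᵥ leafParam H₀ S₀ p.2)), η),
      -(fderiv ℂ S₀ p.2.2 η *ᵥ (H₀ *ᵥ leafParam H₀ S₀ p.2)), η), (hm _).mpr ⟨rfl, rfl⟩⟩, rfl⟩

/-- A section `X` of the Levi kernel satisfies X_z + S₀'(X_ζ)H₀k = 0 on the hypersurface. Under ∂̄
along a CR vector the terms with ∂̄X cancel, because ∂̄X is itself Levi-null, and S₀'(X_ζ)H₀∂̄k = 0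
remains. Since ∂̄k takes all values, S₀'(X_ζ) = 0. -/
theorem secondLeviKernel_explicit
    (hp : graphFunction (modelFunction (explicitH H₀ S₀) (explicitS H₀ S₀)) p = 0) :
    secondLeviKernel (graphFunction (modelFunction (explicitH H₀ S₀) (explicitS H₀ S₀))) p = ⊥ := by
  have hFd := differentiableAt_modelFunction hH hU hx
  have hev := hx.eventually
  have hk := hev.self_of_nhds.2.2.2
  rw [eq_bot_iff]
  intro v hv
  rw [mem_secondLeviKernel_graph (eventually_contDiffAt_modelFunction hH hU hx) hp] at hv
  obtain ⟨X, hX, rfl, h⟩ := hv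
  have hXd := hX.differentiableAt
  obtain ⟨e1, e2⟩ := (mem_leviKernel_explicit hH hU hx hp _).mp (hX.2.self_of_nhds hp)
  let A : ModelSpace s r → Matrix (Fin s) (Fin s) ℂ := fun q => fderiv ℂ S₀ q.2.2 (X q).2.2
  let κ : ModelSpace s r → Fin s → ℂ := fun q => H₀ *ᵥ leafParam H₀ S₀ q.2
  let Xz : ModelSpace s r → Fin s → ℂ := fun q => (X q).2.1
  have hvan : ∀ᶠ q in 𝓝 p,
      graphFunction (modelFunction (explicitH H₀ S₀) (explicitS H₀ S₀)) q = 0 →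
        Xz q + A q *ᵥ κ q = 0 := by
    have hr : ∀ᶠ x : (Fin s → ℂ) × (Fin r → ℂ) in 𝓝 p.2, (∀ᶠ y in 𝓝 x, ContDiffAt ℝ ∞
        (modelFunction (explicitH H₀ S₀) (explicitS H₀ S₀)) y) :=
      (eventually_contDiffAt_modelFunction hH hU hx).eventually_nhds
    have hinj : ∀ᶠ ζ in 𝓝 p.2.2, IsRegularPoint H₀ S₀ ζ := by
      have h5 : ∀ᶠ ζ in 𝓝 p.2.2,
          LinearIndependent ℂ fun α : Fin r => fderiv ℂ S₀ ζ (Pi.single α 1) :=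
        (continuous_fderiv_single hx.analytic).eventually
          (isOpen_setOfPred_linearIndependent.mem_nhds
            ((fderiv_injective_iff _).mp hx.independent))
      have h4 := eventually_isUnit_det (analyticAt_pivot (H₀ := H₀) hx.analytic).continuousAt hx.unit
      filter_upwards [hx.analytic.eventually_analyticAt, hx.symmetric.eventually_nhds, h4, h5]
        with ζ a b c d using ⟨a, b, c, (fderiv_injective_iff _).mpr d⟩
    have h22 : ContinuousAt (fun q : ModelSpace s r => q.2.2) p :=
      (continuous_snd.comp continuous_snd).continuousAt
    filter_upwards [hX.2, h22.eventually hinj] with q hq hqr hMq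
    have := ((mem_leviKernel_explicit hH hU hqr hMq _).mp (hq hMq)).2
    simp only [Xz, A, κ, this, neg_add_cancel]
  have hXz : DifferentiableAt ℝ Xz p := hXd.snd.fst
  have h22 : DifferentiableAt ℝ (fun q : ModelSpace s r => q.2.2) p :=
    differentiableAt_snd.snd
  have hg : DifferentiableAt ℝ (fun q : ModelSpace s r => (q.2.2, (X q).2.2)) p :=
    h22.prodMk hXd.snd.snd
  obtain ⟨hB, hB'⟩ := fderiv_uncurry_fderiv (c := (X p).2.2) hx.analytic
  have hA : DifferentiableAt ℝ A p :=
    DifferentiableAt.comp p (g := fun y : (Fin r → ℂ) × (Fin r → ℂ) => fderiv ℂ S₀ y.1 y.2)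
      (hB.restrictScalars ℝ) hg
  have hkp : DifferentiableAt ℝ (fun q : ModelSpace s r => leafParam H₀ S₀ q.2) p :=
    hk.differentiableAt.comp p differentiableAt_snd
  have hκ : DifferentiableAt ℝ κ p := (differentiableAt_const H₀).mulVec hkp
  have hzero : fderiv ℂ S₀ p.2.2 (X p).2.2 = 0 := by
    have key : ∀ u : Fin s → ℂ, fderiv ℂ S₀ p.2.2 (X p).2.2 *ᵥ
        (H₀ *ᵥ twiceDbar (leafParam H₀ S₀) p.2 (u, 0)) = 0 := by
      intro u
      set y : ModelSpace s r := (explicitDel H₀ S₀ p.2 (u, 0), u, 0) with hy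
      have hyT : y ∈ holTangent
          (graphFunction (modelFunction (explicitH H₀ S₀) (explicitS H₀ S₀))) p := by
        rw [mem_holTangent_graph hFd, twiceDel_explicit hH hU hx]
      have h1 := (twiceDbar_leafParam_eq_zero_iff hx _).mp
        ((leviForm_explicit_eq_zero_iff hH hU hx _).mp (h y hyT))
      -- The relation vanishes only on the hypersurface, but `y` and `I • y` are both tangent to it.
      have h2 : twiceDbar (fun q => Xz q + A q *ᵥ κ q) p y = 0 := by
        have hd := hXz.fun_add (hA.mulVec hκ)
        rw [twiceDbar, fderiv_eq_zero_of_vanishing hFd hp hd hvan hyT.1,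
          fderiv_eq_zero_of_vanishing hFd hp hd hvan hyT.2, smul_zero, add_zero]
      have h3 : twiceDbar Xz p y = (twiceDbar X p y).2.1 := by
        have : HasFDerivAt Xz _ p := hXd.hasFDerivAt.snd.fst
        rw [twiceDbar, this.fderiv]
        rfl
      -- The map (ζ, c) ↦ S₀'(ζ)c is holomorphic, so only the ∂̄-derivative of its arguments enters,
      -- and that of ζ vanishes.
      have h4 : twiceDbar A p y = fderiv ℂ S₀ p.2.2 (twiceDbar X p y).2.2 := by
        have a1 : twiceDbar A p y = _ := twiceDbar_comp
          (f := fun y : (Fin r → ℂ) × (Fin r → ℂ) => fderiv ℂ S₀ y.1 y.2)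
          (g := fun q : ModelSpace s r => (q.2.2, (X q).2.2)) hB hg y
        have a2 : twiceDbar (fun q : ModelSpace s r => (q.2.2, (X q).2.2)) p y
            = (0, (twiceDbar X p y).2.2) := by
          have b1 : HasFDerivAt (fun q : ModelSpace s r => (q.2.2, (X q).2.2)) _ p :=
            (hasFDerivAt_snd.snd).prodMk hXd.hasFDerivAt.snd.snd
          rw [twiceDbar, b1.fderiv]
          ext i
          · simp [hy]
          · rfl
        rw [a1, a2]
        exact hB' _
      have h5 : twiceDbar κ p y = H₀ *ᵥ twiceDbar (leafParam H₀ S₀) p.2 (u, 0) := by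
        have b1 := twiceDbar_mulVec (differentiableAt_const H₀) hkp y
        have b2 : twiceDbar (fun q : ModelSpace s r => leafParam H₀ S₀ q.2) p y
            = twiceDbar (leafParam H₀ S₀) p.2 (u, 0) := by
          rw [twiceDbar, fderiv_comp_snd_real hk.differentiableAt,
            fderiv_comp_snd_real hk.differentiableAt]
          rfl
        rw [b2, twiceDbar_const, Matrix.zero_mulVec, add_zero] at b1
        exact b1
      rw [twiceDbar_add hXz (hA.mulVec hκ), twiceDbar_mulVec hA hκ, h3, h4, h5, h1] at h2
      simp only [A, κ] at h2
      rw [add_comm, add_assoc, add_neg_cancel, add_zero] at h2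
      exact h2
    have h6 : ∀ w : Fin s → ℂ, fderiv ℂ S₀ p.2.2 (X p).2.2 *ᵥ w = 0 := by
      intro w
      -- For this `u`, `twiceDbar_leafParam_fst` makes `H₀ *ᵥ twiceDbar (leafParam H₀ S₀) p.2 (u,
      -- 0)` equal to twice `w`.
      have h7 := key (star (pivot H₀ S₀ p.2.2 *ᵥ (H₀⁻¹ *ᵥ w)))
      rw [twiceDbar_leafParam_fst hx, star_star, Matrix.mulVec_mulVec (H₀⁻¹ *ᵥ w),
        Matrix.nonsing_inv_mul _ hx.unit, Matrix.one_mulVec, Matrix.mulVec_smul,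
        Matrix.mulVec_mulVec w, Matrix.mul_nonsing_inv _ hU, Matrix.one_mulVec,
        Matrix.mulVec_smul] at h7
      exact (smul_eq_zero_iff_right (two_ne_zero' ℂ)).mp h7
    ext i j
    have := congrFun (h6 (Pi.single j 1)) i
    simpa using this
  have h3 := hx.independent _ hzero
  have h2 : (X p).2.1 = 0 := by rw [e2, hzero]; simp
  have h23 : (X p).2 = 0 := Prod.ext h2 h3
  have h1 : (X p).1 = 0 := by rw [e1, h23]; simp [explicitDel]
  exact Prod.ext h1 h23

end Kernel

/-- The positivity of `r` serves only to make the Levi kernel, which has dimension `r`, nonzero. -/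
theorem IsModelData.isTwoNondegenerateModel (h : IsModelData H₀ S₀) (hr : 0 < r) :
    IsTwoNondegenerateModel (explicitH H₀ S₀) (explicitS H₀ S₀) := by
  have hH := h.hermitian
  have hU := h.nondegenerate
  have hreg := h.eventually_isRegularPoint
  have h0 := hreg.self_of_nhds
  have hS : AnalyticAt ℝ S₀ 0 := h.analyticAt.restrictScalars
  have hB : AnalyticAt ℝ (fun ζ => S₀ ζ * H₀) 0 := hS.mul analyticAt_const
  have hP := (analyticAt_pivot (H₀ := H₀) h.analyticAt).matrix_inv h0.unit
  have h22 : ContinuousAt (fun q : ModelSpace s r => q.2.2) 0 :=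
    (continuous_snd.comp continuous_snd).continuousAt
  have hregp : ∀ᶠ p : ModelSpace s r in 𝓝 0, IsRegularPoint H₀ S₀ p.2.2 := h22.eventually hreg
  refine ⟨analyticAt_matrix_iff.mp ?_, analyticAt_matrix_iff.mp ?_, ?_, ?_, ?_, ?_, ?_⟩
  · have e : explicitH H₀ S₀ = fun ζ => H₀ * (pivot H₀ S₀ ζ)⁻¹ :=
      funext fun ζ => explicitH_eq hH hU ζ
    rw [e]
    exact analyticAt_const.mul hP
  · have e : explicitS H₀ S₀ = fun ζ =>
        conjMatrix (H₀ * (pivot H₀ S₀ ζ)⁻¹ * conjMatrix (S₀ ζ * H₀)) := by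
      funext ζ
      rw [← conjMatrix_explicitS hH, conjMatrix_conjMatrix]
    rw [e]
    exact analyticAt_conjMatrix ((analyticAt_const.mul hP).mul (analyticAt_conjMatrix hB))
  · filter_upwards [hreg] with ζ hζ using isHermitian_explicitH hH hζ.symmetric.self_of_nhds
  · filter_upwards [hreg] with ζ hζ
      using isSymm_explicitS hH hζ.symmetric.self_of_nhds hζ.unit
  · rw [explicitH_eq hH hU]
    simpa [pivot, h.vanishing, conjMatrix] using hU
  · filter_upwards [hregp] with p hp hMp
    rw [modelDefiningFunction_eq] at hMp ⊢
    rw [HasLeviRank, finrank_leviKernel_explicit hH hU hp hMp,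
      finrank_holTangent (differentiableAt_modelFunction hH hU hp)]
    simp [add_comm]
  · filter_upwards [hregp] with p hp hMp
    rw [modelDefiningFunction_eq] at hMp ⊢
    refine ⟨fun hbot => ?_, secondLeviKernel_explicit hH hU hp hMp⟩
    have := finrank_leviKernel_explicit hH hU hp hMp
    rw [hbot, finrank_bot] at this
    omega

end ExplicitModelIsModel

/-! ### Leaves and Heisenberg symmetries of the explicit models -/

section ExplicitSymmetries

open Complex
open scoped Matrix.Norms.Operator

variable {s r : ℕ} (H₀ : Matrix (Fin s) (Fin s) ℂ) (S₀ : (Fin r → ℂ) → Matrix (Fin s) (Fin s) ℂ)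

/-- The infinitesimal generators of the Heisenberg group acting on the explicit model. -/
noncomputable def heisenbergField (c : Fin s → ℂ) (t : ℝ) (p : ModelSpace s r) : ModelSpace s r :=
  (2 * (p.2.1 ⬝ᵥ (H₀ *ᵥ star c)) + I * t, c - S₀ p.2.2 *ᵥ (H₀ *ᵥ star c), 0)

/-- The point over `ζ` of the leaf of the Levi kernel with parameters `c`, `t`. -/
noncomputable def leafPoint (c : Fin s → ℂ) (t : ℝ) (ζ : Fin r → ℂ) : ModelSpace s r :=
  (I * t + c ⬝ᵥ (H₀ *ᵥ star c) - (H₀ *ᵥ star c) ⬝ᵥ (S₀ ζ *ᵥ (H₀ *ᵥ star c)),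
    c - S₀ ζ *ᵥ (H₀ *ᵥ star c), ζ)

variable {H₀ S₀} (hH : H₀.IsHermitian) (hU : IsUnit H₀.det)

/-- At a leaf point the vector to which the inverse pivot is applied is the pivot times `star c`. -/
theorem leafParam_leafPoint {ζ : Fin r → ℂ} (hu : IsUnit (pivot H₀ S₀ ζ).det) (c : Fin s → ℂ)
    (t : ℝ) : leafParam H₀ S₀ (leafPoint H₀ S₀ c t ζ).2 = star c := by
  have h : star (leafPoint H₀ S₀ c t ζ).2.1
      + conjMatrix (S₀ ζ * H₀) *ᵥ (leafPoint H₀ S₀ c t ζ).2.1 = pivot H₀ S₀ ζ *ᵥ star c := by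
    simp only [leafPoint, Matrix.mulVec_mulVec, star_sub, star_mulVec_conjMatrix, star_star,
      pivot, Matrix.sub_mulVec, Matrix.one_mulVec, Matrix.mulVec_sub]
    abel
  rw [leafParam]
  change (pivot H₀ S₀ ζ)⁻¹ *ᵥ (_ + conjMatrix (S₀ ζ * H₀) *ᵥ _) = _
  rw [h, Matrix.mulVec_mulVec, Matrix.nonsing_inv_mul _ hu, Matrix.one_mulVec]

include hH in
theorem re_hermitian_form (c : Fin s → ℂ) :
    c ⬝ᵥ (H₀ *ᵥ star c) = ((c ⬝ᵥ (H₀ *ᵥ star c)).re : ℂ) := by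
  rw [eq_comm, ← conj_eq_iff_re]
  change star (_ : ℂ) = _
  rw [star_dotProduct_star', star_mulVec_conjMatrix, star_star, conjMatrix_of_isHermitian hH,
    ← dotProduct_mulVec_transpose]

include hH hU in
theorem graphFunction_leafPoint {ζ : Fin r → ℂ} (hu : IsUnit (pivot H₀ S₀ ζ).det) (c : Fin s → ℂ)
    (t : ℝ) : graphFunction (modelFunction (explicitH H₀ S₀) (explicitS H₀ S₀))
      (leafPoint H₀ S₀ c t ζ) = 0 := by
  rw [graphFunction, modelFunction_explicit hH hU, leafParam_leafPoint hu]
  simp only [leafPoint, sub_dotProduct, sub_re, add_re, mul_re, I_re, zero_mul, I_im, ofReal_im,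
    mul_zero, zero_add, dotProduct_comm (S₀ ζ *ᵥ (H₀ *ᵥ star c)), sub_self]

include hH hU in
/-- Every point of the explicit model over a regular point lies on a leaf. -/
theorem eq_leafPoint {p : ModelSpace s r} (hu : IsUnit (pivot H₀ S₀ p.2.2).det)
    (hp : graphFunction (modelFunction (explicitH H₀ S₀) (explicitS H₀ S₀)) p = 0) :
    p = leafPoint H₀ S₀ (star (leafParam H₀ S₀ p.2))
      (p.1 + (H₀ *ᵥ leafParam H₀ S₀ p.2) ⬝ᵥ (S₀ p.2.2 *ᵥ (H₀ *ᵥ leafParam H₀ S₀ p.2))).im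
      p.2.2 := by
  have h1 := star_leafParam_sub hu
  rw [← Matrix.mulVec_mulVec] at h1
  set k := leafParam H₀ S₀ p.2 with hk
  -- The Hermitian form is real, so it does not disturb the imaginary part of `w`, from which the
  -- parameter `t` is read off.
  have h2 := re_hermitian_form hH (star k)
  have h3 : p.1.re = (p.2.1 ⬝ᵥ (H₀ *ᵥ k)).re := by
    rw [graphFunction, modelFunction_explicit hH hU, sub_eq_zero] at hp
    exact hp
  rw [← h1, sub_dotProduct, dotProduct_comm (S₀ p.2.2 *ᵥ (H₀ *ᵥ k)), sub_re] at h3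
  rw [star_star] at h2
  have h4 := congrArg im h2
  rw [ofReal_im] at h4
  refine Prod.ext ?_ (Prod.ext ?_ rfl)
  · rw [leafPoint, star_star]
    apply Complex.ext
    · simp [h3]
    · simp [h4]
  · rw [leafPoint, star_star, h1]

theorem analyticAt_leafPoint {ζ : Fin r → ℂ} (ha : AnalyticAt ℂ S₀ ζ) (c : Fin s → ℂ) (t : ℝ) :
    AnalyticAt ℂ (leafPoint H₀ S₀ c t) ζ := by
  have h1 : AnalyticAt ℂ (fun ζ => S₀ ζ *ᵥ (H₀ *ᵥ star c)) ζ := ha.mulVec analyticAt_const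
  exact (analyticAt_const.sub (analyticAt_const.dotProduct h1)).prod
    ((analyticAt_const.sub h1).prod analyticAt_id)

theorem fderiv_leafPoint {ζ : Fin r → ℂ} (ha : AnalyticAt ℂ S₀ ζ) (c : Fin s → ℂ) (t : ℝ)
    (η : Fin r → ℂ) : fderiv ℂ (leafPoint H₀ S₀ c t) ζ η
      = (-((H₀ *ᵥ star c) ⬝ᵥ (fderiv ℂ S₀ ζ η *ᵥ (H₀ *ᵥ star c))),
        -(fderiv ℂ S₀ ζ η *ᵥ (H₀ *ᵥ star c)), η) := by
  have hd := ha.differentiableAt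
  have h1 : DifferentiableAt ℂ (fun ζ => S₀ ζ *ᵥ (H₀ *ᵥ star c)) ζ :=
    hd.mulVec (differentiableAt_const _)
  have h2 : DifferentiableAt ℂ (fun ζ => (H₀ *ᵥ star c) ⬝ᵥ (S₀ ζ *ᵥ (H₀ *ᵥ star c))) ζ :=
    (differentiableAt_const _).dotProduct h1
  have h3 : HasFDerivAt (leafPoint H₀ S₀ c t) _ ζ :=
    ((hasFDerivAt_const (I * t + c ⬝ᵥ (H₀ *ᵥ star c)) ζ).sub h2.hasFDerivAt).prodMk
      (((hasFDerivAt_const c ζ).sub h1.hasFDerivAt).prodMk (hasFDerivAt_id ζ))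
  rw [h3.fderiv]
  have h4 : fderiv ℂ (fun ζ => S₀ ζ *ᵥ (H₀ *ᵥ star c)) ζ η
      = fderiv ℂ S₀ ζ η *ᵥ (H₀ *ᵥ star c) := by
    rw [fderiv_mulVec hd (differentiableAt_const _)]
    simp
  have h5 : fderiv ℂ (fun ζ => (H₀ *ᵥ star c) ⬝ᵥ (S₀ ζ *ᵥ (H₀ *ᵥ star c))) ζ η
      = (H₀ *ᵥ star c) ⬝ᵥ (fderiv ℂ S₀ ζ η *ᵥ (H₀ *ᵥ star c)) := by
    rw [fderiv_dotProduct (differentiableAt_const _) h1, h4]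
    simp
  rw [← h5, ← h4]
  exact Prod.ext (zero_sub _) (Prod.ext (zero_sub _) rfl)

theorem differentiableAt_heisenbergField {p : ModelSpace s r} (ha : AnalyticAt ℂ S₀ p.2.2)
    (c : Fin s → ℂ) (t : ℝ) : DifferentiableAt ℂ (heisenbergField H₀ S₀ c t) p := by
  have h1 : DifferentiableAt ℂ (fun p : ModelSpace s r => p.2.1) p := differentiableAt_snd.fst
  have h2 : DifferentiableAt ℂ (fun p : ModelSpace s r => S₀ p.2.2) p :=
    ha.differentiableAt.comp p (differentiableAt_snd.snd)
  have h3 : DifferentiableAt ℂ (fun p : ModelSpace s r => p.2.1 ⬝ᵥ (H₀ *ᵥ star c)) p :=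
    h1.dotProduct (differentiableAt_const _)
  exact ((h3.const_mul 2).add_const _).prodMk
    (((differentiableAt_const c).sub (h2.mulVec (differentiableAt_const _))).prodMk
      (differentiableAt_const _))

include hH hU in
-- Pair z = conj k - S₀H₀k with H₀ conj c. The symmetry of `S₀` and the Hermitian symmetry of `H₀`
-- allow the roles of k and conj c to be exchanged under the real part.
theorem heisenbergField_tangent {p : ModelSpace s r} (hx : IsRegularPoint H₀ S₀ p.2.2)
    (c : Fin s → ℂ) (t : ℝ) :
    fderiv ℝ (graphFunction (modelFunction (explicitH H₀ S₀) (explicitS H₀ S₀))) p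
      (heisenbergField H₀ S₀ c t p) = 0 := by
  rw [fderiv_graphFunction (differentiableAt_modelFunction hH hU hx),
    fderiv_modelFunction_regular hH hU hx]
  have h1 := star_leafParam_sub hx.unit
  rw [← Matrix.mulVec_mulVec] at h1
  have h2 := re_dotProduct_hermitian hH (leafParam H₀ S₀ p.2) (star c)
  rw [star_star] at h2
  have h3 := congrArg (fun z => (z ⬝ᵥ (H₀ *ᵥ star c)).re) h1
  simp only [sub_dotProduct, sub_re, h2] at h3
  have h4 : (S₀ p.2.2 *ᵥ (H₀ *ᵥ leafParam H₀ S₀ p.2)) ⬝ᵥ (H₀ *ᵥ star c)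
      = (S₀ p.2.2 *ᵥ (H₀ *ᵥ star c)) ⬝ᵥ (H₀ *ᵥ leafParam H₀ S₀ p.2) := by
    rw [dotProduct_comm, dotProduct_mulVec_transpose, hx.symmetric.self_of_nhds.eq, dotProduct_comm]
  rw [h4] at h3
  simp only [heisenbergField, explicitDel, map_zero, Matrix.zero_mulVec, dotProduct_zero, add_zero,
    sub_dotProduct, add_re, mul_re, sub_re, re_ofNat, im_ofNat, I_re, I_im, ofReal_re, ofReal_im,
    zero_mul, mul_zero, sub_zero]
  linarith

include hH hU in
-- A kernel vector removes the ζ-component of a tangent vector. The z-component of the rest is c -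
-- S₀H₀ conj c for a unique c, found by `leafParam` itself, and `t` is left free for the imaginary
-- part of `w`.
theorem span_heisenbergField_sup_leviKernel {p : ModelSpace s r}
    (hx : IsRegularPoint H₀ S₀ p.2.2)
    (hp : graphFunction (modelFunction (explicitH H₀ S₀) (explicitS H₀ S₀)) p = 0) :
    Submodule.span ℝ {v | ∃ ξ ∈ Set.range (fun a : (Fin s → ℂ) × ℝ =>
        heisenbergField (r := r) H₀ S₀ a.1 a.2), v = ξ p}
      ⊔ (leviKernel (graphFunction
          (modelFunction (explicitH H₀ S₀) (explicitS H₀ S₀))) p).restrictScalars ℝ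
      = LinearMap.ker (fderiv ℝ (graphFunction
          (modelFunction (explicitH H₀ S₀) (explicitS H₀ S₀))) p).toLinearMap := by
  have hK := mem_leviKernel_explicit hH hU hx hp
  have hKle : ∀ v ∈ leviKernel (graphFunction
      (modelFunction (explicitH H₀ S₀) (explicitS H₀ S₀))) p,
      fderiv ℝ (graphFunction (modelFunction (explicitH H₀ S₀) (explicitS H₀ S₀))) p v = 0 := by
    rintro v ⟨_, _, _, hv, _⟩
    exact hv.1
  apply le_antisymm
  · refine sup_le (Submodule.span_le.mpr ?_) fun v hv => hKle v hv
    rintro _ ⟨_, ⟨a, rfl⟩, rfl⟩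
    exact heisenbergField_tangent hH hU hx a.1 a.2
  · intro v hv
    have hv' : fderiv ℝ (graphFunction (modelFunction (explicitH H₀ S₀) (explicitS H₀ S₀))) p v
      = 0 := hv
    set n : (Fin s → ℂ) × (Fin r → ℂ) :=
      (-(fderiv ℂ S₀ p.2.2 v.2.2 *ᵥ (H₀ *ᵥ leafParam H₀ S₀ p.2)), v.2.2) with hn
    have hκ := (hK (explicitDel H₀ S₀ p.2 n, n)).mpr ⟨rfl, rfl⟩
    have hκ' := hKle _ hκ
    set κ : ModelSpace s r := (explicitDel H₀ S₀ p.2 n, n)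
    have hc := star_leafParam_sub (H₀ := H₀) (S₀ := S₀) (x := ((v - κ).2.1, p.2.2)) hx.unit
    set k' := leafParam H₀ S₀ ((v - κ).2.1, p.2.2)
    set t : ℝ := ((v - κ).1 - 2 * (p.2.1 ⬝ᵥ (H₀ *ᵥ k'))).im with ht
    have hξ := heisenbergField_tangent hH hU hx (star k') t
    have h2 : (heisenbergField H₀ S₀ (star k') t p).2 = (v - κ).2 := by
      rw [heisenbergField, star_star, Matrix.mulVec_mulVec]
      refine Prod.ext hc ?_
      change (0 : Fin r → ℂ) = v.2.2 - v.2.2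
      rw [sub_self]
    have hvκ : fderiv ℝ (graphFunction
        (modelFunction (explicitH H₀ S₀) (explicitS H₀ S₀))) p (v - κ) = 0 := by
      rw [map_sub, hv', hκ', sub_zero]
    have hFd := differentiableAt_modelFunction hH hU hx
    rw [fderiv_graphFunction hFd] at hξ hvκ
    -- The real parts agree because both vectors are tangent and have the same (z, ζ)-component; `t`
    -- was chosen to match the imaginary parts.
    have h1 : (heisenbergField H₀ S₀ (star k') t p).1 = (v - κ).1 := by
      apply Complex.ext
      · rw [h2] at hξ
        linarith
      · simp [heisenbergField, star_star, ht]
    have h3 : v = heisenbergField H₀ S₀ (star k') t p + κ := by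
      rw [Prod.ext h1 h2, sub_add_cancel]
    rw [h3]
    exact Submodule.add_mem_sup
      (Submodule.subset_span ⟨_, ⟨(star k', t), rfl⟩, rfl⟩) hκ

theorem leafPoint_zero_right (h0 : S₀ 0 = 0) (c : Fin s → ℂ) (t : ℝ) :
    leafPoint H₀ S₀ c t 0 = (I * t + c ⬝ᵥ (H₀ *ᵥ star c), c, 0) := by
  simp [leafPoint, h0]

/-- A leaf curve in the explicit model, parametrized by a segment in the `ζ`-space. -/
theorem onSameLeviLeaf_leafPoint (hH : H₀.IsHermitian) (hU : IsUnit H₀.det)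
    {W : Set (ModelSpace s r)} {c : Fin s → ℂ} {t : ℝ} {ζ : Fin r → ℂ}
    (hreg : ∀ τ ∈ Set.Icc (0 : ℝ) 1, IsRegularPoint H₀ S₀ (τ • ζ))
    (hW : ∀ τ ∈ Set.Icc (0 : ℝ) 1, leafPoint H₀ S₀ c t (τ • ζ) ∈ W) :
    OnSameLeviLeaf (graphFunction (modelFunction (explicitH H₀ S₀) (explicitS H₀ S₀))) W
      (leafPoint H₀ S₀ c t 0) (leafPoint H₀ S₀ c t ζ) := by
  have hlin : ∀ τ : ℝ, HasDerivAt (fun τ : ℝ => τ • ζ) ζ τ := fun τ => by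
    simpa using (hasDerivAt_id τ).smul_const ζ
  have hder : ∀ τ ∈ Set.Icc (0 : ℝ) 1, HasDerivAt (fun τ : ℝ => leafPoint H₀ S₀ c t (τ • ζ))
      (fderiv ℂ (leafPoint H₀ S₀ c t) (τ • ζ) ζ) τ := by
    intro τ hτ
    have h1 := (analyticAt_leafPoint (H₀ := H₀) (hreg τ hτ).analytic c t).differentiableAt
    exact (h1.hasFDerivAt.restrictScalars ℝ).comp_hasDerivAt τ (hlin τ)
  refine ⟨fun τ => leafPoint H₀ S₀ c t (τ • ζ), by simp, by simp, ?_, fun τ hτ => ?_⟩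
  · intro τ hτ
    have h1 : ContDiffAt ℝ 1 (leafPoint H₀ S₀ c t) (τ • ζ) :=
      ((analyticAt_leafPoint (H₀ := H₀) (hreg τ hτ).analytic c t).restrictScalars
        (𝕜 := ℝ)).contDiffAt
    have h2 : ContDiffAt ℝ 1 (fun τ : ℝ => τ • ζ) τ := contDiffAt_id.smul contDiffAt_const
    exact (h1.comp τ h2).contDiffWithinAt
  · have hM := graphFunction_leafPoint hH hU (hreg τ hτ).unit c t
    refine ⟨hW τ hτ, hM, ?_⟩
    rw [(hder τ hτ).hasDerivWithinAt.derivWithin (uniqueDiffOn_Icc_zero_one τ hτ),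
      mem_leviKernel_explicit hH hU (p := leafPoint H₀ S₀ c t (τ • ζ)) (hreg τ hτ) hM,
      fderiv_leafPoint (hreg τ hτ).analytic, explicitDel,
      leafParam_leafPoint (hreg τ hτ).unit]
    refine ⟨?_, rfl⟩
    simp only [leafPoint, neg_dotProduct]
    rw [dotProduct_comm (fderiv ℂ S₀ (τ • ζ) ζ *ᵥ (H₀ *ᵥ star c))]
    ring

/-- Over ζ = 0 the matrix `S₀` vanishes, and the integral curve through `0` is (iτt + τ²cᵀH₀ conj c,
τc, 0), again a curve of leaf points. -/
theorem joinedByFlow_leafPoint (hH : H₀.IsHermitian) (hU : IsUnit H₀.det) (h0 : S₀ 0 = 0)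
    {W : Set (ModelSpace s r)} {c : Fin s → ℂ} {t : ℝ}
    (hW : ∀ τ ∈ Set.Icc (0 : ℝ) 1, leafPoint H₀ S₀ (τ • c) (τ * t) (0 : Fin r → ℂ) ∈ W) :
    JoinedByFlow (graphFunction (modelFunction (explicitH H₀ S₀) (explicitS H₀ S₀)))
      (Set.range (fun a : (Fin s → ℂ) × ℝ => heisenbergField (r := r) H₀ S₀ a.1 a.2)) W
      0 (leafPoint H₀ S₀ c t 0) := by
  have hu : IsUnit (pivot H₀ S₀ 0).det := by simp [pivot, h0]
  refine ⟨_, ⟨(c, t), rfl⟩, fun τ => leafPoint H₀ S₀ (τ • c) (τ * t) 0, ?_, by simp,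
    fun τ hτ => ⟨hW τ hτ, graphFunction_leafPoint hH hU hu _ _, HasDerivAt.hasDerivWithinAt ?_⟩⟩
  · simp [leafPoint_zero_right h0]
  · have e : (fun τ : ℝ => leafPoint H₀ S₀ (τ • c) (τ * t) (0 : Fin r → ℂ))
        = fun τ : ℝ => (I * t * (τ : ℂ) + (τ : ℂ) ^ 2 * (c ⬝ᵥ (H₀ *ᵥ star c)), τ • c, 0) := by
      funext τ
      rw [leafPoint_zero_right h0]
      refine Prod.ext ?_ rfl
      have : star (τ • c) = τ • star c := by simp
      simp only [this, Matrix.mulVec_smul, dotProduct_smul, smul_dotProduct, real_smul, ofReal_mul]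
      ring
    have hof : HasDerivAt (fun τ : ℝ => (τ : ℂ)) 1 τ := ofRealCLM.hasDerivAt
    have hlin : HasDerivAt (fun τ : ℝ => τ • c) c τ := by
      simpa using (hasDerivAt_id τ).smul_const c
    have h1 := ((hof.const_mul (I * t)).add
      ((hof.pow 2).mul_const (c ⬝ᵥ (H₀ *ᵥ star c)))).prodMk
        (hlin.prodMk (hasDerivAt_const τ (0 : Fin r → ℂ)))
    rw [e]
    refine HasDerivAt.congr_deriv (f := fun τ : ℝ => (I * t * (τ : ℂ)
      + (τ : ℂ) ^ 2 * (c ⬝ᵥ (H₀ *ᵥ star c)), τ • c, (0 : Fin r → ℂ))) h1 ?_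
    refine Prod.ext ?_ (Prod.ext ?_ rfl)
    · simp only [heisenbergField, smul_dotProduct, real_smul]
      push_cast
      ring
    · simp [heisenbergField, h0]

theorem ContinuousAt.mulVec {X : Type*} [TopologicalSpace X] {A : X → Matrix (Fin s) (Fin s) ℂ}
    {f : X → Fin s → ℂ} {x : X} (hA : ContinuousAt A x) (hf : ContinuousAt f x) :
    ContinuousAt (fun y => A y *ᵥ f y) x :=
  ContinuousAt.comp (g := fun a : Matrix (Fin s) (Fin s) ℂ × (Fin s → ℂ) => a.1 *ᵥ a.2)
    (isBoundedBilinearMap_mulVec (𝕜 := ℂ) (s := s)).continuous.continuousAt (hA.prodMk hf)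

theorem ContinuousAt.dotProduct {X : Type*} [TopologicalSpace X] {f g : X → Fin s → ℂ} {x : X}
    (hg : ContinuousAt g x) (hf : ContinuousAt f x) : ContinuousAt (fun y => g y ⬝ᵥ f y) x :=
  ContinuousAt.comp (g := fun a : (Fin s → ℂ) × (Fin s → ℂ) => a.1 ⬝ᵥ a.2)
    (isBoundedBilinearMap_dotProduct (𝕜 := ℂ) (s := s)).continuous.continuousAt (hg.prodMk hf)

theorem continuousAt_leafPoint (hS : ContinuousAt S₀ 0) :
    ContinuousAt (fun a : (Fin s → ℂ) × ℝ × (Fin r → ℂ) => leafPoint H₀ S₀ a.1 a.2.1 a.2.2)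
      0 := by
  have h22 : ContinuousAt (fun a : (Fin s → ℂ) × ℝ × (Fin r → ℂ) => a.2.2) 0 :=
    (continuous_snd.comp continuous_snd).continuousAt
  have hc : ContinuousAt (fun a : (Fin s → ℂ) × ℝ × (Fin r → ℂ) => a.1) 0 := continuousAt_fst
  have ht : ContinuousAt (fun a : (Fin s → ℂ) × ℝ × (Fin r → ℂ) => (a.2.1 : ℂ)) 0 :=
    (continuous_ofReal.comp (continuous_fst.comp continuous_snd)).continuousAt
  have hS' : ContinuousAt (fun a : (Fin s → ℂ) × ℝ × (Fin r → ℂ) => S₀ a.2.2) 0 :=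
    ContinuousAt.comp (g := S₀) hS h22
  have hh : ContinuousAt (fun a : (Fin s → ℂ) × ℝ × (Fin r → ℂ) => H₀ *ᵥ star a.1) 0 :=
    continuousAt_const.mulVec (continuous_star.continuousAt.comp hc)
  have hSh := hS'.mulVec hh
  exact (((continuousAt_const.mul ht).add (hc.dotProduct hh)).sub (hh.dotProduct hSh)).prodMk
    ((hc.sub hSh).prodMk h22)

/-- A nearby point of the hypersurface has small leaf coordinates (c, t, ζ). The flow of the field
with parameters (c, t) leads from `0` to its leaf over ζ = 0, and a segment in ζ-space leads along
the leaf. Both curves only shrink coordinates by factors in [0, 1], so they stay in the prescribed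
neighbourhood. -/
theorem IsModelData.exists_transitive_symmetries (h : IsModelData H₀ S₀) :
    ∃ (U : Set (ModelSpace s r)) (𝔤 : Set (ModelSpace s r → ModelSpace s r)),
      IsOpen U ∧ 0 ∈ U ∧
      (∀ ξ ∈ 𝔤, IsHolInfinitesimalSymmetry
        (modelDefiningFunction (explicitH H₀ S₀) (explicitS H₀ S₀)) U ξ) ∧
      ActsLocallyTransitivelyOnLeviLeaves
        (modelDefiningFunction (explicitH H₀ S₀) (explicitS H₀ S₀)) 𝔤 U := by
  have hH := h.hermitian
  have hU := h.nondegenerate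
  rw [modelDefiningFunction_eq]
  obtain ⟨ε, hε, hreg⟩ := Metric.eventually_nhds_iff_ball.mp h.eventually_isRegularPoint
  have h22 : Continuous (fun q : ModelSpace s r => q.2.2) := continuous_snd.comp continuous_snd
  refine ⟨{p | p.2.2 ∈ Metric.ball 0 ε},
    Set.range (fun a : (Fin s → ℂ) × ℝ => heisenbergField (r := r) H₀ S₀ a.1 a.2),
    Metric.isOpen_ball.preimage h22, Metric.mem_ball_self hε, ?_, ?_, ?_⟩
  · rintro _ ⟨a, rfl⟩
    refine ⟨fun p hp => ?_, fun p hp _ => heisenbergField_tangent hH hU (hreg _ hp) _ _⟩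
    exact (differentiableAt_heisenbergField (hreg _ hp).analytic _ _).differentiableWithinAt
  · filter_upwards [h22.continuousAt.eventually (Metric.ball_mem_nhds 0 hε)] with p hp hMp
    exact span_heisenbergField_sup_leviKernel hH hU (hreg _ hp) hMp
  · intro W hW
    have hΨ := continuousAt_leafPoint (H₀ := H₀) h.analyticAt.continuousAt
    rw [ContinuousAt] at hΨ
    have hΨ0 : leafPoint H₀ S₀ (0 : (Fin s → ℂ) × ℝ × (Fin r → ℂ)).1
        (0 : (Fin s → ℂ) × ℝ × (Fin r → ℂ)).2.1 (0 : (Fin s → ℂ) × ℝ × (Fin r → ℂ)).2.2 = 0 := by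
      simp [leafPoint]
    rw [hΨ0] at hΨ
    obtain ⟨δ, hδ, hδW⟩ := Metric.eventually_nhds_iff_ball.mp (hΨ.eventually hW)
    have hk : ContinuousAt (fun p : ModelSpace s r => leafParam H₀ S₀ p.2) 0 :=
      ContinuousAt.comp (g := leafParam H₀ S₀)
        (analyticAt_leafParam h.eventually_isRegularPoint.self_of_nhds).continuousAt
        continuousAt_snd
    have hk0 : leafParam H₀ S₀ (0 : ModelSpace s r).2 = 0 := by simp [leafParam]
    have hh : ContinuousAt (fun p : ModelSpace s r => H₀ *ᵥ leafParam H₀ S₀ p.2) 0 :=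
      continuousAt_const.mulVec hk
    have hS' : ContinuousAt (fun p : ModelSpace s r => S₀ p.2.2) 0 :=
      ContinuousAt.comp (g := S₀) h.analyticAt.continuousAt h22.continuousAt
    have hSh : ContinuousAt (fun p : ModelSpace s r =>
        S₀ p.2.2 *ᵥ (H₀ *ᵥ leafParam H₀ S₀ p.2)) 0 :=
      hS'.mulVec hh
    have hq : ContinuousAt (fun p : ModelSpace s r => (H₀ *ᵥ leafParam H₀ S₀ p.2) ⬝ᵥ
        (S₀ p.2.2 *ᵥ (H₀ *ᵥ leafParam H₀ S₀ p.2))) 0 :=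
      hh.dotProduct hSh
    have ht : ContinuousAt (fun p : ModelSpace s r => (p.1 + (H₀ *ᵥ leafParam H₀ S₀ p.2) ⬝ᵥ
        (S₀ p.2.2 *ᵥ (H₀ *ᵥ leafParam H₀ S₀ p.2))).im) 0 :=
      continuous_im.continuousAt.comp (continuousAt_fst.add hq)
    have hpar := (continuous_star.continuousAt.comp hk).prodMk (ht.prodMk h22.continuousAt)
    have hpar' : ∀ᶠ p : ModelSpace s r in 𝓝 0, (star (leafParam H₀ S₀ p.2),
        (p.1 + (H₀ *ᵥ leafParam H₀ S₀ p.2) ⬝ᵥ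
          (S₀ p.2.2 *ᵥ (H₀ *ᵥ leafParam H₀ S₀ p.2))).im, p.2.2)
        ∈ Metric.ball (0 : (Fin s → ℂ) × ℝ × (Fin r → ℂ)) δ := by
      refine hpar.eventually (Metric.isOpen_ball.mem_nhds ?_)
      simp only [Function.comp, hk0]
      simpa using hδ
    filter_upwards [hpar', h22.continuousAt.eventually (Metric.ball_mem_nhds 0 hε)]
      with p hp hpε hMp
    have hpe := eq_leafPoint hH hU (hreg _ hpε).unit hMp
    set c := star (leafParam H₀ S₀ p.2)
    set t := (p.1 + (H₀ *ᵥ leafParam H₀ S₀ p.2) ⬝ᵥ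
          (S₀ p.2.2 *ᵥ (H₀ *ᵥ leafParam H₀ S₀ p.2))).im
    have hsm : ∀ τ ∈ Set.Icc (0 : ℝ) 1, ∀ {E : Type} [NormedAddCommGroup E] [NormedSpace ℝ E]
        (v : E) {d : ℝ}, ‖v‖ < d → ‖τ • v‖ < d := by
      intro τ hτ E _ _ v d hd
      rw [norm_smul, Real.norm_of_nonneg hτ.1]
      exact (mul_le_of_le_one_left (norm_nonneg v) hτ.2).trans_lt hd
    rw [mem_ball_zero_iff] at hp
    have hpε : ‖p.2.2‖ < ε := mem_ball_zero_iff.mp hpε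
    have hp1 : ‖c‖ < δ := (norm_fst_le _).trans_lt hp
    have hp2 : ‖t‖ < δ := ((norm_fst_le _).trans (norm_snd_le (c, t, p.2.2))).trans_lt hp
    have hp3 : ‖p.2.2‖ < δ := ((norm_snd_le _).trans (norm_snd_le (c, t, p.2.2))).trans_lt hp
    have hmem : ∀ (c' : Fin s → ℂ) (t' : ℝ) (ζ' : Fin r → ℂ), ‖c'‖ < δ → ‖t'‖ < δ → ‖ζ'‖ < δ →
        leafPoint H₀ S₀ c' t' ζ' ∈ W := by
      intro c' t' ζ' h1 h2 h3
      refine hδW (c', t', ζ') ?_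
      rw [mem_ball_zero_iff]
      exact max_lt h1 (max_lt h2 h3)
    have hflow := joinedByFlow_leafPoint (W := W ∩ {p | p.2.2 ∈ Metric.ball 0 ε}) hH hU h.vanishing
      (c := c) (t := t) fun τ hτ => ⟨hmem _ _ _ (hsm τ hτ c hp1) (hsm τ hτ t hp2)
        (by rw [norm_zero]; exact hδ), Metric.mem_ball_self hε⟩
    have hleaf := onSameLeviLeaf_leafPoint hH hU (c := c) (t := t) (ζ := p.2.2)
      (W := W ∩ {p | p.2.2 ∈ Metric.ball 0 ε})
      (fun τ hτ => hreg _ (mem_ball_zero_iff.mpr (hsm τ hτ _ hpε)))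
      (fun τ hτ => ⟨hmem _ _ _ hp1 hp2 (hsm τ hτ _ hp3),
        mem_ball_zero_iff.mpr (hsm τ hτ _ hpε)⟩)
    rw [← hpe] at hleaf
    exact Relation.ReflTransGen.tail (Relation.ReflTransGen.single (Or.inr hflow)) (Or.inl hleaf)

end ExplicitSymmetries

/-! ### Holomorphic extension from totally real subspaces -/

section Complexification

open Complex

/-- A holomorphic function near `0` in `V × V` that vanishes on the totally real subspace of the
pairs `(x, star x)` vanishes near `0`. -/
theorem eventually_eq_zero_of_diagonal {V : Type*} [NormedAddCommGroup V] [NormedSpace ℂ V]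
    [StarAddMonoid V] [StarModule ℂ V] [NormedStarGroup V] {W : Type*} [NormedAddCommGroup W]
    [NormedSpace ℂ W] [CompleteSpace W] {g : V × V → W}
    (hg : ∀ᶠ p in 𝓝 (0 : V × V), DifferentiableAt ℂ g p)
    (h : ∀ᶠ x in 𝓝 (0 : V), g (x, star x) = 0) : ∀ᶠ p in 𝓝 (0 : V × V), g p = 0 := by
  obtain ⟨R, hR, hgR⟩ := Metric.eventually_nhds_iff_ball.mp hg
  obtain ⟨R', hR', hd⟩ := Metric.eventually_nhds_iff_ball.mp h
  -- With this radius `x` and `y` below have norm less than `min R R' / 4`, so the disc |t| < 2,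
  -- which contains `I`, is mapped into the ball of radius `min R R'`.
  refine Metric.eventually_nhds_iff_ball.mpr ⟨min R R' / 4, by positivity, ?_⟩
  rintro ⟨a, b⟩ hab
  rw [mem_ball_zero_iff, Prod.norm_mk, max_lt_iff] at hab
  obtain ⟨ha, hb⟩ := hab
  -- The disc t ↦ (x + ty, star x + t star y) lies in the totally real subspace for real t and
  -- passes through (a, b) at t = I. The identity theorem in one variable applies along it.
  set x : V := (1 / 2 : ℂ) • (a + star b) with hx
  set y : V := (-(I / 2) : ℂ) • (a - star b) with hy
  have hxn : ‖x‖ < min R R' / 4 := by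
    rw [hx, norm_smul]
    have := norm_add_le a (star b)
    rw [norm_star] at this
    norm_num
    linarith
  have hyn : ‖y‖ < min R R' / 4 := by
    rw [hy, norm_smul]
    have := norm_sub_le a (star b)
    rw [norm_star] at this
    norm_num
    linarith
  have hsx : star x = (1 / 2 : ℂ) • (star a + b) := by
    rw [hx, star_smul, star_add, star_star]
    simp
  have hsy : star y = (I / 2 : ℂ) • (star a - b) := by
    have h : star (-(I / 2) : ℂ) = I / 2 := by
      apply Complex.ext <;> norm_num
    rw [hy, star_smul, star_sub, star_star, h]
  have e1 : x + I • y = a := by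
    rw [hx, hy, smul_smul]
    have : I * -(I / 2) = 1 / 2 := by linear_combination (-1 / 2) * I_mul_I
    rw [this]
    module
  have e2 : star x + I • star y = b := by
    rw [hsx, hsy, smul_smul]
    have : I * (I / 2) = -(1 / 2) := by linear_combination (1 / 2) * I_mul_I
    rw [this]
    module
  have hbound : ∀ t : ℂ, ‖t‖ < 2 → ‖x + t • y‖ < min R R' ∧ ‖star x + t • star y‖ < min R R' := by
    intro t ht
    have h1 : ‖t‖ * ‖y‖ ≤ 2 * ‖y‖ := mul_le_mul_of_nonneg_right ht.le (norm_nonneg _)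
    have h2 := norm_add_le x (t • y)
    have h3 := norm_add_le (star x) (t • star y)
    rw [norm_smul t y] at h2
    rw [norm_smul t, norm_star, norm_star] at h3
    constructor <;> linarith [norm_nonneg y]
  let φ : ℂ → W := fun t => g (x + t • y, star x + t • star y)
  have hφ : AnalyticOnNhd ℂ φ (Metric.ball 0 2) := by
    refine DifferentiableOn.analyticOnNhd (fun t ht => ?_) Metric.isOpen_ball
    obtain ⟨b1, b2⟩ := hbound t (mem_ball_zero_iff.mp ht)
    have hd : DifferentiableAt ℂ g (x + t • y, star x + t • star y) :=
      hgR _ (mem_ball_zero_iff.mpr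
        (max_lt (b1.trans_le (min_le_left _ _)) (b2.trans_le (min_le_left _ _))))
    have hl : DifferentiableAt ℂ (fun t : ℂ => (x + t • y, star x + t • star y)) t := by
      fun_prop
    exact (DifferentiableAt.comp t hd hl).differentiableWithinAt
  have hfreq : ∃ᶠ t in 𝓝[≠] (0 : ℂ), φ t = 0 := by
    have ht : Filter.Tendsto (fun t : ℝ => (t : ℂ)) (𝓝[≠] 0) (𝓝[≠] 0) := by
      refine tendsto_nhdsWithin_of_tendsto_nhds_of_eventually_within _ ?_ ?_
      · exact (continuous_ofReal.tendsto' 0 0 ofReal_zero).mono_left nhdsWithin_le_nhds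
      · filter_upwards [self_mem_nhdsWithin] with t ht
        simpa using ht
    refine ht.frequently (Filter.Eventually.frequently ?_)
    have h2 : ∀ᶠ t : ℝ in 𝓝[≠] 0, t ∈ Metric.ball (0 : ℝ) 2 :=
      nhdsWithin_le_nhds (Metric.ball_mem_nhds 0 two_pos)
    filter_upwards [h2] with t ht
    rw [mem_ball_zero_iff] at ht
    have h3 := (hbound t (by simpa using ht)).1
    have h4 := hd _ (mem_ball_zero_iff.mpr (h3.trans_le (min_le_right _ _)))
    have h5 : star (t : ℂ) = t := conj_ofReal t
    rw [star_add x, star_smul (t : ℂ), h5] at h4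
    exact h4
  have hI := hφ.eqOn_zero_of_preconnected_of_frequently_eq_zero
    (convex_ball (0 : ℂ) 2).isPreconnected (Metric.mem_ball_self two_pos) hfreq
    (show I ∈ Metric.ball (0 : ℂ) 2 by simp)
  simpa [φ, e1, e2] using hI

variable {V W ι : Type*} [NormedAddCommGroup V] [NormedSpace ℝ V] [NormedAddCommGroup W]
  [NormedSpace ℂ W] [Fintype ι]

/-- The complexification of a power series in the coordinates given by real basis vectors `b` and
complex coordinate functionals `ℓ`. -/
noncomputable def complexifiedSeries (b : ι → V) (l : ι → W →L[ℂ] ℂ)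
    (p : FormalMultilinearSeries ℝ V ℂ) : FormalMultilinearSeries ℂ W ℂ := fun n =>
  ∑ k : Fin n → ι, p n (fun i => b (k i)) •
    (ContinuousMultilinearMap.mkPiAlgebra ℂ (Fin n) ℂ).compContinuousLinearMap fun i => l (k i)

theorem complexifiedSeries_apply (b : ι → V) (l : ι → W →L[ℂ] ℂ)
    (p : FormalMultilinearSeries ℝ V ℂ) (n : ℕ) (w : W) (x : V) (t : ι → ℝ)
    (ht : ∀ k, l k w = t k) (hx : x = ∑ k, t k • b k) :
    complexifiedSeries b l p n (fun _ => w) = p n fun _ => x := by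
  classical
  rw [hx, ContinuousMultilinearMap.map_sum]
  simp only [complexifiedSeries, _root_.sum_apply]
  refine Finset.sum_congr rfl fun k _ => ?_
  rw [ContinuousMultilinearMap.map_smul_univ]
  simp [ht, mul_comm]

theorem norm_complexifiedSeries_le (b : ι → V) (l : ι → W →L[ℂ] ℂ)
    (p : FormalMultilinearSeries ℝ V ℂ) (hb : ∀ k, ‖b k‖ ≤ 1) (hl : ∀ k, ‖l k‖ ≤ 1) (n : ℕ) :
    ‖complexifiedSeries b l p n‖ ≤ (Fintype.card ι : ℝ) ^ n * ‖p n‖ := by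
  have h : ∀ k : Fin n → ι, ‖p n (fun i => b (k i)) •
      (ContinuousMultilinearMap.mkPiAlgebra ℂ (Fin n) ℂ).compContinuousLinearMap
        fun i => l (k i)‖ ≤ ‖p n‖ := by
    intro k
    rw [norm_smul]
    have h1 : ‖p n (fun i => b (k i))‖ ≤ ‖p n‖ := by
      refine ((p n).le_opNorm _).trans (mul_le_of_le_one_right (norm_nonneg _) ?_)
      exact Finset.prod_le_one (fun _ _ => norm_nonneg _) fun i _ => hb _
    have h2 : ‖(ContinuousMultilinearMap.mkPiAlgebra ℂ (Fin n) ℂ).compContinuousLinearMap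
        fun i => l (k i)‖ ≤ 1 := by
      refine (ContinuousMultilinearMap.norm_compContinuousLinearMap_le _ _).trans ?_
      refine mul_le_one₀ ContinuousMultilinearMap.norm_mkPiAlgebra.le
        (Finset.prod_nonneg fun _ _ => norm_nonneg _) ?_
      exact Finset.prod_le_one (fun _ _ => norm_nonneg _) fun i _ => hl _
    exact (mul_le_of_le_one_right (norm_nonneg _) h2).trans h1
  refine (norm_sum_le_of_le _ fun k _ => h k).trans ?_
  simp

/-- The coefficients of the complexified series grow by at most the factor `Fintype.card ι ^ n`, so
it still has positive radius; the `+ 1` in the denominator covers the empty index type. At `j x` the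
coordinates are real and the two series agree term by term. -/
theorem AnalyticAt.exists_complexification_aux {f : V → ℂ} (hf : AnalyticAt ℝ f 0) (b : ι → V)
    (l : ι → W →L[ℂ] ℂ) (hb : ∀ k, ‖b k‖ ≤ 1) (hl : ∀ k, ‖l k‖ ≤ 1) (j : V → W)
    (hj : ∀ x, ∃ t : ι → ℝ, (∀ k, l k (j x) = t k) ∧ x = ∑ k, t k • b k) :
    ∃ g : W → ℂ, AnalyticAt ℂ g 0 ∧ ∀ᶠ x in 𝓝 0, g (j x) = f x := by
  obtain ⟨p, hp⟩ := hf
  obtain ⟨ρ, hρ, hρp⟩ : ∃ ρ : NNReal, 0 < ρ ∧ (ρ : ENNReal) < p.radius := by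
    obtain ⟨R, hR⟩ := hp
    obtain ⟨ρ, h1, h2⟩ := ENNReal.lt_iff_exists_nnreal_btwn.mp (hR.r_pos.trans_le hR.r_le)
    exact ⟨ρ, by exact_mod_cast h1, h2⟩
  obtain ⟨C, -, hC⟩ := p.norm_mul_pow_le_of_lt_radius hρp
  have hrad : 0 < (complexifiedSeries b l p).radius := by
    refine lt_of_lt_of_le ?_ ((complexifiedSeries b l p).le_radius_of_bound C
      (r := ρ / (Fintype.card ι + 1)) fun n => ?_)
    · have : 0 < ρ / (Fintype.card ι + 1) := by positivity
      exact_mod_cast this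
    · refine le_trans ?_ (hC n)
      push_cast
      rw [div_pow]
      calc ‖complexifiedSeries b l p n‖ * ((ρ : ℝ) ^ n / ((Fintype.card ι : ℝ) + 1) ^ n)
          ≤ ((Fintype.card ι : ℝ) ^ n * ‖p n‖)
              * ((ρ : ℝ) ^ n / ((Fintype.card ι : ℝ) + 1) ^ n) := by
            gcongr
            exact norm_complexifiedSeries_le b l p hb hl n
        _ = ‖p n‖ * (ρ : ℝ) ^ n
              * ((Fintype.card ι : ℝ) ^ n / ((Fintype.card ι : ℝ) + 1) ^ n) := by ring
        _ ≤ ‖p n‖ * (ρ : ℝ) ^ n := by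
            refine mul_le_of_le_one_right (by positivity) ?_
            rw [div_le_one (by positivity)]
            gcongr
            linarith
  refine ⟨(complexifiedSeries b l p).sum,
    ((complexifiedSeries b l p).hasFPowerSeriesOnBall hrad).analyticAt, ?_⟩
  filter_upwards [hp.eventually_hasSum] with x hx
  obtain ⟨t, ht, hxt⟩ := hj x
  rw [zero_add] at hx
  rw [FormalMultilinearSeries.sum, ← hx.tsum_eq]
  exact tsum_congr fun n => complexifiedSeries_apply b l p n (j x) x t ht hxt

/-- A real analytic function of `ζ` is the restriction to `ω = star ζ` of a holomorphic function of
`(ζ, ω)`. -/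
theorem AnalyticAt.exists_complexification {r : ℕ} {f : (Fin r → ℂ) → ℂ} (hf : AnalyticAt ℝ f 0) :
    ∃ g : (Fin r → ℂ) × (Fin r → ℂ) → ℂ, AnalyticAt ℂ g 0 ∧
      ∀ᶠ x in 𝓝 0, g (x, star x) = f x := by
  let b : Fin r × Bool → Fin r → ℂ := fun k => Pi.single k.1 (if k.2 then I else 1)
  let P : Fin r → ((Fin r → ℂ) × (Fin r → ℂ)) →L[ℂ] ℂ := fun i =>
    (ContinuousLinearMap.proj i).comp (ContinuousLinearMap.fst ℂ _ _)
  let Q : Fin r → ((Fin r → ℂ) × (Fin r → ℂ)) →L[ℂ] ℂ := fun i =>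
    (ContinuousLinearMap.proj i).comp (ContinuousLinearMap.snd ℂ _ _)
  -- The coordinates Re ζ and Im ζ extend holomorphically as (ζ + ω)/2 and (ζ - ω)/(2i).
  let l : Fin r × Bool → ((Fin r → ℂ) × (Fin r → ℂ)) →L[ℂ] ℂ := fun k =>
    if k.2 then (-(I / 2)) • (P k.1 - Q k.1) else (1 / 2 : ℂ) • (P k.1 + Q k.1)
  have hP : ∀ i v, ‖P i v‖ ≤ ‖v‖ := fun i v => (norm_le_pi_norm v.1 i).trans (norm_fst_le v)
  have hQ : ∀ i v, ‖Q i v‖ ≤ ‖v‖ := fun i v => (norm_le_pi_norm v.2 i).trans (norm_snd_le v)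
  refine hf.exists_complexification_aux b l ?_ ?_ (fun x => (x, star x)) ?_
  · rintro ⟨i, β⟩
    refine (pi_norm_le_iff_of_nonneg zero_le_one).mpr fun k => ?_
    by_cases hk : k = i
    · subst hk
      cases β <;> simp [b]
    · simp [b, hk]
  · rintro ⟨i, β⟩
    refine ContinuousLinearMap.opNorm_le_bound _ zero_le_one fun v => ?_
    have h1 := hP i v
    have h2 := hQ i v
    cases β
    · have := norm_add_le (P i v) (Q i v)
      simp only [l, Bool.false_eq_true, if_false, _root_.smul_apply, _root_.add_apply, norm_smul]
      norm_num
      linarith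
    · have := norm_sub_le (P i v) (Q i v)
      simp only [l, if_true, _root_.smul_apply, _root_.sub_apply, norm_smul]
      norm_num
      linarith
  · intro x
    refine ⟨fun k => if k.2 then (x k.1).im else (x k.1).re, ?_, ?_⟩
    · rintro ⟨i, β⟩
      cases β
      · simp only [l, P, Q, Bool.false_eq_true, if_false]
        apply Complex.ext <;> simp
        ring
      · simp only [l, P, Q, if_true]
        apply Complex.ext <;> simp
        ring
    · funext i
      rw [Fintype.sum_prod_type]
      simp [b, Finset.sum_apply, Pi.single_apply, Finset.sum_add_distrib]
      rw [add_comm, re_add_im]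

end Complexification

/-! ### Integration of the flat system -/

section FlatSystem

variable {V 𝔸 : Type*} [NormedAddCommGroup V] [NormedSpace ℂ V] [NormedRing 𝔸] [NormedAlgebra ℂ 𝔸]

/-- The complexified equations for the coefficients of a model whose Levi form has minimal rank, for
functions with values in a noncommutative normed algebra; `k` plays the role of the transpose of
`h`, and `hi`, `ki` are the inverses of `h`, `k`. -/
structure IsFlatSystem (h k σ τ hi ki : V × V → 𝔸) (R : ℝ) : Prop where
  diff_h : ∀ p ∈ Metric.ball 0 R, DifferentiableAt ℂ h p
  diff_k : ∀ p ∈ Metric.ball 0 R, DifferentiableAt ℂ k p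
  diff_σ : ∀ p ∈ Metric.ball 0 R, DifferentiableAt ℂ σ p
  diff_τ : ∀ p ∈ Metric.ball 0 R, DifferentiableAt ℂ τ p
  diff_hi : ∀ p ∈ Metric.ball 0 R, DifferentiableAt ℂ hi p
  diff_ki : ∀ p ∈ Metric.ball 0 R, DifferentiableAt ℂ ki p
  diff_fderiv_h : ∀ p ∈ Metric.ball 0 R, DifferentiableAt ℂ (fderiv ℂ h) p
  diff_fderiv_k : ∀ p ∈ Metric.ball 0 R, DifferentiableAt ℂ (fderiv ℂ k) p
  diff_fderiv_σ : ∀ p ∈ Metric.ball 0 R, DifferentiableAt ℂ (fderiv ℂ σ) p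
  diff_fderiv_τ : ∀ p ∈ Metric.ball 0 R, DifferentiableAt ℂ (fderiv ℂ τ) p
  hi_mul : ∀ p ∈ Metric.ball 0 R, hi p * h p = 1
  mul_hi : ∀ p ∈ Metric.ball 0 R, h p * hi p = 1
  ki_mul : ∀ p ∈ Metric.ball 0 R, ki p * k p = 1
  mul_ki : ∀ p ∈ Metric.ball 0 R, k p * ki p = 1
  eq_h : ∀ p ∈ Metric.ball 0 R, ∀ η ∈ Metric.ball 0 R, ∀ w ∈ Metric.ball 0 R,
    fderiv ℂ (fun q => fderiv ℂ h q (η, 0)) p (0, w) =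
      fderiv ℂ h p (η, 0) * hi p * fderiv ℂ h p (0, w)
        + fderiv ℂ τ p (0, w) * ki p * fderiv ℂ σ p (η, 0)
  eq_k : ∀ p ∈ Metric.ball 0 R, ∀ η ∈ Metric.ball 0 R, ∀ w ∈ Metric.ball 0 R,
    fderiv ℂ (fun q => fderiv ℂ k q (η, 0)) p (0, w) =
      fderiv ℂ k p (0, w) * ki p * fderiv ℂ k p (η, 0)
        + fderiv ℂ σ p (η, 0) * hi p * fderiv ℂ τ p (0, w)
  eq_σ : ∀ p ∈ Metric.ball 0 R, ∀ η ∈ Metric.ball 0 R, ∀ w ∈ Metric.ball 0 R,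
    fderiv ℂ (fun q => fderiv ℂ σ q (η, 0)) p (0, w) =
      fderiv ℂ σ p (η, 0) * hi p * fderiv ℂ h p (0, w)
        + fderiv ℂ k p (0, w) * ki p * fderiv ℂ σ p (η, 0)
  eq_τ : ∀ p ∈ Metric.ball 0 R, ∀ η ∈ Metric.ball 0 R, ∀ w ∈ Metric.ball 0 R,
    fderiv ℂ (fun q => fderiv ℂ τ q (η, 0)) p (0, w) =
      fderiv ℂ h p (η, 0) * hi p * fderiv ℂ τ p (0, w)
        + fderiv ℂ τ p (0, w) * ki p * fderiv ℂ k p (η, 0)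

theorem eq_of_hasDerivAt_zero {W : Type*} [NormedAddCommGroup W] [NormedSpace ℝ W] {f : ℝ → W}
    (hf : ∀ t ∈ Set.Icc (0 : ℝ) 1, HasDerivAt f 0 t) : f 1 = f 0 :=
  constant_of_has_deriv_right_zero
    (fun t ht => (hf t ht).continuousAt.continuousWithinAt)
    (fun t ht => (hf t ⟨ht.1, ht.2.le⟩).hasDerivWithinAt) 1 (by simp)

theorem DifferentiableAt.hasDerivAt_fst_smul {W : Type*} [NormedAddCommGroup W] [NormedSpace ℂ W]
    {f : V × V → W} {v w : V} {t : ℝ} (hf : DifferentiableAt ℂ f (t • v, w)) :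
    HasDerivAt (fun t : ℝ => f (t • v, w)) (fderiv ℂ f (t • v, w) (v, 0)) t := by
  have h1 : HasDerivAt (fun t : ℝ => t • v) v t := by
    simpa using (hasDerivAt_id t).smul_const v
  exact (hf.hasFDerivAt.restrictScalars ℝ).comp_hasDerivAt t (h1.prodMk (hasDerivAt_const t w))

theorem DifferentiableAt.hasDerivAt_snd_smul {W : Type*} [NormedAddCommGroup W] [NormedSpace ℂ W]
    {f : V × V → W} {v w : V} {t : ℝ} (hf : DifferentiableAt ℂ f (v, t • w)) :
    HasDerivAt (fun t : ℝ => f (v, t • w)) (fderiv ℂ f (v, t • w) (0, w)) t := by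
  have h1 : HasDerivAt (fun t : ℝ => t • w) w t := by
    simpa using (hasDerivAt_id t).smul_const w
  exact (hf.hasFDerivAt.restrictScalars ℝ).comp_hasDerivAt t ((hasDerivAt_const t v).prodMk h1)

theorem prod_smul_mem_ball {ζ w : V} {R : ℝ} (hp : (ζ, w) ∈ Metric.ball (0 : V × V) R) {a b : ℝ}
    (ha : a ∈ Set.Icc (0 : ℝ) 1) (hb : b ∈ Set.Icc (0 : ℝ) 1) :
    (a • ζ, b • w) ∈ Metric.ball (0 : V × V) R := by
  rw [mem_ball_zero_iff, Prod.norm_mk, max_lt_iff] at hp ⊢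
  rw [norm_smul, norm_smul, Real.norm_of_nonneg ha.1, Real.norm_of_nonneg hb.1]
  exact ⟨(mul_le_of_le_one_left (norm_nonneg _) ha.2).trans_lt hp.1,
    (mul_le_of_le_one_left (norm_nonneg _) hb.2).trans_lt hp.2⟩

/-- The derivative of a left inverse. -/
theorem fderiv_of_mul_eq_one {f g : V → 𝔸} {p : V} (hf : DifferentiableAt ℂ f p)
    (hg : DifferentiableAt ℂ g p) (h1 : ∀ᶠ q in 𝓝 p, g q * f q = 1) (h2 : f p * g p = 1) (v : V) :
    fderiv ℂ g p v = -(g p * fderiv ℂ f p v * g p) := by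
  have h3 : (fun q => g q * f q) =ᶠ[𝓝 p] fun _ => 1 := h1
  have h4 := congrArg (fun L => L v) (h3.fderiv_eq (𝕜 := ℂ))
  rw [fderiv_fun_mul' hg hf] at h4
  simp only [_root_.add_apply, _root_.smul_apply, fderiv_fun_const, Pi.zero_apply,
    _root_.zero_apply, smul_eq_mul] at h4
  have h5 : g p * fderiv ℂ f p v + fderiv ℂ g p v * f p = 0 := h4
  have h6 := congrArg (· * g p) h5
  simp only [add_mul, mul_assoc, h2, mul_one, zero_mul] at h6
  rw [mul_assoc]
  exact (neg_eq_of_add_eq_zero_right h6).symm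

/-- The hypotheses are the three invariants of `independent_of_snd` compared at (ζ, w) and (ζ, 0),
with `X` the common value of the fourth. Elimination leaves a linear differential equation for the
difference of τ and its restriction `g`. -/
theorem IsFlatSystem.sub_eq_of_independent {𝔹 : Type*} [Ring 𝔹] {τ g τe ge Y Y0 Z Z0 X : 𝔹}
    (h1 : Y - τ * X = Y0 - g * X)
    (h2 : Z - X * τ = Z0 - X * g)
    (h3 : τe - τ * (Z - X * τ) - Y * τ = ge - g * (Z0 - X * g) - Y0 * g) :
    τe - ge = (τ - g) * Z0 + Y * (τ - g) := by
  have e0 : Y0 = Y - τ * X + g * X := by rw [h1]; abel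
  have e1 : τe = ge - g * (Z0 - X * g) - Y0 * g + τ * (Z0 - X * g) + Y * τ := by
    rw [← h3, h2]; abel
  rw [e1, e0]
  noncomm_ring

namespace IsFlatSystem

variable {h k σ τ hi ki : V × V → 𝔸} {R : ℝ} (H : IsFlatSystem h k σ τ hi ki R)

include H

theorem fderiv_hi {p : V × V} (hp : p ∈ Metric.ball 0 R) (v : V × V) :
    fderiv ℂ hi p v = -(hi p * fderiv ℂ h p v * hi p) :=
  fderiv_of_mul_eq_one (H.diff_h p hp) (H.diff_hi p hp)
    (by filter_upwards [Metric.isOpen_ball.mem_nhds hp] with q hq using H.hi_mul q hq)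
    (H.mul_hi p hp) v

theorem fderiv_ki {p : V × V} (hp : p ∈ Metric.ball 0 R) (v : V × V) :
    fderiv ℂ ki p v = -(ki p * fderiv ℂ k p v * ki p) :=
  fderiv_of_mul_eq_one (H.diff_k p hp) (H.diff_ki p hp)
    (by filter_upwards [Metric.isOpen_ball.mem_nhds hp] with q hq using H.ki_mul q hq)
    (H.mul_ki p hp) v

/-- The combinations of the first derivatives that are holomorphic in `ζ`. -/
theorem independent_of_snd {ζ w : V} (hp : (ζ, w) ∈ Metric.ball (0 : V × V) R) {η : V}
    (hη : η ∈ Metric.ball (0 : V) R) :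
    (ki (ζ, w) * fderiv ℂ σ (ζ, w) (η, 0) * hi (ζ, w)
      = ki (ζ, 0) * fderiv ℂ σ (ζ, 0) (η, 0) * hi (ζ, 0)) ∧
    (fderiv ℂ h (ζ, w) (η, 0) * hi (ζ, w)
        - τ (ζ, w) * (ki (ζ, w) * fderiv ℂ σ (ζ, w) (η, 0) * hi (ζ, w))
      = fderiv ℂ h (ζ, 0) (η, 0) * hi (ζ, 0)
        - τ (ζ, 0) * (ki (ζ, 0) * fderiv ℂ σ (ζ, 0) (η, 0) * hi (ζ, 0))) ∧
    (ki (ζ, w) * fderiv ℂ k (ζ, w) (η, 0)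
        - ki (ζ, w) * fderiv ℂ σ (ζ, w) (η, 0) * hi (ζ, w) * τ (ζ, w)
      = ki (ζ, 0) * fderiv ℂ k (ζ, 0) (η, 0)
        - ki (ζ, 0) * fderiv ℂ σ (ζ, 0) (η, 0) * hi (ζ, 0) * τ (ζ, 0)) ∧
    (fderiv ℂ τ (ζ, w) (η, 0)
        - τ (ζ, w) * (ki (ζ, w) * fderiv ℂ k (ζ, w) (η, 0)
          - ki (ζ, w) * fderiv ℂ σ (ζ, w) (η, 0) * hi (ζ, w) * τ (ζ, w))
        - fderiv ℂ h (ζ, w) (η, 0) * hi (ζ, w) * τ (ζ, w)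
      = fderiv ℂ τ (ζ, 0) (η, 0)
        - τ (ζ, 0) * (ki (ζ, 0) * fderiv ℂ k (ζ, 0) (η, 0)
          - ki (ζ, 0) * fderiv ℂ σ (ζ, 0) (η, 0) * hi (ζ, 0) * τ (ζ, 0))
        - fderiv ℂ h (ζ, 0) (η, 0) * hi (ζ, 0) * τ (ζ, 0)) := by
  -- Each combination is constant along the segment from (ζ, 0) to (ζ, w).
  have step : ∀ C : V × V → 𝔸, (∀ t ∈ Set.Icc (0 : ℝ) 1,
      HasDerivAt (fun t : ℝ => C (ζ, t • w)) 0 t) → C (ζ, w) = C (ζ, 0) := by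
    intro C hC
    simpa using eq_of_hasDerivAt_zero hC
  have hw : w ∈ Metric.ball (0 : V) R :=
    mem_ball_zero_iff.mpr ((norm_snd_le (ζ, w)).trans_lt (mem_ball_zero_iff.mp hp))
  have mem : ∀ t ∈ Set.Icc (0 : ℝ) 1, (ζ, t • w) ∈ Metric.ball (0 : V × V) R := fun t ht => by
    simpa using prod_smul_mem_ball hp (a := 1) (by simp) ht
  have clm : ∀ {f : V × V → 𝔸} {p : V × V}, DifferentiableAt ℂ (fderiv ℂ f) p →
      DifferentiableAt ℂ (fun q => fderiv ℂ f q (η, 0)) p := fun hf =>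
    hf.clm_apply (differentiableAt_const _)
  have dτ := fun t ht => (H.diff_τ _ (mem t ht)).hasDerivAt_snd_smul
  have dhi := fun t ht => ((H.diff_hi _ (mem t ht)).hasDerivAt_snd_smul).congr_deriv
    (H.fderiv_hi (mem t ht) _)
  have dki := fun t ht => ((H.diff_ki _ (mem t ht)).hasDerivAt_snd_smul).congr_deriv
    (H.fderiv_ki (mem t ht) _)
  have dhe := fun t ht => ((clm (H.diff_fderiv_h _ (mem t ht))).hasDerivAt_snd_smul).congr_deriv
    (H.eq_h _ (mem t ht) η hη w hw)
  have dke := fun t ht => ((clm (H.diff_fderiv_k _ (mem t ht))).hasDerivAt_snd_smul).congr_deriv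
    (H.eq_k _ (mem t ht) η hη w hw)
  have dσe := fun t ht => ((clm (H.diff_fderiv_σ _ (mem t ht))).hasDerivAt_snd_smul).congr_deriv
    (H.eq_σ _ (mem t ht) η hη w hw)
  have dτe := fun t ht => ((clm (H.diff_fderiv_τ _ (mem t ht))).hasDerivAt_snd_smul).congr_deriv
    (H.eq_τ _ (mem t ht) η hη w hw)
  have dX := fun t ht => ((dki t ht).mul (dσe t ht)).mul (dhi t ht)
  have dY := fun t ht => ((dhe t ht).mul (dhi t ht)).sub ((dτ t ht).mul (dX t ht))
  have dZ := fun t ht => ((dki t ht).mul (dke t ht)).sub ((dX t ht).mul (dτ t ht))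
  refine ⟨step (fun q => ki q * fderiv ℂ σ q (η, 0) * hi q) fun t ht =>
      (dX t ht).congr_deriv ?_,
    step (fun q => fderiv ℂ h q (η, 0) * hi q - τ q * (ki q * fderiv ℂ σ q (η, 0) * hi q))
      fun t ht => (dY t ht).congr_deriv ?_,
    step (fun q => ki q * fderiv ℂ k q (η, 0) - ki q * fderiv ℂ σ q (η, 0) * hi q * τ q)
      fun t ht => (dZ t ht).congr_deriv ?_,
    step (fun q => fderiv ℂ τ q (η, 0) - τ q * (ki q * fderiv ℂ k q (η, 0)
        - ki q * fderiv ℂ σ q (η, 0) * hi q * τ q) - fderiv ℂ h q (η, 0) * hi q * τ q)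
      fun t ht => (((dτe t ht).sub ((dτ t ht).mul (dZ t ht))).sub
        (((dhe t ht).mul (dhi t ht)).mul (dτ t ht))).congr_deriv ?_⟩
  -- Once the second derivatives and the derivatives of `hi` and `ki` are substituted, all terms
  -- cancel formally, without the relation `hi * h = 1`.
  all_goals
    simp only [Pi.mul_apply, Pi.sub_apply]
    noncomm_ring

/-- A solution is determined by its restrictions to the coordinate subspaces. -/
theorem eq_const {ζ w : V} (hp : (ζ, w) ∈ Metric.ball (0 : V × V) R) :
    hi (ζ, w) * (τ (ζ, w) - τ (ζ, 0)) * ki (ζ, 0)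
        = hi (0, w) * (τ (0, w) - τ (0, 0)) * ki (0, 0) ∧
      hi (ζ, w) * h (ζ, 0) + hi (ζ, w) * (τ (ζ, w) - τ (ζ, 0)) * ki (ζ, 0) * σ (ζ, 0)
        = hi (0, w) * h (0, 0)
          + hi (0, w) * (τ (0, w) - τ (0, 0)) * ki (0, 0) * σ (0, 0) := by
  have step : ∀ C : V → 𝔸, (∀ t ∈ Set.Icc (0 : ℝ) 1,
      HasDerivAt (fun t : ℝ => C (t • ζ)) 0 t) → C ζ = C 0 := by
    intro C hC
    simpa using eq_of_hasDerivAt_zero hC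
  have hζ : ζ ∈ Metric.ball (0 : V) R :=
    mem_ball_zero_iff.mpr ((norm_fst_le (ζ, w)).trans_lt (mem_ball_zero_iff.mp hp))
  have mem : ∀ t ∈ Set.Icc (0 : ℝ) 1, (t • ζ, w) ∈ Metric.ball (0 : V × V) R := fun t ht => by
    simpa using prod_smul_mem_ball hp ht (b := 1) (by simp)
  have mem0 : ∀ t ∈ Set.Icc (0 : ℝ) 1, (t • ζ, (0 : V)) ∈ Metric.ball (0 : V × V) R :=
    fun t ht => by simpa using prod_smul_mem_ball hp ht (b := 0) (by simp)
  have dτ := fun t ht => (H.diff_τ _ (mem t ht)).hasDerivAt_fst_smul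
  have dg := fun t ht => (H.diff_τ _ (mem0 t ht)).hasDerivAt_fst_smul
  have da := fun t ht => (H.diff_h _ (mem0 t ht)).hasDerivAt_fst_smul
  have db := fun t ht => (H.diff_σ _ (mem0 t ht)).hasDerivAt_fst_smul
  have dhi := fun t ht => ((H.diff_hi _ (mem t ht)).hasDerivAt_fst_smul).congr_deriv
    (H.fderiv_hi (mem t ht) _)
  have dki := fun t ht => ((H.diff_ki _ (mem0 t ht)).hasDerivAt_fst_smul).congr_deriv
    (H.fderiv_ki (mem0 t ht) _)
  have key := fun t ht => H.independent_of_snd (mem t ht) hζ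
  have dQ := fun t ht => ((dhi t ht).mul ((dτ t ht).sub (dg t ht))).mul (dki t ht)
  have dQ0 : ∀ t ∈ Set.Icc (0 : ℝ) 1,
      HasDerivAt (fun t : ℝ => hi (t • ζ, w) * (τ (t • ζ, w) - τ (t • ζ, 0)) * ki (t • ζ, 0)) 0 t := by
    intro t ht
    refine (dQ t ht).congr_deriv ?_
    obtain ⟨h1, h2, h3, h4⟩ := key t ht
    rw [h1] at h2 h3
    rw [h1] at h4
    -- This linear equation says exactly that `hi * (τ - g) * ki`, with the last factor taken on w =
    -- 0, has zero derivative.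
    have e := sub_eq_of_independent h2 h3 h4
    simp only [Pi.mul_apply, Pi.sub_apply]
    rw [e]
    noncomm_ring
  refine ⟨step (fun ζ => hi (ζ, w) * (τ (ζ, w) - τ (ζ, 0)) * ki (ζ, 0)) dQ0,
    step (fun ζ => hi (ζ, w) * h (ζ, 0)
      + hi (ζ, w) * (τ (ζ, w) - τ (ζ, 0)) * ki (ζ, 0) * σ (ζ, 0)) fun t ht =>
      (((dhi t ht).mul (da t ht)).add ((dQ0 t ht).mul (db t ht))).congr_deriv ?_⟩
  obtain ⟨h1, h2, -, -⟩ := key t ht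
  rw [h1] at h2
  -- Multiplying the second invariant by `h` on w = 0 expresses the derivative of that restriction;
  -- the τ-term it brings in is cancelled by the derivative of σ.
  have h5 := congrArg (· * h (t • ζ, 0)) h2
  simp only [sub_mul, mul_assoc, H.hi_mul _ (mem0 t ht), mul_one] at h5
  have h6 := (sub_eq_iff_eq_add.mp h5.symm)
  rw [h6]
  simp only [zero_mul, zero_add]
  noncomm_ring

end IsFlatSystem

end FlatSystem

/-! ### The Levi form through a holomorphic polarization -/

section Polarization

open Complex

variable {V : Type*} [NormedAddCommGroup V] [StarAddMonoid V] [ContinuousStar V]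

theorem continuous_diagonal : Continuous (fun y : V => (y, star y)) :=
  continuous_id.prodMk continuous_star

variable [NormedSpace ℂ V] [StarModule ℝ V]

theorem hasFDerivAt_diagonal (x : V) :
    HasFDerivAt (fun y : V => (y, star y))
      ((ContinuousLinearMap.id ℝ V).prod (starL' ℝ : V ≃L[ℝ] V).toContinuousLinearMap) x :=
  (hasFDerivAt_id x).prodMk (starL' ℝ : V ≃L[ℝ] V).toContinuousLinearMap.hasFDerivAt

theorem analyticAt_diagonal (x : V) : AnalyticAt ℝ (fun y : V => (y, star y)) x :=
  analyticAt_id.prod ((starL' ℝ : V ≃L[ℝ] V).toContinuousLinearMap.analyticAt x)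

variable {W : Type*} [NormedAddCommGroup W] [NormedSpace ℂ W]

theorem fderiv_diagonal {G : V × V → W} {x : V} (hG : DifferentiableAt ℂ G (x, star x)) (v : V) :
    fderiv ℝ (fun y => G (y, star y)) x v = fderiv ℂ G (x, star x) (v, star v) := by
  have h := (hG.hasFDerivAt.restrictScalars ℝ).comp x (hasFDerivAt_diagonal x)
  have h' : HasFDerivAt (fun y => G (y, star y)) _ x := h
  rw [h'.fderiv]
  rfl

variable {F : V → ℝ} {Φ : V × V → ℂ} {x : V}

theorem contDiffAt_of_polarization (hΦ : AnalyticAt ℂ Φ (x, star x))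
    (hF : ∀ᶠ y in 𝓝 x, (F y : ℂ) = Φ (y, star y)) : ContDiffAt ℝ ∞ F x := by
  have h1 : AnalyticAt ℝ (fun y => reCLM (Φ (y, star y))) x :=
    (reCLM.analyticAt _).fun_comp
      (AnalyticAt.fun_comp (g := Φ) (hΦ.restrictScalars (𝕜 := ℝ)) (analyticAt_diagonal x))
  refine h1.contDiffAt.congr_of_eventuallyEq ?_
  filter_upwards [hF] with y hy
  simp [← hy]

variable [StarModule ℂ V]

/-- On the diagonal only the second argument depends antiholomorphically on the point; the factor 2
is the normalization of `twiceDbar`. -/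
theorem twiceDbar_diagonal {G : V × V → W} {x : V} (hG : DifferentiableAt ℂ G (x, star x))
    (v : V) :
    twiceDbar (fun y => G (y, star y)) x v = (2 : ℂ) • fderiv ℂ G (x, star x) (0, star v) := by
  have e1 : (v, star v) = (v, (0 : V)) + ((0 : V), star v) := by simp
  have e2 : (I • v, star (I • v)) = I • (v, (0 : V)) - I • ((0 : V), star v) := by
    simp [star_smul]
  rw [twiceDbar, fderiv_diagonal hG, fderiv_diagonal hG, e1, e2, map_add, map_sub, map_smul,
    map_smul, smul_sub, smul_smul, smul_smul, I_mul_I]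
  module

/-- The Levi form in terms of the mixed second derivatives of the polarization `Φ` of `F`. -/
theorem leviForm_polarization (hΦ : AnalyticAt ℂ Φ (x, star x))
    (hF : ∀ᶠ y in 𝓝 x, (F y : ℂ) = Φ (y, star y)) (v u : V) :
    leviForm F x v u
      = (4 * fderiv ℂ (fun q => fderiv ℂ Φ q (u, 0)) (x, star x) (0, star v)).re := by
  have hc : ContinuousAt (fun y : V => (y, star y)) x := continuous_diagonal.continuousAt
  -- As `F` is real, the derivatives of `Φ` along `(v, 0)` and `(0, star v)` have equal real parts,
  -- so the differential of `F` is twice the first of these.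
  have h1 : ∀ᶠ y in 𝓝 x, ∀ v, fderiv ℝ F y v = (2 * fderiv ℂ Φ (y, star y) (v, 0)).re := by
    filter_upwards [hF.eventually_nhds, hc.eventually hΦ.eventually_analyticAt] with y hy hΦy v
    have hr : DifferentiableAt ℝ F y :=
      (contDiffAt_of_polarization hΦy hy).differentiableAt (by simp)
    have h2 : ∀ v, ((fderiv ℝ F y v : ℝ) : ℂ) = fderiv ℂ Φ (y, star y) (v, star v) := by
      intro v
      rw [← fderiv_diagonal hΦy.differentiableAt v, ← (show (fun y => (F y : ℂ)) =ᶠ[𝓝 y] _ from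
        hy).fderiv_eq]
      have h3 : HasFDerivAt (fun y => (F y : ℂ)) (ofRealCLM.comp (fderiv ℝ F y)) y :=
        ofRealCLM.hasFDerivAt.comp y hr.hasFDerivAt
      rw [h3.fderiv]
      rfl
    have e1 : (v, star v) = (v, (0 : V)) + ((0 : V), star v) := by simp
    have e2 : (I • v, star (I • v)) = I • (v, (0 : V)) - I • ((0 : V), star v) := by
      simp [star_smul]
    have h4 := h2 v
    have h5 := h2 (I • v)
    rw [e1, map_add] at h4
    rw [e2, map_sub, (fderiv ℂ Φ (y, star y)).map_smul, (fderiv ℂ Φ (y, star y)).map_smul] at h5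
    have h6 := congrArg re h4
    have h7 := congrArg im h5
    simp at h6 h7
    simp
    linarith
  have hd : DifferentiableAt ℂ (fun q => fderiv ℂ Φ q (u, 0)) (x, star x) :=
    hΦ.fderiv.differentiableAt.clm_apply (differentiableAt_const _)
  have hd2 : DifferentiableAt ℂ (fun q => 2 * fderiv ℂ Φ q (u, 0)) (x, star x) := hd.const_mul 2
  rw [leviForm_eq_re_twiceDbar (contDiffAt_of_polarization hΦ hF)
    (Θ := fun y v => 2 * fderiv ℂ Φ (y, star y) (v, 0)) h1 ?_ u ?_ v]
  · rw [twiceDbar_diagonal (G := fun q => 2 * fderiv ℂ Φ q (u, 0)) hd2, fderiv_const_mul hd]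
    simp only [_root_.smul_apply, smul_eq_mul]
    ring_nf
  · intro y v
    have : (I • v, (0 : V)) = I • (v, (0 : V)) := by simp
    simp only [this, map_smul, smul_eq_mul]
    ring
  · exact ((hd2.restrictScalars ℝ).hasFDerivAt.comp x (hasFDerivAt_diagonal x)).differentiableAt

/-- Replacing `u` by `I • u` recovers the imaginary part of the complex Hessian from the real Levi
form. -/
theorem leviForm_eq_zero_iff_polarization (hΦ : AnalyticAt ℂ Φ (x, star x))
    (hF : ∀ᶠ y in 𝓝 x, (F y : ℂ) = Φ (y, star y)) (v : V) :
    (∀ u, leviForm F x v u = 0)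
      ↔ ∀ u, fderiv ℂ (fun q => fderiv ℂ Φ q (v, 0)) (x, star x) (0, u) = 0 := by
  have hs : ∀ u, leviForm F x v u
      = (4 * fderiv ℂ (fun q => fderiv ℂ Φ q (v, 0)) (x, star x) (0, star u)).re := fun u => by
    rw [← leviForm_polarization hΦ hF]
    exact leviForm_symm (q := (0, x)) (contDiffAt_of_polarization hΦ hF) v u
  constructor
  · intro h u
    have h1 := h (star u)
    have h2 := h (star (I • u))
    rw [hs, star_star] at h1 h2
    have e : ((0 : V), I • u) = I • ((0 : V), u) := by simp
    rw [e, map_smul] at h2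
    apply Complex.ext
    · simpa using h1
    · simpa using h2
  · intro h u
    rw [hs, h]
    simp

end Polarization

/-! ### Complexification of the coefficients of a model -/

section CoefficientComplexification

open Complex
open scoped Matrix.Norms.Operator

section

variable {V : Type*} [NormedAddCommGroup V] [NormedSpace ℂ V] [StarAddMonoid V] [StarModule ℂ V]
  [NormedStarGroup V] {f g : V × V → ℂ}

theorem AnalyticAt.eventually_eq_of_diagonal (hf : AnalyticAt ℂ f 0) (hg : AnalyticAt ℂ g 0)
    (h : ∀ᶠ x in 𝓝 (0 : V), f (x, star x) = g (x, star x)) :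
    ∀ᶠ p in 𝓝 (0 : V × V), f p = g p := by
  have h1 := eventually_eq_zero_of_diagonal (g := fun p => f p - g p)
    (by filter_upwards [hf.eventually_analyticAt, hg.eventually_analyticAt] with p h1 h2
        using h1.differentiableAt.sub h2.differentiableAt)
    (by filter_upwards [h] with x hx using sub_eq_zero.mpr hx)
  filter_upwards [h1] with p hp using sub_eq_zero.mp hp

/-- Schwarz reflection: `p ↦ star (f (star p.swap))` is holomorphic and equals `g` on the diagonal,
hence near `0`. -/
theorem AnalyticAt.eventually_eq_star_of_diagonal (hf : AnalyticAt ℂ f 0) (hg : AnalyticAt ℂ g 0)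
    (h : ∀ᶠ x in 𝓝 (0 : V), g (x, star x) = star (f (x, star x))) :
    ∀ᶠ x in 𝓝 (0 : V), g (0, star x) = star (f (x, 0)) := by
  have hc : Continuous fun p : V × V => star p.swap := continuous_star.comp continuous_swap
  have hc0 : Filter.Tendsto (fun p : V × V => star p.swap) (𝓝 0) (𝓝 0) :=
    hc.tendsto' _ _ (by simp)
  have h1 := eventually_eq_zero_of_diagonal (g := fun p => g p - star (f (star p.swap)))
    (by
      filter_upwards [hc0.eventually hf.eventually_analyticAt, hg.eventually_analyticAt]
        with p h1 h2
      refine h2.differentiableAt.sub ?_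
      have h3 : DifferentiableAt ℂ (fun q : V × V => f q.swap) (star p) :=
        DifferentiableAt.comp (g := f) (star p) h1.differentiableAt
          (differentiableAt_snd.prodMk differentiableAt_fst)
      have h4 := h3.star_star
      rw [star_star] at h4
      exact h4)
    (by
      filter_upwards [h] with x hx
      have : star (x, star x).swap = (x, star x) := by
        ext1 <;> simp
      rw [this, hx, sub_self])
  have h2 : Filter.Tendsto (fun x : V => ((0 : V), star x)) (𝓝 0) (𝓝 0) :=
    (Continuous.prodMk continuous_const continuous_star).tendsto' _ _ (by simp)
  filter_upwards [h2.eventually h1] with x hx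
  have e : star ((0 : V), star x).swap = (x, 0) := by
    ext1 <;> simp
  rw [e] at hx
  exact sub_eq_zero.mp hx

end

variable {s r : ℕ}

/-- `h`, `σ`, `τ` are holomorphic extensions of `H`, `S` and the conjugate of `S` from the totally
real subspace of the pairs `(ζ, star ζ)`. -/
structure IsCoefficientComplexification (H S : (Fin r → ℂ) → Matrix (Fin s) (Fin s) ℂ)
    (h σ τ : (Fin r → ℂ) × (Fin r → ℂ) → Matrix (Fin s) (Fin s) ℂ) : Prop where
  analytic_h : AnalyticAt ℂ h 0
  analytic_σ : AnalyticAt ℂ σ 0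
  analytic_τ : AnalyticAt ℂ τ 0
  h_diagonal : ∀ᶠ ζ in 𝓝 0, h (ζ, star ζ) = H ζ
  σ_diagonal : ∀ᶠ ζ in 𝓝 0, σ (ζ, star ζ) = S ζ
  τ_diagonal : ∀ᶠ ζ in 𝓝 0, τ (ζ, star ζ) = conjMatrix (S ζ)
  σ_symm : ∀ᶠ p in 𝓝 0, (σ p).IsSymm
  τ_symm : ∀ᶠ p in 𝓝 0, (τ p).IsSymm
  h_conj : ∀ᶠ ζ in 𝓝 0, h (0, star ζ) = conjMatrix (h (ζ, 0))ᵀ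
  τ_conj : ∀ᶠ ζ in 𝓝 0, τ (0, star ζ) = conjMatrix (σ (ζ, 0))

theorem exists_matrix_complexification {A : (Fin r → ℂ) → Matrix (Fin s) (Fin s) ℂ}
    (hA : ∀ i j, AnalyticAt ℝ (fun ζ => A ζ i j) 0) :
    ∃ a : (Fin r → ℂ) × (Fin r → ℂ) → Matrix (Fin s) (Fin s) ℂ, AnalyticAt ℂ a 0 ∧
      ∀ᶠ ζ in 𝓝 0, a (ζ, star ζ) = A ζ := by
  choose g hg hgA using fun i j => (hA i j).exists_complexification
  refine ⟨fun p => Matrix.of fun i j => g i j p, analyticAt_matrix_iff.mpr hg, ?_⟩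
  have := Filter.eventually_all.mpr fun i => Filter.eventually_all.mpr fun j => hgA i j
  filter_upwards [this] with ζ hζ
  ext i j
  exact hζ i j

/-- The symmetries of `H` and `S` hold on the diagonal and pass to the extensions by the identity
principle. -/
theorem IsTwoNondegenerateModel.exists_complexification
    {H S : (Fin r → ℂ) → Matrix (Fin s) (Fin s) ℂ} (hM : IsTwoNondegenerateModel H S) :
    ∃ h σ τ, IsCoefficientComplexification H S h σ τ := by
  obtain ⟨h, hh, hH⟩ := exists_matrix_complexification hM.analytic_H
  obtain ⟨σ, hσ, hS⟩ := exists_matrix_complexification hM.analytic_S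
  obtain ⟨τ, hτ, hT⟩ := exists_matrix_complexification (A := fun ζ => conjMatrix (S ζ))
    fun i j => (conjCLE.toContinuousLinearMap.analyticAt _).fun_comp (hM.analytic_S i j)
  have eh := fun i j => analyticAt_matrix_iff.mp hh i j
  have eσ := fun i j => analyticAt_matrix_iff.mp hσ i j
  have eτ := fun i j => analyticAt_matrix_iff.mp hτ i j
  refine ⟨h, σ, τ, hh, hσ, hτ, hH, hS, hT, ?_, ?_, ?_, ?_⟩
  · have h1 := fun i j => (eσ j i).eventually_eq_of_diagonal (eσ i j) (by
      filter_upwards [hS, hM.symmetric] with ζ h1 h2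
      rw [h1]
      exact h2.apply i j)
    filter_upwards [Filter.eventually_all.mpr fun i => Filter.eventually_all.mpr (h1 i)] with p hp
    exact Matrix.IsSymm.ext hp
  · have h1 := fun i j => (eτ j i).eventually_eq_of_diagonal (eτ i j) (by
      filter_upwards [hT, hM.symmetric] with ζ h1 h2
      rw [h1]
      exact congrArg (starRingEnd ℂ) (h2.apply i j))
    filter_upwards [Filter.eventually_all.mpr fun i => Filter.eventually_all.mpr (h1 i)] with p hp
    exact Matrix.IsSymm.ext hp
  · have h1 := fun i j => (eh j i).eventually_eq_star_of_diagonal (eh i j) (by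
      filter_upwards [hH, hM.hermitian] with ζ h1 h2
      rw [h1]
      exact (h2.apply i j).symm)
    filter_upwards [Filter.eventually_all.mpr fun i => Filter.eventually_all.mpr (h1 i)] with ζ hζ
    ext i j
    exact hζ i j
  · have h1 := fun i j => (eσ i j).eventually_eq_star_of_diagonal (eτ i j) (by
      filter_upwards [hT, hS] with ζ h1 h2
      rw [h1, h2]
      rfl)
    filter_upwards [Filter.eventually_all.mpr fun i => Filter.eventually_all.mpr (h1 i)] with ζ hζ
    ext i j
    exact hζ i j

end CoefficientComplexification

/-! ### Mixed second derivatives of the polarized model -/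

section ModelPolarization

open Complex
open scoped Matrix.Norms.Operator

variable {s r : ℕ}

/-- The space of the points `((z, ζ), (y, w))`. -/
abbrev DoubledSpace (s r : ℕ) : Type := ((Fin s → ℂ) × (Fin r → ℂ)) × ((Fin s → ℂ) × (Fin r → ℂ))

theorem fderiv_dotProduct_mulVec {E : Type*} [NormedAddCommGroup E] [NormedSpace ℂ E]
    {A : E → Matrix (Fin s) (Fin s) ℂ} {a b : E → Fin s → ℂ} {p : E}
    (ha : DifferentiableAt ℂ a p) (hA : DifferentiableAt ℂ A p) (hb : DifferentiableAt ℂ b p)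
    (v : E) :
    fderiv ℂ (fun q => a q ⬝ᵥ (A q *ᵥ b q)) p v
      = a p ⬝ᵥ (A p *ᵥ fderiv ℂ b p v) + a p ⬝ᵥ (fderiv ℂ A p v *ᵥ b p)
        + fderiv ℂ a p v ⬝ᵥ (A p *ᵥ b p) := by
  rw [fderiv_dotProduct ha (hA.mulVec hb), fderiv_mulVec hA hb, dotProduct_add]

/-- The holomorphic function of `((z, ζ), (y, w))` whose restriction to `y = star z`, `w = star ζ`
is the defining function of the model. -/
noncomputable def modelPolarization
    (h σ τ : (Fin r → ℂ) × (Fin r → ℂ) → Matrix (Fin s) (Fin s) ℂ)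
    (p : DoubledSpace s r) : ℂ :=
  p.1.1 ⬝ᵥ (h (p.1.2, p.2.2) *ᵥ p.2.1) + (1 / 2 * (p.2.1 ⬝ᵥ (σ (p.1.2, p.2.2) *ᵥ p.2.1))
    + 1 / 2 * (p.1.1 ⬝ᵥ (τ (p.1.2, p.2.2) *ᵥ p.1.1)))

variable {h σ τ : (Fin r → ℂ) × (Fin r → ℂ) → Matrix (Fin s) (Fin s) ℂ}
  {p : DoubledSpace s r}

theorem analyticAt_baseParams :
    AnalyticAt ℂ (fun q : DoubledSpace s r =>
      (q.1.2, q.2.2)) p :=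
  (analyticAt_snd.fun_comp analyticAt_fst).prod (analyticAt_snd.fun_comp analyticAt_snd)

theorem AnalyticAt.comp_baseParams {W : Type*} [NormedAddCommGroup W] [NormedSpace ℂ W]
    {A : (Fin r → ℂ) × (Fin r → ℂ) → W} (hA : AnalyticAt ℂ A (p.1.2, p.2.2)) :
    AnalyticAt ℂ (fun q : DoubledSpace s r =>
      A (q.1.2, q.2.2)) p :=
  AnalyticAt.fun_comp (g := A) hA analyticAt_baseParams

theorem fderiv_comp_baseParams {W : Type*} [NormedAddCommGroup W] [NormedSpace ℂ W]
    {A : (Fin r → ℂ) × (Fin r → ℂ) → W} (hA : DifferentiableAt ℂ A (p.1.2, p.2.2))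
    (v : DoubledSpace s r) :
    fderiv ℂ (fun q : DoubledSpace s r => A (q.1.2, q.2.2)) p v
      = fderiv ℂ A (p.1.2, p.2.2) (v.1.2, v.2.2) := by
  let L : DoubledSpace s r →L[ℂ] (Fin r → ℂ) × (Fin r → ℂ) :=
    ((ContinuousLinearMap.snd ℂ _ _).comp (ContinuousLinearMap.fst ℂ _ _)).prod
      ((ContinuousLinearMap.snd ℂ _ _).comp (ContinuousLinearMap.snd ℂ _ _))
  have h2 : HasFDerivAt (fun q : DoubledSpace s r => A (q.1.2, q.2.2)) _ p :=
    HasFDerivAt.comp (f := L) p hA.hasFDerivAt L.hasFDerivAt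
  rw [h2.fderiv]
  rfl

theorem fderiv_fst_fst (v : DoubledSpace s r) :
    fderiv ℂ (fun q : DoubledSpace s r => q.1.1) p v = v.1.1 := by
  have h3 : HasFDerivAt (fun q : DoubledSpace s r => q.1.1) _ p :=
    ((ContinuousLinearMap.fst ℂ (Fin s → ℂ) (Fin r → ℂ)).comp
      (ContinuousLinearMap.fst ℂ _ ((Fin s → ℂ) × (Fin r → ℂ)))).hasFDerivAt
  rw [h3.fderiv]
  rfl

theorem fderiv_snd_fst (v : DoubledSpace s r) :
    fderiv ℂ (fun q : DoubledSpace s r => q.2.1) p v = v.2.1 := by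
  have h3 : HasFDerivAt (fun q : DoubledSpace s r => q.2.1) _ p :=
    ((ContinuousLinearMap.fst ℂ (Fin s → ℂ) (Fin r → ℂ)).comp
      (ContinuousLinearMap.snd ℂ ((Fin s → ℂ) × (Fin r → ℂ)) _)).hasFDerivAt
  rw [h3.fderiv]
  rfl

theorem analyticAt_modelPolarization (hh : AnalyticAt ℂ h (p.1.2, p.2.2))
    (hσ : AnalyticAt ℂ σ (p.1.2, p.2.2)) (hτ : AnalyticAt ℂ τ (p.1.2, p.2.2)) :
    AnalyticAt ℂ (modelPolarization h σ τ) p := by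
  have h1 : AnalyticAt ℂ (fun q : DoubledSpace s r =>
      q.1.1) p := analyticAt_fst.fun_comp analyticAt_fst
  have h2 : AnalyticAt ℂ (fun q : DoubledSpace s r =>
      q.2.1) p := analyticAt_fst.fun_comp analyticAt_snd
  exact (h1.dotProduct (hh.comp_baseParams.mulVec h2)).add
    ((analyticAt_const.mul (h2.dotProduct (hσ.comp_baseParams.mulVec h2))).add
      (analyticAt_const.mul (h1.dotProduct (hτ.comp_baseParams.mulVec h1))))

theorem fderiv_modelPolarization (hh : AnalyticAt ℂ h (p.1.2, p.2.2))
    (hσ : AnalyticAt ℂ σ (p.1.2, p.2.2)) (hτ : AnalyticAt ℂ τ (p.1.2, p.2.2))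
    (hs : (τ (p.1.2, p.2.2)).IsSymm) (v : (Fin s → ℂ) × (Fin r → ℂ)) :
    fderiv ℂ (modelPolarization h σ τ) p (v, 0)
      = (p.1.1 ⬝ᵥ (fderiv ℂ h (p.1.2, p.2.2) (v.2, 0) *ᵥ p.2.1) + v.1 ⬝ᵥ (h (p.1.2, p.2.2) *ᵥ p.2.1))
        + (1 / 2 * (p.2.1 ⬝ᵥ (fderiv ℂ σ (p.1.2, p.2.2) (v.2, 0) *ᵥ p.2.1))
        + (1 / 2 * (p.1.1 ⬝ᵥ (fderiv ℂ τ (p.1.2, p.2.2) (v.2, 0) *ᵥ p.1.1))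
          + v.1 ⬝ᵥ (τ (p.1.2, p.2.2) *ᵥ p.1.1))) := by
  have h1 : DifferentiableAt ℂ
      (fun q : DoubledSpace s r => q.1.1) p :=
    (analyticAt_fst.fun_comp analyticAt_fst).differentiableAt
  have h2 : DifferentiableAt ℂ
      (fun q : DoubledSpace s r => q.2.1) p :=
    (analyticAt_fst.fun_comp analyticAt_snd).differentiableAt
  have d1 := h1.dotProduct ((hh.comp_baseParams (p := p)).differentiableAt.mulVec h2)
  have d2 := h2.dotProduct ((hσ.comp_baseParams (p := p)).differentiableAt.mulVec h2)
  have d3 := h1.dotProduct ((hτ.comp_baseParams (p := p)).differentiableAt.mulVec h1)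
  have e := ((d1.hasFDerivAt).add ((d2.hasFDerivAt.const_mul (1 / 2)).add
    (d3.hasFDerivAt.const_mul (1 / 2)))).fderiv
  have e' : fderiv ℂ (modelPolarization h σ τ) p = _ := e
  have eh : fderiv ℂ (fun q : DoubledSpace s r => h (q.1.2, q.2.2)) p (v, 0)
      = fderiv ℂ h (p.1.2, p.2.2) (v.2, 0) := fderiv_comp_baseParams hh.differentiableAt _
  have eσ : fderiv ℂ (fun q : DoubledSpace s r => σ (q.1.2, q.2.2)) p (v, 0)
      = fderiv ℂ σ (p.1.2, p.2.2) (v.2, 0) := fderiv_comp_baseParams hσ.differentiableAt _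
  have eτ : fderiv ℂ (fun q : DoubledSpace s r => τ (q.1.2, q.2.2)) p (v, 0)
      = fderiv ℂ τ (p.1.2, p.2.2) (v.2, 0) := fderiv_comp_baseParams hτ.differentiableAt _
  rw [e']
  simp only [_root_.add_apply, _root_.smul_apply, smul_eq_mul]
  rw [fderiv_dotProduct_mulVec h1 (hh.comp_baseParams (p := p)).differentiableAt h2,
    fderiv_dotProduct_mulVec h2 (hσ.comp_baseParams (p := p)).differentiableAt h2,
    fderiv_dotProduct_mulVec h1 (hτ.comp_baseParams (p := p)).differentiableAt h1,
    eh, eσ, eτ, fderiv_fst_fst, fderiv_snd_fst]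
  simp only [Prod.fst_zero, Matrix.mulVec_zero, dotProduct_zero, zero_dotProduct]
  rw [dotProduct_mulVec_transpose (τ (p.1.2, p.2.2)) p.1.1, hs.eq]
  ring

theorem AnalyticAt.fderiv_apply_const {E W : Type*} [NormedAddCommGroup E] [NormedSpace ℂ E]
    [NormedAddCommGroup W] [NormedSpace ℂ W] [CompleteSpace W] {f : E → W} {p : E}
    (hf : AnalyticAt ℂ f p) (v : E) : AnalyticAt ℂ (fun q => fderiv ℂ f q v) p :=
  ((ContinuousLinearMap.apply ℂ W v).analyticAt _).fun_comp hf.fderiv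

theorem isSymm_fderiv {E : Type*} [NormedAddCommGroup E] [NormedSpace ℂ E]
    {A : E → Matrix (Fin s) (Fin s) ℂ} {p : E} (hA : AnalyticAt ℂ A p)
    (hs : ∀ᶠ q in 𝓝 p, (A q).IsSymm) (v : E) : (fderiv ℂ A p v).IsSymm := by
  have h : (fun q => (A q)ᵀ) =ᶠ[𝓝 p] A := hs
  rw [Matrix.IsSymm, ← fderiv_matrix_transpose hA, h.fderiv_eq]

/-- The mixed second derivatives of the polarization. -/
theorem fderiv_fderiv_modelPolarization (hh : AnalyticAt ℂ h (p.1.2, p.2.2))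
    (hσ : AnalyticAt ℂ σ (p.1.2, p.2.2)) (hτ : AnalyticAt ℂ τ (p.1.2, p.2.2))
    (hσs : ∀ᶠ q in 𝓝 (p.1.2, p.2.2), (σ q).IsSymm) (hτs : ∀ᶠ q in 𝓝 (p.1.2, p.2.2), (τ q).IsSymm)
    (v u : (Fin s → ℂ) × (Fin r → ℂ)) :
    fderiv ℂ (fun q => fderiv ℂ (modelPolarization h σ τ) q (v, 0)) p (0, u)
      = u.1 ⬝ᵥ ((h (p.1.2, p.2.2))ᵀ *ᵥ v.1
          + ((fderiv ℂ h (p.1.2, p.2.2) (v.2, 0))ᵀ *ᵥ p.1.1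
            + fderiv ℂ σ (p.1.2, p.2.2) (v.2, 0) *ᵥ p.2.1))
        + (v.1 ⬝ᵥ (fderiv ℂ h (p.1.2, p.2.2) (0, u.2) *ᵥ p.2.1
            + fderiv ℂ τ (p.1.2, p.2.2) (0, u.2) *ᵥ p.1.1)
        + (p.1.1 ⬝ᵥ (fderiv ℂ (fun q => fderiv ℂ h q (v.2, 0)) (p.1.2, p.2.2) (0, u.2) *ᵥ p.2.1)
          + (1 / 2 * (p.2.1 ⬝ᵥ
              (fderiv ℂ (fun q => fderiv ℂ σ q (v.2, 0)) (p.1.2, p.2.2) (0, u.2) *ᵥ p.2.1))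
            + 1 / 2 * (p.1.1 ⬝ᵥ
              (fderiv ℂ (fun q => fderiv ℂ τ q (v.2, 0)) (p.1.2, p.2.2) (0, u.2) *ᵥ p.1.1))))) := by
  have hc : ContinuousAt (fun q : DoubledSpace s r => (q.1.2, q.2.2)) p :=
    analyticAt_baseParams.continuousAt
  have e : (fun q => fderiv ℂ (modelPolarization h σ τ) q (v, 0)) =ᶠ[𝓝 p] fun q =>
      (q.1.1 ⬝ᵥ (fderiv ℂ h (q.1.2, q.2.2) (v.2, 0) *ᵥ q.2.1) + v.1 ⬝ᵥ (h (q.1.2, q.2.2) *ᵥ q.2.1))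
        + (1 / 2 * (q.2.1 ⬝ᵥ (fderiv ℂ σ (q.1.2, q.2.2) (v.2, 0) *ᵥ q.2.1))
        + (1 / 2 * (q.1.1 ⬝ᵥ (fderiv ℂ τ (q.1.2, q.2.2) (v.2, 0) *ᵥ q.1.1))
          + v.1 ⬝ᵥ (τ (q.1.2, q.2.2) *ᵥ q.1.1))) := by
    filter_upwards [hc.eventually hh.eventually_analyticAt, hc.eventually hσ.eventually_analyticAt,
      hc.eventually hτ.eventually_analyticAt, hc.eventually hτs] with q a b c d
    exact fderiv_modelPolarization a b c d v
  have h1 : DifferentiableAt ℂ (fun q : DoubledSpace s r => q.1.1) p :=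
    (analyticAt_fst.fun_comp analyticAt_fst).differentiableAt
  have h2 : DifferentiableAt ℂ (fun q : DoubledSpace s r => q.2.1) p :=
    (analyticAt_fst.fun_comp analyticAt_snd).differentiableAt
  have hv : DifferentiableAt ℂ (fun _ : DoubledSpace s r => v.1) p := differentiableAt_const _
  have ah : AnalyticAt ℂ (fun q => fderiv ℂ h q (v.2, 0)) (p.1.2, p.2.2) :=
    hh.fderiv_apply_const (v.2, 0)
  have aσ : AnalyticAt ℂ (fun q => fderiv ℂ σ q (v.2, 0)) (p.1.2, p.2.2) :=
    hσ.fderiv_apply_const (v.2, 0)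
  have aτ : AnalyticAt ℂ (fun q => fderiv ℂ τ q (v.2, 0)) (p.1.2, p.2.2) :=
    hτ.fderiv_apply_const (v.2, 0)
  have d1 := h1.dotProduct ((ah.comp_baseParams (p := p)).differentiableAt.mulVec h2)
  have d2 := hv.dotProduct ((hh.comp_baseParams (p := p)).differentiableAt.mulVec h2)
  have d3 := h2.dotProduct ((aσ.comp_baseParams (p := p)).differentiableAt.mulVec h2)
  have d4 := h1.dotProduct ((aτ.comp_baseParams (p := p)).differentiableAt.mulVec h1)
  have d5 := hv.dotProduct ((hτ.comp_baseParams (p := p)).differentiableAt.mulVec h1)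
  have f := ((d1.hasFDerivAt.add d2.hasFDerivAt).add ((d3.hasFDerivAt.const_mul (1 / 2)).add
    ((d4.hasFDerivAt.const_mul (1 / 2)).add d5.hasFDerivAt))).fderiv
  have f' := e.fderiv_eq.trans f
  have eh : fderiv ℂ (fun q : DoubledSpace s r => h (q.1.2, q.2.2)) p (0, u)
      = fderiv ℂ h (p.1.2, p.2.2) (0, u.2) := fderiv_comp_baseParams hh.differentiableAt _
  have eτ : fderiv ℂ (fun q : DoubledSpace s r => τ (q.1.2, q.2.2)) p (0, u)
      = fderiv ℂ τ (p.1.2, p.2.2) (0, u.2) := fderiv_comp_baseParams hτ.differentiableAt _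
  have eah : fderiv ℂ (fun q : DoubledSpace s r => fderiv ℂ h (q.1.2, q.2.2) (v.2, 0)) p (0, u)
      = fderiv ℂ (fun q => fderiv ℂ h q (v.2, 0)) (p.1.2, p.2.2) (0, u.2) :=
    fderiv_comp_baseParams (A := fun q => fderiv ℂ h q (v.2, 0)) ah.differentiableAt _
  have eaσ : fderiv ℂ (fun q : DoubledSpace s r => fderiv ℂ σ (q.1.2, q.2.2) (v.2, 0)) p (0, u)
      = fderiv ℂ (fun q => fderiv ℂ σ q (v.2, 0)) (p.1.2, p.2.2) (0, u.2) :=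
    fderiv_comp_baseParams (A := fun q => fderiv ℂ σ q (v.2, 0)) aσ.differentiableAt _
  have eaτ : fderiv ℂ (fun q : DoubledSpace s r => fderiv ℂ τ (q.1.2, q.2.2) (v.2, 0)) p (0, u)
      = fderiv ℂ (fun q => fderiv ℂ τ q (v.2, 0)) (p.1.2, p.2.2) (0, u.2) :=
    fderiv_comp_baseParams (A := fun q => fderiv ℂ τ q (v.2, 0)) aτ.differentiableAt _
  rw [f']
  simp only [_root_.add_apply, _root_.smul_apply, smul_eq_mul]
  have g1 := fderiv_dotProduct_mulVec h1 (ah.comp_baseParams (p := p)).differentiableAt h2 (0, u)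
  have g2 := fderiv_dotProduct_mulVec hv (hh.comp_baseParams (p := p)).differentiableAt h2 (0, u)
  have g3 := fderiv_dotProduct_mulVec h2 (aσ.comp_baseParams (p := p)).differentiableAt h2 (0, u)
  have g4 := fderiv_dotProduct_mulVec h1 (aτ.comp_baseParams (p := p)).differentiableAt h1 (0, u)
  have g5 := fderiv_dotProduct_mulVec hv (hτ.comp_baseParams (p := p)).differentiableAt h1 (0, u)
  rw [g1, g2, g3, g4, g5, eh, eτ, eah, eaσ, eaτ, fderiv_fst_fst, fderiv_snd_fst]
  simp only [Prod.fst_zero, Matrix.mulVec_zero, dotProduct_zero, zero_dotProduct,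
    fderiv_fun_const, Pi.zero_apply, _root_.zero_apply, dotProduct_add]
  rw [dotProduct_mulVec_transpose (fderiv ℂ h _ _) p.1.1 u.1,
    dotProduct_mulVec_transpose (h _) v.1 u.1,
    dotProduct_mulVec_transpose (fderiv ℂ σ _ _) p.2.1 u.1,
    (isSymm_fderiv hσ hσs _).eq]
  ring

end ModelPolarization

/-! ### The Levi kernel of a model of rank s -/

section MinimalRank

open Complex
open scoped Matrix.Norms.Operator

variable {s r : ℕ} {H S : (Fin r → ℂ) → Matrix (Fin s) (Fin s) ℂ}
  {h σ τ : (Fin r → ℂ) × (Fin r → ℂ) → Matrix (Fin s) (Fin s) ℂ}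

/-- A point at which the complexified coefficients are regular. -/
structure IsRegularCoefficientPoint
    (h σ τ : (Fin r → ℂ) × (Fin r → ℂ) → Matrix (Fin s) (Fin s) ℂ)
    (p : (Fin r → ℂ) × (Fin r → ℂ)) : Prop where
  analytic_h : AnalyticAt ℂ h p
  analytic_σ : AnalyticAt ℂ σ p
  analytic_τ : AnalyticAt ℂ τ p
  σ_symm : ∀ᶠ q in 𝓝 p, (σ q).IsSymm
  τ_symm : ∀ᶠ q in 𝓝 p, (τ q).IsSymm
  unit : IsUnit (h p).det

namespace IsCoefficientComplexification

theorem isUnit_det_zero (hC : IsCoefficientComplexification H S h σ τ) (hH : IsUnit (H 0).det) :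
    IsUnit (h 0).det := by
  have h1 := hC.h_diagonal.self_of_nhds
  rw [star_zero] at h1
  rwa [← h1] at hH

theorem eventually_isRegular (hC : IsCoefficientComplexification H S h σ τ)
    (hH : IsUnit (H 0).det) : ∀ᶠ p in 𝓝 0, IsRegularCoefficientPoint h σ τ p := by
  filter_upwards [hC.analytic_h.eventually_analyticAt, hC.analytic_σ.eventually_analyticAt,
    hC.analytic_τ.eventually_analyticAt, hC.σ_symm.eventually_nhds, hC.τ_symm.eventually_nhds,
    eventually_isUnit_det hC.analytic_h.continuousAt (hC.isUnit_det_zero hH)] with p a b c d e f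
    using ⟨a, b, c, d, e, f⟩

theorem modelFunction_eq_polarization (hC : IsCoefficientComplexification H S h σ τ)
    (hH : ∀ᶠ ζ in 𝓝 0, (H ζ).IsHermitian) :
    ∀ᶠ x in 𝓝 (0 : (Fin s → ℂ) × (Fin r → ℂ)),
      (modelFunction H S x : ℂ) = modelPolarization h σ τ (x, star x) := by
  have hc : Filter.Tendsto (fun x : (Fin s → ℂ) × (Fin r → ℂ) => x.2) (𝓝 0) (𝓝 0) :=
    continuous_snd.tendsto' _ _ rfl
  filter_upwards [hc.eventually hC.h_diagonal, hc.eventually hC.σ_diagonal,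
    hc.eventually hC.τ_diagonal, hc.eventually hH] with x h1 h2 h3 h4
  have e1 : ((x.1 ⬝ᵥ (H x.2 *ᵥ star x.1)).re : ℂ) = x.1 ⬝ᵥ (H x.2 *ᵥ star x.1) := by
    rw [← conj_eq_iff_re]
    change star (_ : ℂ) = _
    rw [star_dotProduct_star', star_mulVec_conjMatrix, star_star, conjMatrix_of_isHermitian h4,
      ← dotProduct_mulVec_transpose]
  have e2 : ((star x.1 ⬝ᵥ (S x.2 *ᵥ star x.1)).re : ℂ)
      = 1 / 2 * (star x.1 ⬝ᵥ (S x.2 *ᵥ star x.1))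
        + 1 / 2 * (x.1 ⬝ᵥ (conjMatrix (S x.2) *ᵥ x.1)) := by
    rw [re_eq_add_conj]
    change (_ + star (_ : ℂ)) / 2 = _
    rw [star_dotProduct_star', star_mulVec_conjMatrix, star_star]
    ring
  rw [modelFunction, modelPolarization]
  simp only [Prod.fst_star, Prod.snd_star, h1, h2, h3]
  rw [ofReal_add, e1, e2]

end IsCoefficientComplexification

/-- The vector of the Levi kernel over `(z, ζ)` whose `ζ`-component is `η`. -/
noncomputable def kernelLift (h σ : (Fin r → ℂ) × (Fin r → ℂ) → Matrix (Fin s) (Fin s) ℂ)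
    (η : Fin r → ℂ) (x : (Fin s → ℂ) × (Fin r → ℂ)) : Fin s → ℂ :=
  -(((h (x.2, star x.2))⁻¹)ᵀ *ᵥ ((fderiv ℂ h (x.2, star x.2) (η, 0))ᵀ *ᵥ x.1
    + fderiv ℂ σ (x.2, star x.2) (η, 0) *ᵥ star x.1))

theorem kernelLift_zero (x : (Fin s → ℂ) × (Fin r → ℂ)) : kernelLift h σ 0 x = 0 := by
  have e1 : fderiv ℂ h (x.2, star x.2) (0, 0) = 0 := map_zero _
  have e2 : fderiv ℂ σ (x.2, star x.2) (0, 0) = 0 := map_zero _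
  rw [kernelLift, e1, e2]
  simp

theorem eq_neg_inv_mulVec {A : Matrix (Fin s) (Fin s) ℂ} (hA : IsUnit A.det) {u c : Fin s → ℂ}
    (h : Aᵀ *ᵥ u + c = 0) : u = -((A⁻¹)ᵀ *ᵥ c) := by
  have h1 : c = -(Aᵀ *ᵥ u) := (neg_eq_of_add_eq_zero_right h).symm
  rw [h1, Matrix.mulVec_neg, Matrix.mulVec_mulVec, ← Matrix.transpose_mul,
    Matrix.mul_nonsing_inv _ hA, Matrix.transpose_one, Matrix.one_mulVec, neg_neg]

/-- A subspace of dimension `r` that projects injectively to `ℂ^r` projects onto it. -/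
theorem exists_mem_of_finrank_eq {E : Type*} [AddCommGroup E] [Module ℂ E] [FiniteDimensional ℂ E]
    {K : Submodule ℂ E} (hK : Module.finrank ℂ K = r) (f : E →ₗ[ℂ] (Fin r → ℂ))
    (hf : ∀ v ∈ K, f v = 0 → v = 0) (η : Fin r → ℂ) : ∃ v ∈ K, f v = η := by
  have h1 : Function.Injective (f ∘ₗ K.subtype) := by
    rw [← LinearMap.ker_eq_bot, LinearMap.ker_eq_bot']
    intro v hv
    exact Subtype.ext (hf v v.2 hv)
  have h2 := (LinearMap.injective_iff_surjective_of_finrank_eq_finrank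
    (by rw [hK, Module.finrank_fin_fun])).mp h1
  obtain ⟨v, hv⟩ := h2 η
  exact ⟨v, v.2, hv⟩

/-- Invertibility of `h` determines the z-component of a kernel vector from its ζ-component. By the
rank hypothesis the kernel has dimension `r`, so it is a graph over the whole ζ-space and each
`kernelLift` belongs to it. -/
theorem IsTwoNondegenerateModel.eventually_kernelLift (hM : IsTwoNondegenerateModel H S)
    (hC : IsCoefficientComplexification H S h σ τ) :
    ∀ᶠ x in 𝓝 (0 : (Fin s → ℂ) × (Fin r → ℂ)), ∀ η u,
      leviForm (modelFunction H S) x (kernelLift h σ η x, η) u = 0 := by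
  have hP := hC.modelFunction_eq_polarization hM.hermitian
  have hreg := hC.eventually_isRegular hM.nondegenerate
  have hc : Filter.Tendsto (fun x : (Fin s → ℂ) × (Fin r → ℂ) => (x.2, star x.2)) (𝓝 0) (𝓝 0) :=
    (continuous_snd.prodMk (continuous_star.comp continuous_snd)).tendsto' _ _ (by simp)
  have hreg' := hc.eventually hreg
  have hcont : ∀ᶠ x in 𝓝 (0 : (Fin s → ℂ) × (Fin r → ℂ)),
      ContDiffAt ℝ ∞ (modelFunction H S) x := by
    filter_upwards [hP.eventually_nhds, hreg'] with x h1 h2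
    exact contDiffAt_of_polarization
      (analyticAt_modelPolarization h2.analytic_h h2.analytic_σ h2.analytic_τ) h1
  have ht : Filter.Tendsto (fun x : (Fin s → ℂ) × (Fin r → ℂ) => ((modelFunction H S x : ℂ), x))
      (𝓝 0) (𝓝 0) := by
    have h1 : ContinuousAt (fun x : (Fin s → ℂ) × (Fin r → ℂ) =>
        ((modelFunction H S x : ℂ), x)) 0 :=
      (continuous_ofReal.continuousAt.comp hcont.self_of_nhds.continuousAt).prodMk continuousAt_id
    have h2 : (((modelFunction H S 0 : ℝ) : ℂ), (0 : (Fin s → ℂ) × (Fin r → ℂ))) = 0 := by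
      simp [modelFunction]
    rw [← h2]
    exact h1
  filter_upwards [ht.eventually hM.levi_rank, hP.eventually_nhds, hreg', hcont.eventually_nhds]
    with x hrank hPx hregx hcx η
  -- The rank is known only at points of the hypersurface; this one lies over `x`.
  set q : ModelSpace s r := ((modelFunction H S x : ℂ), x) with hq
  have hq0 : graphFunction (modelFunction H S) q = 0 := by simp [graphFunction, hq]
  have hrank' := hrank hq0
  rw [modelDefiningFunction_eq] at hrank'
  have hK := mem_leviKernel_graph (q := q) hcx hq0
  have hT := mem_holTangent_graph (q := q) (hcx.self_of_nhds.differentiableAt (by simp))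
  have hΦ := analyticAt_modelPolarization (p := (x, star x)) hregx.analytic_h hregx.analytic_σ
    hregx.analytic_τ
  have hlift : ∀ v, v ∈ leviKernel (graphFunction (modelFunction H S)) q →
      v.2.1 = kernelLift h σ v.2.2 x := by
    intro v hv
    have h1 := (leviForm_eq_zero_iff_polarization hΦ hPx v.2).mp ((hK v).mp hv).2
    refine eq_neg_inv_mulVec hregx.unit ?_
    refine eq_zero_of_re_dotProduct fun u => ?_
    -- A test vector without ω-component isolates the linear equation for the z-component.
    have h2 := h1 (u, 0)
    rw [fderiv_fderiv_modelPolarization (p := (x, star x)) hregx.analytic_h hregx.analytic_σ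
      hregx.analytic_τ hregx.σ_symm hregx.τ_symm] at h2
    simp only [Prod.mk_zero_zero, map_zero, Matrix.zero_mulVec, dotProduct_zero, mul_zero,
      add_zero] at h2
    exact congrArg re h2
  have hfin : Module.finrank ℂ (leviKernel (graphFunction (modelFunction H S)) q) = r := by
    have h1 := finrank_holTangent (q := q) (hcx.self_of_nhds.differentiableAt (by simp))
    rw [Module.finrank_prod, Module.finrank_fin_fun, Module.finrank_fin_fun] at h1
    have h2 : Module.finrank ℂ (leviKernel (graphFunction (modelFunction H S)) q) + s
        = Module.finrank ℂ (holTangent (graphFunction (modelFunction H S)) q) := hrank'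
    omega
  obtain ⟨v, hv, hvη⟩ := exists_mem_of_finrank_eq hfin
    ((LinearMap.snd ℂ (Fin s → ℂ) (Fin r → ℂ)) ∘ₗ (LinearMap.snd ℂ ℂ _)) (fun v hv hv0 => by
      have h0 : v.2.2 = 0 := hv0
      have h1 := hlift v hv
      rw [h0] at h1
      have h2 : v.2 = 0 := Prod.ext (by
        rw [h1, kernelLift_zero]
        rfl) h0
      exact twiceDel_injOn_holTangent (hcx.self_of_nhds.differentiableAt (by simp))
        ((hK v).mp hv).1 (zero_mem _) h2) η
  have h3 : v.2 = (kernelLift h σ η x, η) := Prod.ext (by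
    rw [hlift v hv]
    exact congrArg (fun η => kernelLift h σ η x) hvη) hvη
  intro u
  rw [← h3]
  exact ((hK v).mp hv).2 u

end MinimalRank

/-! ### Vanishing of the Schur complement -/

section SchurComplement

open Complex
open scoped Matrix.Norms.Operator

variable {s r : ℕ} {H S : (Fin r → ℂ) → Matrix (Fin s) (Fin s) ℂ}
  {h σ τ : (Fin r → ℂ) × (Fin r → ℂ) → Matrix (Fin s) (Fin s) ℂ}

theorem AnalyticAt.clm_apply_clm {E F G : Type*} [NormedAddCommGroup E] [NormedSpace ℂ E]
    [NormedAddCommGroup F] [NormedSpace ℂ F] [NormedAddCommGroup G] [NormedSpace ℂ G]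
    {c : E → F →L[ℂ] G} {u : E → F} {p : E} (hc : AnalyticAt ℂ c p) (hu : AnalyticAt ℂ u p) :
    AnalyticAt ℂ (fun q => c q (u q)) p :=
  AnalyticAt.fun_comp (g := fun x : (F →L[ℂ] G) × F => x.1 x.2)
    ((ContinuousLinearMap.id ℂ (F →L[ℂ] G)).analyticAt_bilinear _) (hc.prod hu)

theorem fderiv_fderiv_apply_const {E W : Type*} [NormedAddCommGroup E] [NormedSpace ℂ E]
    [NormedAddCommGroup W] [NormedSpace ℂ W] [CompleteSpace W] {f : E → W} {p : E}
    (hf : AnalyticAt ℂ f p) (v u : E) :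
    fderiv ℂ (fun q => fderiv ℂ f q v) p u = fderiv ℂ (fderiv ℂ f) p u v := by
  rw [fderiv_clm_apply hf.fderiv.differentiableAt (differentiableAt_const _)]
  simp

/-- The Schur complement in the mixed second derivatives of the polarization, at the point
`((z, ζ), (y, w))` in the directions `η` (of `ζ`) and `ν` (of `w`). -/
noncomputable def schurComplement
    (h σ τ : (Fin r → ℂ) × (Fin r → ℂ) → Matrix (Fin s) (Fin s) ℂ)
    (P : (((Fin s → ℂ) × (Fin r → ℂ)) × (Fin r → ℂ))
      × (((Fin s → ℂ) × (Fin r → ℂ)) × (Fin r → ℂ))) : ℂ :=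
  -((((h (P.1.1.2, P.2.1.2))⁻¹)ᵀ *ᵥ ((fderiv ℂ h (P.1.1.2, P.2.1.2) (P.1.2, 0))ᵀ *ᵥ P.1.1.1
      + fderiv ℂ σ (P.1.1.2, P.2.1.2) (P.1.2, 0) *ᵥ P.2.1.1))
    ⬝ᵥ (fderiv ℂ h (P.1.1.2, P.2.1.2) (0, P.2.2) *ᵥ P.2.1.1
      + fderiv ℂ τ (P.1.1.2, P.2.1.2) (0, P.2.2) *ᵥ P.1.1.1))
  + (P.1.1.1 ⬝ᵥ (fderiv ℂ (fderiv ℂ h) (P.1.1.2, P.2.1.2) (0, P.2.2) (P.1.2, 0) *ᵥ P.2.1.1)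
    + (1 / 2 * (P.2.1.1 ⬝ᵥ
        (fderiv ℂ (fderiv ℂ σ) (P.1.1.2, P.2.1.2) (0, P.2.2) (P.1.2, 0) *ᵥ P.2.1.1))
      + 1 / 2 * (P.1.1.1 ⬝ᵥ
        (fderiv ℂ (fderiv ℂ τ) (P.1.1.2, P.2.1.2) (0, P.2.2) (P.1.2, 0) *ᵥ P.1.1.1))))

theorem analyticAt_schurComplement
    {P : (((Fin s → ℂ) × (Fin r → ℂ)) × (Fin r → ℂ))
      × (((Fin s → ℂ) × (Fin r → ℂ)) × (Fin r → ℂ))}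
    (hp : IsRegularCoefficientPoint h σ τ (P.1.1.2, P.2.1.2)) :
    AnalyticAt ℂ (schurComplement h σ τ) P := by
  let X := (((Fin s → ℂ) × (Fin r → ℂ)) × (Fin r → ℂ))
      × (((Fin s → ℂ) × (Fin r → ℂ)) × (Fin r → ℂ))
  have hz : AnalyticAt ℂ (fun P : X => P.1.1.1) P :=
    analyticAt_fst.fun_comp (analyticAt_fst.fun_comp analyticAt_fst)
  have hy : AnalyticAt ℂ (fun P : X => P.2.1.1) P :=
    analyticAt_fst.fun_comp (analyticAt_fst.fun_comp analyticAt_snd)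
  have hb : AnalyticAt ℂ (fun P : X => (P.1.1.2, P.2.1.2)) P :=
    (analyticAt_snd.fun_comp (analyticAt_fst.fun_comp analyticAt_fst)).prod
      (analyticAt_snd.fun_comp (analyticAt_fst.fun_comp analyticAt_snd))
  have hη : AnalyticAt ℂ (fun P : X => (P.1.2, (0 : Fin r → ℂ))) P :=
    (analyticAt_snd.fun_comp analyticAt_fst).prod analyticAt_const
  have hν : AnalyticAt ℂ (fun P : X => ((0 : Fin r → ℂ), P.2.2)) P :=
    analyticAt_const.prod (analyticAt_snd.fun_comp analyticAt_snd)
  have comp : ∀ {W : Type} [NormedAddCommGroup W] [NormedSpace ℂ W]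
      {f : (Fin r → ℂ) × (Fin r → ℂ) → W}, AnalyticAt ℂ f (P.1.1.2, P.2.1.2) →
      AnalyticAt ℂ (fun P : X => f (P.1.1.2, P.2.1.2)) P :=
    fun hf => AnalyticAt.fun_comp hf hb
  have one : ∀ {f : (Fin r → ℂ) × (Fin r → ℂ) → Matrix (Fin s) (Fin s) ℂ}
      {u : X → (Fin r → ℂ) × (Fin r → ℂ)}, AnalyticAt ℂ f (P.1.1.2, P.2.1.2) →
      AnalyticAt ℂ u P → AnalyticAt ℂ (fun P : X => fderiv ℂ f (P.1.1.2, P.2.1.2) (u P)) P :=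
    fun hf hu => (comp hf.fderiv).clm_apply_clm hu
  have two : ∀ {f : (Fin r → ℂ) × (Fin r → ℂ) → Matrix (Fin s) (Fin s) ℂ},
      AnalyticAt ℂ f (P.1.1.2, P.2.1.2) →
      AnalyticAt ℂ (fun P : X => fderiv ℂ (fderiv ℂ f) (P.1.1.2, P.2.1.2) (0, P.2.2) (P.1.2, 0)) P :=
    fun hf => ((comp hf.fderiv.fderiv).clm_apply_clm hν).clm_apply_clm hη
  exact (((comp (hp.analytic_h.matrix_inv hp.unit)).matrix_transpose.mulVec
    (((one hp.analytic_h hη).matrix_transpose.mulVec hz).add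
      ((one hp.analytic_σ hη).mulVec hy))).dotProduct
    (((one hp.analytic_h hν).mulVec hy).add ((one hp.analytic_τ hν).mulVec hz))).neg.add
    ((hz.dotProduct ((two hp.analytic_h).mulVec hy)).add
      ((analyticAt_const.mul (hy.dotProduct ((two hp.analytic_σ).mulVec hy))).add
        (analyticAt_const.mul (hz.dotProduct ((two hp.analytic_τ).mulVec hz)))))

/-- Pairing a lifted kernel vector with a pure ω-direction leaves exactly the Schur complement, so
it vanishes at conjugate arguments. The directions η and ν count as variables, so the identity
principle also frees ν from being the conjugate of η. -/
theorem IsTwoNondegenerateModel.eventually_schurComplement (hM : IsTwoNondegenerateModel H S)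
    (hC : IsCoefficientComplexification H S h σ τ) :
    ∀ᶠ P in 𝓝 0, schurComplement h σ τ P = 0 := by
  have hreg := hC.eventually_isRegular hM.nondegenerate
  refine eventually_eq_zero_of_diagonal ?_ ?_
  · have hc : Filter.Tendsto (fun P : (((Fin s → ℂ) × (Fin r → ℂ)) × (Fin r → ℂ))
        × (((Fin s → ℂ) × (Fin r → ℂ)) × (Fin r → ℂ)) => (P.1.1.2, P.2.1.2)) (𝓝 0) (𝓝 0) :=
      Continuous.tendsto' (by fun_prop) _ _ rfl
    filter_upwards [hc.eventually hreg] with P hP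
    exact (analyticAt_schurComplement hP).differentiableAt
  · have hc : Filter.Tendsto (fun x : (Fin s → ℂ) × (Fin r → ℂ) => (x.2, star x.2)) (𝓝 0) (𝓝 0) :=
      (continuous_snd.prodMk (continuous_star.comp continuous_snd)).tendsto' _ _ (by simp)
    have hf : Filter.Tendsto (fun X : ((Fin s → ℂ) × (Fin r → ℂ)) × (Fin r → ℂ) => X.1)
      (𝓝 0) (𝓝 0) := continuous_fst.tendsto' _ _ rfl
    have hev := ((hM.eventually_kernelLift hC).and ((hC.modelFunction_eq_polarization
      hM.hermitian).eventually_nhds.and (hc.eventually hreg)))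
    filter_upwards [hf.eventually hev] with X hX
    obtain ⟨h1, h2, hp⟩ := hX
    have hΦ := analyticAt_modelPolarization (p := (X.1, star X.1)) hp.analytic_h hp.analytic_σ
      hp.analytic_τ
    have h3 := (leviForm_eq_zero_iff_polarization hΦ h2 _).mp (h1 X.2) (0, star X.2)
    rw [fderiv_fderiv_modelPolarization (p := (X.1, star X.1)) hp.analytic_h hp.analytic_σ
      hp.analytic_τ hp.σ_symm hp.τ_symm, zero_dotProduct, zero_add, kernelLift,
      neg_dotProduct] at h3
    rw [← h3, schurComplement]
    have eh := fderiv_fderiv_apply_const hp.analytic_h (X.2, 0) (0, star X.2)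
    have eσ := fderiv_fderiv_apply_const hp.analytic_σ (X.2, 0) (0, star X.2)
    have eτ := fderiv_fderiv_apply_const hp.analytic_τ (X.2, 0) (0, star X.2)
    congr 1
    congr 1
    · exact congrArg (fun A => X.1.1 ⬝ᵥ (A *ᵥ star X.1.1)) eh.symm
    · congr 1
      · exact congrArg (fun A => 1 / 2 * (star X.1.1 ⬝ᵥ (A *ᵥ star X.1.1))) eσ.symm
      · exact congrArg (fun A => 1 / 2 * (X.1.1 ⬝ᵥ (A *ᵥ X.1.1))) eτ.symm

end SchurComplement

/-! ### The flat system satisfied by the coefficients -/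

section FlatEquations

open Complex
open scoped Matrix.Norms.Operator

variable {s r : ℕ} {H S : (Fin r → ℂ) → Matrix (Fin s) (Fin s) ℂ}
  {h σ τ : (Fin r → ℂ) × (Fin r → ℂ) → Matrix (Fin s) (Fin s) ℂ}

theorem eq_zero_of_forall_dotProduct {M : Matrix (Fin s) (Fin s) ℂ}
    (h : ∀ z y : Fin s → ℂ, z ⬝ᵥ (M *ᵥ y) = 0) : M = 0 := by
  ext i j
  simpa using h (Pi.single i 1) (Pi.single j 1)

theorem add_transpose_eq_zero {M : Matrix (Fin s) (Fin s) ℂ}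
    (h : ∀ z : Fin s → ℂ, z ⬝ᵥ (M *ᵥ z) = 0) : M + Mᵀ = 0 := by
  refine eq_zero_of_forall_dotProduct fun z y => ?_
  have h1 := h (z + y)
  rw [Matrix.mulVec_add, add_dotProduct, dotProduct_add, dotProduct_add, h, h,
    dotProduct_mulVec_transpose M y z] at h1
  rw [Matrix.add_mulVec, dotProduct_add]
  simpa using h1

/-- A quadratic polynomial in `(z, y)` that vanishes near `0` has vanishing coefficients. -/
theorem quadratic_coefficients_eq_zero {M N L : Matrix (Fin s) (Fin s) ℂ} {R : ℝ} (hR : 0 < R)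
    (h : ∀ z y : Fin s → ℂ, ‖z‖ < R → ‖y‖ < R →
      z ⬝ᵥ (M *ᵥ y) + (1 / 2 * (y ⬝ᵥ (N *ᵥ y)) + 1 / 2 * (z ⬝ᵥ (L *ᵥ z))) = 0) :
    M = 0 ∧ N + Nᵀ = 0 ∧ L + Lᵀ = 0 := by
  have h' : ∀ z y : Fin s → ℂ,
      z ⬝ᵥ (M *ᵥ y) + (1 / 2 * (y ⬝ᵥ (N *ᵥ y)) + 1 / 2 * (z ⬝ᵥ (L *ᵥ z))) = 0 := by
    -- The expression is homogeneous of degree 2, so arbitrary arguments may be scaled into the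
    -- ball; the `+ 1` below avoids division by zero.
    intro z y
    set t : ℝ := R / (‖z‖ + ‖y‖ + 1) with ht
    have hd : 0 < ‖z‖ + ‖y‖ + 1 := by positivity
    have htp : 0 < t := by positivity
    have hn : ∀ v : Fin s → ℂ, ‖v‖ < ‖z‖ + ‖y‖ + 1 → ‖(t : ℂ) • v‖ < R := by
      intro v hv
      rw [norm_smul, norm_real, Real.norm_of_nonneg htp.le, ht, div_mul_eq_mul_div,
        div_lt_iff₀ hd]
      exact mul_lt_mul_of_pos_left hv hR
    have h1 := h ((t : ℂ) • z) ((t : ℂ) • y) (hn z (by linarith [norm_nonneg y]))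
      (hn y (by linarith [norm_nonneg z]))
    simp only [Matrix.mulVec_smul, smul_dotProduct, dotProduct_smul, smul_eq_mul] at h1
    have ht0 : (t : ℂ) ≠ 0 := ofReal_ne_zero.mpr htp.ne'
    refine (mul_eq_zero.mp ?_).resolve_left (mul_ne_zero ht0 ht0)
    rw [← h1]
    ring
  have hL : ∀ z : Fin s → ℂ, z ⬝ᵥ (L *ᵥ z) = 0 := fun z => by simpa using h' z 0
  have hN : ∀ y : Fin s → ℂ, y ⬝ᵥ (N *ᵥ y) = 0 := fun y => by simpa using h' 0 y
  exact ⟨eq_zero_of_forall_dotProduct fun z y => by simpa [hL, hN] using h' z y,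
    add_transpose_eq_zero hN, add_transpose_eq_zero hL⟩

/-- Comparison of coefficients in `z` and `y`. The pure quadratic forms see only symmetric parts,
whence the symmetrized right-hand sides for `B` and `C`. -/
theorem matrix_equations_of_schurComplement {a hη hw ση τw A B C : Matrix (Fin s) (Fin s) ℂ}
    (hσs : ση.IsSymm) (hτs : τw.IsSymm) (hB : B.IsSymm) (hC : C.IsSymm) {R : ℝ} (hR : 0 < R)
    (h : ∀ z y : Fin s → ℂ, ‖z‖ < R → ‖y‖ < R →
      -((aᵀ *ᵥ (hηᵀ *ᵥ z + ση *ᵥ y)) ⬝ᵥ (hw *ᵥ y + τw *ᵥ z))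
        + (z ⬝ᵥ (A *ᵥ y) + (1 / 2 * (y ⬝ᵥ (B *ᵥ y)) + 1 / 2 * (z ⬝ᵥ (C *ᵥ z)))) = 0) :
    A = hη * a * hw + τw * aᵀ * ση ∧ B = ση * a * hw + hwᵀ * aᵀ * ση ∧
      C = hη * a * τw + τw * aᵀ * hηᵀ := by
  have key := quadratic_coefficients_eq_zero (M := A - (hη * a * hw + τw * aᵀ * ση))
    (N := B - (2 : ℂ) • (ση * a * hw)) (L := C - (2 : ℂ) • (hη * a * τw)) hR fun z y hz hy => by
      rw [← h z y hz hy, dotProduct_comm (aᵀ *ᵥ _), ← dotProduct_mulVec_transpose]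
      have e : y ⬝ᵥ (ση * a * τw) *ᵥ z = z ⬝ᵥ (τw * aᵀ * ση) *ᵥ y := by
        rw [dotProduct_mulVec_transpose, Matrix.transpose_mul, Matrix.transpose_mul, hσs.eq,
          hτs.eq, Matrix.mul_assoc]
      have e2 : ∀ v : Fin s → ℂ, (hηᵀ *ᵥ z) ⬝ᵥ v = z ⬝ᵥ (hη *ᵥ v) := fun v => by
        rw [dotProduct_comm, ← dotProduct_mulVec_transpose]
      have e3 : ∀ v : Fin s → ℂ, (ση *ᵥ y) ⬝ᵥ v = y ⬝ᵥ (ση *ᵥ v) := fun v => by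
        rw [dotProduct_comm, dotProduct_mulVec_transpose, hσs.eq]
      rw [add_dotProduct, e2, e3]
      simp only [Matrix.mulVec_add, dotProduct_add, Matrix.mulVec_mulVec, Matrix.sub_mulVec,
        dotProduct_sub, Matrix.add_mulVec, Matrix.smul_mulVec, dotProduct_smul, smul_eq_mul,
        ← Matrix.mul_assoc]
      rw [e]
      ring
  obtain ⟨k1, k2, k3⟩ := key
  refine ⟨sub_eq_zero.mp k1, ?_, ?_⟩
  · rw [Matrix.transpose_sub, Matrix.transpose_smul, Matrix.transpose_mul, Matrix.transpose_mul,
      hσs.eq, hB.eq] at k2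
    have h2 : (2 : ℂ) • B = (2 : ℂ) • (ση * a * hw + hwᵀ * aᵀ * ση) := by
      rw [← sub_eq_zero, ← k2, Matrix.mul_assoc hwᵀ]
      module
    exact smul_right_injective _ (two_ne_zero (α := ℂ)) h2
  · rw [Matrix.transpose_sub, Matrix.transpose_smul, Matrix.transpose_mul, Matrix.transpose_mul,
      hτs.eq, hC.eq] at k3
    have h2 : (2 : ℂ) • C = (2 : ℂ) • (hη * a * τw + τw * aᵀ * hηᵀ) := by
      rw [← sub_eq_zero, ← k3, Matrix.mul_assoc τw]
      module
    exact smul_right_injective _ (two_ne_zero (α := ℂ)) h2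

theorem isSymm_fderiv_fderiv {p : (Fin r → ℂ) × (Fin r → ℂ)} (hσ : AnalyticAt ℂ σ p)
    (hs : ∀ᶠ q in 𝓝 p, (σ q).IsSymm) (v u : (Fin r → ℂ) × (Fin r → ℂ)) :
    (fderiv ℂ (fderiv ℂ σ) p u v).IsSymm := by
  refine (congrArg Matrix.IsSymm (fderiv_fderiv_apply_const hσ v u)).mp
    (isSymm_fderiv (hσ.fderiv_apply_const v) ?_ u)
  filter_upwards [hσ.eventually_analyticAt, hs.eventually_nhds] with q h1 h2
  exact isSymm_fderiv h1 h2 v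

/-- The equation for the transpose of `h` is the transposed equation for `h`. The directions stay in
a small ball because they are arguments of the Schur complement, which is known to vanish only near
`0`. -/
theorem IsTwoNondegenerateModel.exists_isFlatSystem (hM : IsTwoNondegenerateModel H S)
    (hC : IsCoefficientComplexification H S h σ τ) :
    ∃ R > 0, IsFlatSystem h (fun p => (h p)ᵀ) σ τ (fun p => (h p)⁻¹) (fun p => ((h p)⁻¹)ᵀ) R := by
  obtain ⟨R₁, hR₁, hreg⟩ :=
    Metric.eventually_nhds_iff_ball.mp (hC.eventually_isRegular hM.nondegenerate)
  obtain ⟨R₂, hR₂, hschur⟩ :=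
    Metric.eventually_nhds_iff_ball.mp (hM.eventually_schurComplement hC)
  refine ⟨min R₁ R₂, lt_min hR₁ hR₂, ?_⟩
  have hreg' : ∀ p ∈ Metric.ball (0 : (Fin r → ℂ) × (Fin r → ℂ)) (min R₁ R₂),
      IsRegularCoefficientPoint h σ τ p :=
    fun p hp => hreg p (Metric.ball_subset_ball (min_le_left _ _) hp)
  have key : ∀ p ∈ Metric.ball (0 : (Fin r → ℂ) × (Fin r → ℂ)) (min R₁ R₂),
      ∀ η ∈ Metric.ball (0 : Fin r → ℂ) (min R₁ R₂), ∀ w ∈ Metric.ball (0 : Fin r → ℂ) (min R₁ R₂),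
      _ := fun p hp η hη w hw =>
    matrix_equations_of_schurComplement (a := (h p)⁻¹) (hη := fderiv ℂ h p (η, 0))
      (hw := fderiv ℂ h p (0, w)) (A := fderiv ℂ (fderiv ℂ h) p (0, w) (η, 0))
      (isSymm_fderiv (hreg' p hp).analytic_σ (hreg' p hp).σ_symm (η, 0))
      (isSymm_fderiv (hreg' p hp).analytic_τ (hreg' p hp).τ_symm (0, w))
      (isSymm_fderiv_fderiv (hreg' p hp).analytic_σ (hreg' p hp).σ_symm (η, 0) (0, w))
      (isSymm_fderiv_fderiv (hreg' p hp).analytic_τ (hreg' p hp).τ_symm (η, 0) (0, w))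
      hR₂ fun z y hz hy => by
        have hR := min_le_right R₁ R₂
        rw [mem_ball_zero_iff] at hp hη hw
        refine hschur (((z, p.1), η), ((y, p.2), w)) (mem_ball_zero_iff.mpr ?_)
        exact max_lt (max_lt (max_lt hz ((norm_fst_le p).trans_lt (hp.trans_le hR)))
          (hη.trans_le hR)) (max_lt (max_lt hy ((norm_snd_le p).trans_lt (hp.trans_le hR)))
          (hw.trans_le hR))
  have trans : ∀ p ∈ Metric.ball (0 : (Fin r → ℂ) × (Fin r → ℂ)) (min R₁ R₂), ∀ v,
      fderiv ℂ (fun p => (h p)ᵀ) p v = (fderiv ℂ h p v)ᵀ := fun p hp v =>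
    fderiv_matrix_transpose (hreg' p hp).analytic_h v
  exact
    { diff_h := fun p hp => (hreg' p hp).analytic_h.differentiableAt
      diff_k := fun p hp => (hreg' p hp).analytic_h.matrix_transpose.differentiableAt
      diff_σ := fun p hp => (hreg' p hp).analytic_σ.differentiableAt
      diff_τ := fun p hp => (hreg' p hp).analytic_τ.differentiableAt
      diff_hi := fun p hp =>
        ((hreg' p hp).analytic_h.matrix_inv (hreg' p hp).unit).differentiableAt
      diff_ki := fun p hp =>
        ((hreg' p hp).analytic_h.matrix_inv (hreg' p hp).unit).matrix_transpose.differentiableAt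
      diff_fderiv_h := fun p hp => (hreg' p hp).analytic_h.fderiv.differentiableAt
      diff_fderiv_k := fun p hp => (hreg' p hp).analytic_h.matrix_transpose.fderiv.differentiableAt
      diff_fderiv_σ := fun p hp => (hreg' p hp).analytic_σ.fderiv.differentiableAt
      diff_fderiv_τ := fun p hp => (hreg' p hp).analytic_τ.fderiv.differentiableAt
      hi_mul := fun p hp => Matrix.nonsing_inv_mul _ (hreg' p hp).unit
      mul_hi := fun p hp => Matrix.mul_nonsing_inv _ (hreg' p hp).unit
      ki_mul := fun p hp => by
        rw [← Matrix.transpose_mul, Matrix.mul_nonsing_inv _ (hreg' p hp).unit,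
          Matrix.transpose_one]
      mul_ki := fun p hp => by
        rw [← Matrix.transpose_mul, Matrix.nonsing_inv_mul _ (hreg' p hp).unit,
          Matrix.transpose_one]
      eq_h := fun p hp η hη w hw =>
        (fderiv_fderiv_apply_const (hreg' p hp).analytic_h (η, 0) (0, w)).trans
          (key p hp η hη w hw).1
      eq_k := fun p hp η hη w hw => by
        have e1 : (fun q => fderiv ℂ (fun p => (h p)ᵀ) q (η, 0)) =ᶠ[𝓝 p]
            fun q => (fderiv ℂ h q (η, 0))ᵀ := by
          filter_upwards [Metric.isOpen_ball.mem_nhds hp] with q hq using trans q hq _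
        have e2 := e1.fderiv_eq (𝕜 := ℂ)
        have e3 := fderiv_matrix_transpose
          ((hreg' p hp).analytic_h.fderiv_apply_const (η, 0)) (0, w)
        have e4 := fderiv_fderiv_apply_const (hreg' p hp).analytic_h (η, 0) (0, w)
        have e5 := (key p hp η hη w hw).1
        have e6 : (fderiv ℂ h p (η, 0) * (h p)⁻¹ * fderiv ℂ h p (0, w)
            + fderiv ℂ τ p (0, w) * ((h p)⁻¹)ᵀ * fderiv ℂ σ p (η, 0))ᵀ
            = (fderiv ℂ h p (0, w))ᵀ * ((h p)⁻¹)ᵀ * (fderiv ℂ h p (η, 0))ᵀ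
              + fderiv ℂ σ p (η, 0) * (h p)⁻¹ * fderiv ℂ τ p (0, w) := by
          rw [Matrix.transpose_add, Matrix.transpose_mul, Matrix.transpose_mul,
            Matrix.transpose_mul, Matrix.transpose_mul, Matrix.transpose_transpose,
            (isSymm_fderiv (hreg' p hp).analytic_σ (hreg' p hp).σ_symm (η, 0)).eq,
            (isSymm_fderiv (hreg' p hp).analytic_τ (hreg' p hp).τ_symm (0, w)).eq,
            ← Matrix.mul_assoc, ← Matrix.mul_assoc]
        exact (congrArg (fun L => L (0, w)) e2).trans (e3.trans
          ((congrArg Matrix.transpose (e4.trans e5)).trans (e6.trans (congrArg₂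
            (fun A B => A * ((h p)⁻¹)ᵀ * B + fderiv ℂ σ p (η, 0) * (h p)⁻¹ * fderiv ℂ τ p (0, w))
            (trans p hp (0, w)).symm (trans p hp (η, 0)).symm))))
      eq_σ := fun p hp η hη w hw =>
        ((fderiv_fderiv_apply_const (hreg' p hp).analytic_σ (η, 0) (0, w)).trans
          (key p hp η hη w hw).2.1).trans (congrArg
            (fun A => fderiv ℂ σ p (η, 0) * (h p)⁻¹ * fderiv ℂ h p (0, w)
              + A * ((h p)⁻¹)ᵀ * fderiv ℂ σ p (η, 0)) (trans p hp (0, w)).symm)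
      eq_τ := fun p hp η hη w hw =>
        ((fderiv_fderiv_apply_const (hreg' p hp).analytic_τ (η, 0) (0, w)).trans
          (key p hp η hη w hw).2.2).trans (congrArg
            (fun A => fderiv ℂ h p (η, 0) * (h p)⁻¹ * fderiv ℂ τ p (0, w)
              + fderiv ℂ τ p (0, w) * ((h p)⁻¹)ᵀ * A) (trans p hp (η, 0)).symm) }

end FlatEquations

/-! ### Consequence of 2-nondegeneracy at the origin -/

section Independence

open Complex
open scoped Matrix.Norms.Operator

variable {s r : ℕ} {H S : (Fin r → ℂ) → Matrix (Fin s) (Fin s) ℂ}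
  {h σ τ : (Fin r → ℂ) × (Fin r → ℂ) → Matrix (Fin s) (Fin s) ℂ}

theorem AnalyticAt.comp_diagonal_snd {W : Type*} [NormedAddCommGroup W] [NormedSpace ℂ W]
    {A : (Fin r → ℂ) × (Fin r → ℂ) → W} {x : (Fin s → ℂ) × (Fin r → ℂ)}
    (hA : AnalyticAt ℂ A (x.2, star x.2)) :
    AnalyticAt ℝ (fun x : (Fin s → ℂ) × (Fin r → ℂ) => A (x.2, star x.2)) x :=
  AnalyticAt.fun_comp (g := fun ζ : Fin r → ℂ => A (ζ, star ζ))
    (AnalyticAt.fun_comp (g := A) (hA.restrictScalars (𝕜 := ℝ)) (analyticAt_diagonal x.2))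
    analyticAt_snd

theorem IsRegularCoefficientPoint.zero_diagonal (hp : IsRegularCoefficientPoint h σ τ 0) :
    IsRegularCoefficientPoint h σ τ
      ((0 : (Fin s → ℂ) × (Fin r → ℂ)).2, star (0 : (Fin s → ℂ) × (Fin r → ℂ)).2) := by
  have : ((0 : (Fin s → ℂ) × (Fin r → ℂ)).2, star (0 : (Fin s → ℂ) × (Fin r → ℂ)).2) = 0 := by
    simp
  rwa [this]

theorem analyticAt_kernelLift (hp : IsRegularCoefficientPoint h σ τ 0) (c : Fin r → ℂ) :
    AnalyticAt ℝ (kernelLift h σ c) (0 : (Fin s → ℂ) × (Fin r → ℂ)) := by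
  have hp' := hp.zero_diagonal
  have hi := (hp'.analytic_h.matrix_inv hp'.unit).matrix_transpose.comp_diagonal_snd
  have hc := (hp'.analytic_h.fderiv_apply_const (c, 0)).matrix_transpose.comp_diagonal_snd
  have hσ := (hp'.analytic_σ.fderiv_apply_const (c, 0)).comp_diagonal_snd
  exact (hi.mulVec ((hc.mulVec analyticAt_fst).add
    (hσ.mulVec (analyticAt_star_vec analyticAt_fst)))).neg

/-- At the origin z = 0, so derivatives of the coefficients drop out, and the term linear in z is
killed by ∂̄. Only the coefficient of conj z could contribute, and `hc0` says that it vanishes. -/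
theorem twiceDbar_kernelLift (hp : IsRegularCoefficientPoint h σ τ 0) {c : Fin r → ℂ}
    (hc0 : fderiv ℂ σ 0 (c, 0) = 0) (v : (Fin s → ℂ) × (Fin r → ℂ)) :
    twiceDbar (kernelLift h σ c) 0 v = 0 := by
  have hp' := hp.zero_diagonal
  have hi : AnalyticAt ℝ (fun x : (Fin s → ℂ) × (Fin r → ℂ) => -((h (x.2, star x.2))⁻¹)ᵀ) 0 :=
    (hp'.analytic_h.matrix_inv hp'.unit).matrix_transpose.comp_diagonal_snd.neg
  have hc : AnalyticAt ℝ (fun x : (Fin s → ℂ) × (Fin r → ℂ) =>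
      (fderiv ℂ h (x.2, star x.2) (c, 0))ᵀ) 0 :=
    (hp'.analytic_h.fderiv_apply_const (c, 0)).matrix_transpose.comp_diagonal_snd
  have hσ : AnalyticAt ℝ (fun x : (Fin s → ℂ) × (Fin r → ℂ) =>
      fderiv ℂ σ (x.2, star x.2) (c, 0)) 0 :=
    (hp'.analytic_σ.fderiv_apply_const (c, 0)).comp_diagonal_snd
  have hz : DifferentiableAt ℝ (fun x : (Fin s → ℂ) × (Fin r → ℂ) => x.1) 0 := differentiableAt_fst
  have hz' : DifferentiableAt ℝ (fun x : (Fin s → ℂ) × (Fin r → ℂ) => star x.1) 0 :=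
    (analyticAt_star_vec analyticAt_fst).differentiableAt
  have e : kernelLift h σ c = fun x : (Fin s → ℂ) × (Fin r → ℂ) =>
      (-((h (x.2, star x.2))⁻¹)ᵀ) *ᵥ ((fderiv ℂ h (x.2, star x.2) (c, 0))ᵀ *ᵥ x.1
        + fderiv ℂ σ (x.2, star x.2) (c, 0) *ᵥ star x.1) :=
    funext fun x => (Matrix.neg_mulVec _ _).symm
  have h0 : fderiv ℂ σ ((0 : (Fin s → ℂ) × (Fin r → ℂ)).2,
      star (0 : (Fin s → ℂ) × (Fin r → ℂ)).2) (c, 0) = 0 := by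
    have : ((0 : (Fin s → ℂ) × (Fin r → ℂ)).2, star (0 : (Fin s → ℂ) × (Fin r → ℂ)).2) = 0 := by
      simp
    rw [this]
    exact hc0
  have d1 := twiceDbar_mulVec hc.differentiableAt hz v
  have d2 := twiceDbar_mulVec hσ.differentiableAt hz' v
  have d0 : twiceDbar (fun x : (Fin s → ℂ) × (Fin r → ℂ) => x.1) 0 v = 0 :=
    twiceDbar_eq_zero differentiableAt_fst v
  have d := twiceDbar_mulVec hi.differentiableAt
    ((hc.differentiableAt.mulVec hz).fun_add (hσ.differentiableAt.mulVec hz')) v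
  rw [e, d, twiceDbar_add (hc.differentiableAt.mulVec hz) (hσ.differentiableAt.mulVec hz'), d1, d2,
    d0, h0]
  simp

/-- The `ζ`-derivatives of `S` at `0` are linearly independent. -/
theorem IsTwoNondegenerateModel.eq_zero_of_fderiv_eq_zero (hM : IsTwoNondegenerateModel H S)
    (hC : IsCoefficientComplexification H S h σ τ) {c : Fin r → ℂ}
    (hc : fderiv ℂ σ 0 (c, 0) = 0) : c = 0 := by
  have hreg := hC.eventually_isRegular hM.nondegenerate
  have hp := hreg.self_of_nhds
  have hP := hC.modelFunction_eq_polarization hM.hermitian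
  have hp' := hp.zero_diagonal
  have hF : ∀ᶠ x in 𝓝 (0 : (Fin s → ℂ) × (Fin r → ℂ)), ContDiffAt ℝ ∞ (modelFunction H S) x := by
    have hd : Filter.Tendsto (fun x : (Fin s → ℂ) × (Fin r → ℂ) => (x.2, star x.2)) (𝓝 0) (𝓝 0) :=
      (continuous_snd.prodMk (continuous_star.comp continuous_snd)).tendsto' _ _ (by simp)
    filter_upwards [hP.eventually_nhds, hd.eventually hreg] with x h1 h2
    exact contDiffAt_of_polarization
      (analyticAt_modelPolarization h2.analytic_h h2.analytic_σ h2.analytic_τ) h1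
  have hq : graphFunction (modelFunction H S) (0 : ModelSpace s r) = 0 := by
    simp [graphFunction, modelFunction]
  -- This lifts to a section of the Levi kernel with constant ζ-component `c`. The ∂̄-derivatives of
  -- its (z, ζ)-component vanish at `0`, so its value there lies in K₃ = 0.
  let v : (Fin s → ℂ) × (Fin r → ℂ) → (Fin s → ℂ) × (Fin r → ℂ) :=
    fun x => (kernelLift h σ c x, c)
  let X : ModelSpace s r → ModelSpace s r :=
    fun q => (twiceDel (modelFunction H S) q.2 (v q.2), v q.2)
  have hv : AnalyticAt ℝ v 0 := (analyticAt_kernelLift hp c).prod analyticAt_const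
  have hXT := isLocalSection_lift (q := (0 : ModelSpace s r)) hF (e := v)
    (hv.eventually_analyticAt.mono fun x hx => hx.contDiffAt)
  have hXK : IsLocalSection (graphFunction (modelFunction H S))
      (leviKernel (graphFunction (modelFunction H S))) 0 X := by
    refine ⟨hXT.1, ?_⟩
    have h2 : Filter.Tendsto (fun q : ModelSpace s r => q.2) (𝓝 0) (𝓝 0) :=
      continuous_snd.tendsto' _ _ rfl
    filter_upwards [h2.eventually (hM.eventually_kernelLift hC), hXT.2,
      h2.eventually hF.eventually_nhds] with q h3 h4 h5 hq0
    exact (mem_leviKernel_graph h5 hq0 _).mpr ⟨h4 hq0, h3 c⟩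
  have hX0 : X 0 ∈ secondLeviKernel (graphFunction (modelFunction H S)) 0 := by
    refine (mem_secondLeviKernel_graph hF hq _).mpr ⟨X, hXK, rfl, fun y _ u => ?_⟩
    have hXd := hXK.differentiableAt
    have e1 : (twiceDbar X 0 y).2 = twiceDbar (fun q : ModelSpace s r => v q.2) 0 y := by
      have : HasFDerivAt (fun q : ModelSpace s r => v q.2) _ 0 := hXd.hasFDerivAt.snd
      rw [twiceDbar, twiceDbar, this.fderiv]
      rfl
    have e2 : twiceDbar (fun q : ModelSpace s r => v q.2) 0 y = twiceDbar v 0 y.2 := by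
      have hd : DifferentiableAt ℝ v (0 : ModelSpace s r).2 := hv.differentiableAt
      rw [twiceDbar, fderiv_comp_snd_real hd, fderiv_comp_snd_real hd]
      rfl
    have e3 : twiceDbar v 0 y.2 = 0 := by
      have hk := (analyticAt_kernelLift hp c).differentiableAt
      have h3 : HasFDerivAt v _ 0 := hk.hasFDerivAt.prodMk (hasFDerivAt_const c _)
      have h4 := twiceDbar_kernelLift hp hc y.2
      rw [twiceDbar] at h4 ⊢
      rw [h3.fderiv]
      refine Prod.ext h4 ?_
      simp
    rw [e1, e2, e3]
    simp [leviForm]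
  have h1 := (hM.two_nondegenerate.self_of_nhds hq).2
  have h2 : X 0 ∈ (⊥ : Submodule ℂ (ModelSpace s r)) := h1 ▸ hX0
  exact congrArg (fun q : ModelSpace s r => q.2.2) ((Submodule.mem_bot ℂ).mp h2)

end Independence

/-! ### Normal form of the defining function -/

section NormalForm

open Complex
open scoped Matrix.Norms.Operator

variable {s r : ℕ} {H S : (Fin r → ℂ) → Matrix (Fin s) (Fin s) ℂ}
  {h σ τ : (Fin r → ℂ) × (Fin r → ℂ) → Matrix (Fin s) (Fin s) ℂ}

/-- The symmetric matrix of holomorphic functions of the normal form. -/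
noncomputable def normalizedS (H₀ : Matrix (Fin s) (Fin s) ℂ)
    (σ : (Fin r → ℂ) × (Fin r → ℂ) → Matrix (Fin s) (Fin s) ℂ) (ζ : Fin r → ℂ) :
    Matrix (Fin s) (Fin s) ℂ :=
  (H₀⁻¹)ᵀ * (σ (ζ, 0) - σ 0) * H₀⁻¹

theorem tendsto_prodMk_zero :
    Filter.Tendsto (fun ζ : Fin r → ℂ => (ζ, (0 : Fin r → ℂ))) (𝓝 0) (𝓝 0) :=
  Continuous.tendsto' (by fun_prop) _ _ rfl

theorem AnalyticAt.comp_prodMk_zero {A : (Fin r → ℂ) × (Fin r → ℂ) → Matrix (Fin s) (Fin s) ℂ}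
    {ζ : Fin r → ℂ} (hA : AnalyticAt ℂ A (ζ, 0)) : AnalyticAt ℂ (fun ζ => A (ζ, 0)) ζ :=
  AnalyticAt.fun_comp (g := A) hA (analyticAt_id.prod analyticAt_const)

theorem IsTwoNondegenerateModel.isHermitian_zero (hM : IsTwoNondegenerateModel H S) :
    (H 0).IsHermitian := hM.hermitian.self_of_nhds

/-- Congruence by `(H 0)⁻¹` is injective, so a vanishing derivative of `normalizedS` at `0` means a
vanishing ζ-derivative of `σ`, excluded by `eq_zero_of_fderiv_eq_zero`. -/
theorem IsTwoNondegenerateModel.isModelData_normalizedS (hM : IsTwoNondegenerateModel H S)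
    (hC : IsCoefficientComplexification H S h σ τ) : IsModelData (H 0) (normalizedS (H 0) σ) := by
  have hU := hM.nondegenerate
  have hσ0 : AnalyticAt ℂ (fun ζ => σ (ζ, 0)) 0 := hC.analytic_σ.comp_prodMk_zero
  have hS0 : AnalyticAt ℂ (normalizedS (H 0) σ) 0 :=
    (analyticAt_const.mul (hσ0.sub analyticAt_const)).mul analyticAt_const
  refine ⟨hM.isHermitian_zero, hU, analyticAt_matrix_iff.mp hS0, ?_, ?_, ?_⟩
  · filter_upwards [tendsto_prodMk_zero.eventually hC.σ_symm] with ζ hζ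
    have h0 := hC.σ_symm.self_of_nhds
    rw [Matrix.IsSymm, normalizedS, Matrix.transpose_mul, Matrix.transpose_mul,
      Matrix.transpose_sub, hζ.eq, h0.eq, Matrix.transpose_transpose, Matrix.mul_assoc]
  · rw [normalizedS, Prod.mk_zero_zero, sub_self]
    simp
  · have e : (fun α : Fin r => fderiv ℂ (normalizedS (H 0) σ) 0 (Pi.single α 1)) = fun α : Fin r =>
        (Matrix.of fun i j => fderiv ℂ (fun ζ => normalizedS (H 0) σ ζ i j) 0 (Pi.single α 1) :
          Matrix (Fin s) (Fin s) ℂ) := by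
      funext α
      ext i j
      rw [Matrix.of_apply, fderiv_matrix_entry hS0.differentiableAt]
    rw [← e]
    refine (fderiv_injective_iff _).mp fun c hc => hM.eq_zero_of_fderiv_eq_zero hC ?_
    have e1 : ∀ ζ, σ (ζ, 0) = (H 0)ᵀ * normalizedS (H 0) σ ζ * H 0 + σ 0 := by
      intro ζ
      have h1 : (H 0)ᵀ * ((H 0)⁻¹)ᵀ = 1 := by
        rw [← Matrix.transpose_mul, Matrix.nonsing_inv_mul _ hU, Matrix.transpose_one]
      rw [normalizedS, ← Matrix.mul_assoc, ← Matrix.mul_assoc, h1, Matrix.one_mul,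
        Matrix.mul_assoc, Matrix.nonsing_inv_mul _ hU, Matrix.mul_one, sub_add_cancel]
    have e2 : fderiv ℂ (fun ζ => σ (ζ, 0)) 0 c = fderiv ℂ σ 0 (c, 0) := by
      have hd : DifferentiableAt ℂ σ ((0 : Fin r → ℂ), (0 : Fin r → ℂ)) :=
        hC.analytic_σ.differentiableAt
      have h1 : HasFDerivAt (fun ζ : Fin r → ℂ => σ (ζ, 0)) _ 0 :=
        HasFDerivAt.comp (g := σ) (f := fun ζ : Fin r → ℂ => (ζ, (0 : Fin r → ℂ))) 0
          hd.hasFDerivAt ((hasFDerivAt_id 0).prodMk (hasFDerivAt_const 0 0))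
      rw [h1.fderiv]
      rfl
    have e3 : fderiv ℂ (fun ζ => (H 0)ᵀ * normalizedS (H 0) σ ζ * H 0 + σ 0) 0 c
        = (H 0)ᵀ * fderiv ℂ (normalizedS (H 0) σ) 0 c * H 0 := by
      have h1 : HasFDerivAt (fun ζ => (H 0)ᵀ * normalizedS (H 0) σ ζ * H 0 + σ 0) _ 0 :=
        ((ContinuousLinearMap.mulLeftRight ℂ (Matrix (Fin s) (Fin s) ℂ) (H 0)ᵀ
          (H 0)).hasFDerivAt.comp 0 hS0.differentiableAt.hasFDerivAt).add_const (σ 0)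
      rw [h1.fderiv]
      rfl
    rw [← e2, funext e1]
    refine e3.trans ?_
    rw [hc]
    simp

/-- Here `ha` and `t` stand for h and τ at (ζ, conj ζ), `a`, `g`, `b` for h, τ, σ at (ζ, 0), `a'`
for h at (0, conj ζ), `b₀` for σ(0), and `x` for τ(0, conj ζ) - τ(0). `h1` and `h2` are the two
constancy relations of `IsFlatSystem.eq_const`, which are solved for `ha` and `t`. -/
theorem normal_form_algebra {H₀ a b b₀ g t x P ha : Matrix (Fin s) (Fin s) ℂ}
    {a' : Matrix (Fin s) (Fin s) ℂ} (ua : IsUnit a.det) (ua' : IsUnit a'.det)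
    (uh : IsUnit ha.det)
    (h1 : ha⁻¹ * (t - g) * (a⁻¹)ᵀ = a'⁻¹ * x * (H₀⁻¹)ᵀ)
    (h2 : ha⁻¹ * a + ha⁻¹ * (t - g) * (a⁻¹)ᵀ * b = a'⁻¹ * H₀ + a'⁻¹ * x * (H₀⁻¹)ᵀ * b₀)
    (hP : P = H₀ - x * (H₀⁻¹)ᵀ * (b - b₀)) :
    IsUnit P.det ∧ ha = a * P⁻¹ * a' ∧ t = g + a * P⁻¹ * x * (H₀⁻¹)ᵀ * aᵀ := by
  have e1 : ha⁻¹ * a = a'⁻¹ * P := by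
    rw [h1] at h2
    rw [hP, eq_sub_of_add_eq h2]
    noncomm_ring
  -- This shows at once that `P` is invertible and that `ha` factors through its inverse.
  have e2 : P = a' * ha⁻¹ * a := by
    rw [Matrix.mul_assoc, e1, ← Matrix.mul_assoc, Matrix.mul_nonsing_inv _ ua', Matrix.one_mul]
  have uhi : IsUnit (ha⁻¹).det := by
    rw [Matrix.det_nonsing_inv]
    exact uh.ringInverse
  have uP : IsUnit P.det := by
    rw [e2, Matrix.det_mul, Matrix.det_mul]
    exact (ua'.mul uhi).mul ua
  have e3 : ha = a * P⁻¹ * a' := by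
    rw [e2, Matrix.mul_inv_rev, Matrix.mul_inv_rev, Matrix.nonsing_inv_nonsing_inv _ uh,
      ← Matrix.mul_assoc, ← Matrix.mul_assoc, Matrix.mul_nonsing_inv _ ua, Matrix.one_mul,
      Matrix.mul_assoc, Matrix.nonsing_inv_mul _ ua', Matrix.mul_one]
  refine ⟨uP, e3, ?_⟩
  have e4 : (a⁻¹)ᵀ * aᵀ = 1 := by
    rw [← Matrix.transpose_mul, Matrix.mul_nonsing_inv _ ua, Matrix.transpose_one]
  have e5 : t - g = ha * (ha⁻¹ * (t - g) * (a⁻¹)ᵀ) * aᵀ := by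
    rw [Matrix.mul_assoc ha, Matrix.mul_assoc _ _ aᵀ, e4, Matrix.mul_one, ← Matrix.mul_assoc,
      Matrix.mul_nonsing_inv _ uh, Matrix.one_mul]
  rw [← sub_eq_iff_eq_add', e5, h1, e3]
  have e6 : a * P⁻¹ * a' * (a'⁻¹ * x * (H₀⁻¹)ᵀ) * aᵀ
      = a * P⁻¹ * (a' * a'⁻¹) * x * (H₀⁻¹)ᵀ * aᵀ := by noncomm_ring
  rw [e6, Matrix.mul_nonsing_inv _ ua', Matrix.mul_one]

/-- The outer factor h(ζ, 0) is absorbed into the new coordinate Z, and h(0, conj ζ) goes into its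
conjugate by `h_conj`. The pivot of the normalized data is H₀⁻¹P, so the remaining middle factor is
the one of the explicit model. -/
theorem IsTwoNondegenerateModel.eventually_modelFunction_eq (hM : IsTwoNondegenerateModel H S)
    (hC : IsCoefficientComplexification H S h σ τ) :
    ∀ᶠ ζ in 𝓝 0, ∀ z, modelFunction H S (z, ζ) = (z ⬝ᵥ (τ (ζ, 0) *ᵥ z)).re
      + modelFunction (explicitH (H 0) (normalizedS (H 0) σ)) (explicitS (H 0) (normalizedS (H 0) σ))
        ((((H 0)⁻¹)ᵀ * (h (ζ, 0))ᵀ) *ᵥ z, ζ) := by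
  have hU := hM.nondegenerate
  have hH := hM.isHermitian_zero
  have hreg := hC.eventually_isRegular hU
  obtain ⟨R, hR, hflat⟩ := hM.exists_isFlatSystem hC
  have h0 : h 0 = H 0 := by
    have := hC.h_diagonal.self_of_nhds
    rwa [star_zero] at this
  have td : Filter.Tendsto (fun ζ : Fin r → ℂ => (ζ, star ζ)) (𝓝 0) (𝓝 0) :=
    continuous_diagonal.tendsto' _ _ (by simp)
  have ts : Filter.Tendsto (fun ζ : Fin r → ℂ => ((0 : Fin r → ℂ), star ζ)) (𝓝 0) (𝓝 0) :=
    (Continuous.prodMk continuous_const continuous_star).tendsto' _ _ (by simp)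
  have τ0 : τ (0, 0) = conjMatrix (σ 0) := by
    have := hC.τ_conj.self_of_nhds
    rwa [star_zero] at this
  filter_upwards [hC.h_diagonal, hC.τ_diagonal, hC.h_conj, hC.τ_conj,
    td.eventually (Metric.ball_mem_nhds 0 hR), td.eventually hreg, ts.eventually hreg,
    tendsto_prodMk_zero.eventually hreg] with ζ hh hτ hhc hτc hball hp hp' hp₀ z
  obtain ⟨q1, q2⟩ := hflat.eq_const hball
  have e0 : h (0, 0) = H 0 := h0
  simp only [e0] at q1 q2
  set x := τ (0, star ζ) - τ (0, 0) with hx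
  set y := σ (ζ, 0) - σ 0 with hy
  obtain ⟨uP, f1, f2⟩ := normal_form_algebra (P := H 0 - x * ((H 0)⁻¹)ᵀ * y) hp₀.unit hp'.unit
    hp.unit q1 q2 rfl
  set P := H 0 - x * ((H 0)⁻¹)ᵀ * y with hPdef
  clear_value x y P
  have hcH : conjMatrix ((H 0)⁻¹)ᵀ = (H 0)⁻¹ := by
    rw [conjMatrix_transpose, conjMatrix_inv, conjMatrix_of_isHermitian hH,
      ← Matrix.transpose_nonsing_inv, Matrix.transpose_transpose]
  have hB : normalizedS (H 0) σ ζ * H 0 = ((H 0)⁻¹)ᵀ * y := by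
    rw [normalizedS, Matrix.mul_assoc, Matrix.nonsing_inv_mul _ hU, Matrix.mul_one, hy]
  have hBc : conjMatrix (normalizedS (H 0) σ ζ * H 0) = (H 0)⁻¹ * x := by
    rw [hB, conjMatrix_mul, hcH, hx, hτc, τ0, hy, conjMatrix_sub]
  have hpiv : pivot (H 0) (normalizedS (H 0) σ) ζ = (H 0)⁻¹ * P := by
    rw [pivot, hBc, hB, hPdef, Matrix.mul_sub, Matrix.nonsing_inv_mul _ hU]
    noncomm_ring
  set Z := (((H 0)⁻¹)ᵀ * (h (ζ, 0))ᵀ) *ᵥ z with hZ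
  clear_value Z
  have hHZ : (H 0)ᵀ *ᵥ Z = (h (ζ, 0))ᵀ *ᵥ z := by
    rw [hZ, Matrix.mulVec_mulVec, ← Matrix.mul_assoc, ← Matrix.transpose_mul,
      Matrix.nonsing_inv_mul _ hU, Matrix.transpose_one, Matrix.one_mul]
  have hHZc : H 0 *ᵥ star Z = h (0, star ζ) *ᵥ star z := by
    have h1 := congrArg star hHZ
    rw [star_mulVec_conjMatrix, star_mulVec_conjMatrix, conjMatrix_transpose,
      conjMatrix_of_isHermitian hH, Matrix.transpose_transpose, ← hhc] at h1
    exact h1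
  have hleaf : leafParam (H 0) (normalizedS (H 0) σ) (Z, ζ)
      = P⁻¹ *ᵥ (h (0, star ζ) *ᵥ star z + x *ᵥ Z) := by
    rw [leafParam, hBc, hpiv, Matrix.mul_inv_rev, Matrix.nonsing_inv_nonsing_inv _ hU,
      ← hHZc, ← Matrix.mulVec_mulVec, Matrix.mulVec_add, Matrix.mulVec_mulVec _ (H 0),
      ← Matrix.mul_assoc, Matrix.mul_nonsing_inv _ hU, Matrix.one_mul]
  -- The part of the leaf parameter containing conj z reproduces h(ζ, conj ζ); the part containing Z
  -- reproduces the increment of τ.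
  have hmain : Z ⬝ᵥ (H 0 *ᵥ leafParam (H 0) (normalizedS (H 0) σ) (Z, ζ))
      = z ⬝ᵥ (h (ζ, star ζ) *ᵥ star z) + z ⬝ᵥ ((τ (ζ, star ζ) - τ (ζ, 0)) *ᵥ z) := by
    have f3 : τ (ζ, star ζ) - τ (ζ, 0)
        = h (ζ, 0) * P⁻¹ * x * (((H 0)⁻¹)ᵀ * (h (ζ, 0))ᵀ) := by
      rw [f2, add_sub_cancel_left, Matrix.mul_assoc _ _ (h (ζ, 0))ᵀ]
    rw [hleaf, dotProduct_mulVec_transpose, hHZ, dotProduct_comm, dotProduct_comm,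
      ← dotProduct_mulVec_transpose, f1, f3, Matrix.mulVec_add, Matrix.mulVec_add, dotProduct_add]
    simp only [hZ, Matrix.mulVec_mulVec, Matrix.mul_assoc]
  have hS : (star z ⬝ᵥ (S ζ *ᵥ star z)).re = (z ⬝ᵥ (τ (ζ, star ζ) *ᵥ z)).re := by
    rw [hτ, ← conj_re]
    change (star (_ : ℂ)).re = _
    rw [star_dotProduct_star', star_mulVec_conjMatrix, star_star]
  rw [modelFunction_explicit hH hU, hmain, modelFunction, hS, ← hh, Matrix.sub_mulVec,
    dotProduct_sub, add_re, sub_re]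
  ring

end NormalForm

/-! ### The fibred change of coordinates -/

section LocalEquivalence

open scoped Matrix.Norms.Operator

variable {s r : ℕ}

/-- The map `(w, z, ζ) ↦ (w - zᵀ g(ζ) z, A(ζ) z, ζ)`. -/
noncomputable def fibredMap (A g : (Fin r → ℂ) → Matrix (Fin s) (Fin s) ℂ) (p : ModelSpace s r) :
    ModelSpace s r :=
  (p.1 - p.2.1 ⬝ᵥ (g p.2.2 *ᵥ p.2.1), A p.2.2 *ᵥ p.2.1, p.2.2)

variable {A B g k : (Fin r → ℂ) → Matrix (Fin s) (Fin s) ℂ}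

theorem analyticAt_fibredMap {p : ModelSpace s r} (hA : AnalyticAt ℂ A p.2.2)
    (hg : AnalyticAt ℂ g p.2.2) : AnalyticAt ℂ (fibredMap A g) p := by
  have e1 : AnalyticAt ℂ (fun p : ModelSpace s r => p.2) p := analyticAt_snd
  have e2 : AnalyticAt ℂ (fun p : ModelSpace s r => p.2.1) p := analyticAt_fst.fun_comp e1
  have e3 : AnalyticAt ℂ (fun p : ModelSpace s r => p.2.2) p := analyticAt_snd.fun_comp e1
  have eA : AnalyticAt ℂ (fun p : ModelSpace s r => A p.2.2) p :=
    AnalyticAt.fun_comp (g := A) (f := fun p : ModelSpace s r => p.2.2) hA e3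
  have eg : AnalyticAt ℂ (fun p : ModelSpace s r => g p.2.2) p :=
    AnalyticAt.fun_comp (g := g) (f := fun p : ModelSpace s r => p.2.2) hg e3
  exact (analyticAt_fst.sub (e2.dotProduct (eg.mulVec e2))).prod ((eA.mulVec e2).prod e3)

theorem fibredMap_fibredMap {p : ModelSpace s r} (hAB : B p.2.2 * A p.2.2 = 1)
    (hgk : g p.2.2 + (A p.2.2)ᵀ * k p.2.2 * A p.2.2 = 0) :
    fibredMap B k (fibredMap A g p) = p := by
  have h1 := congrArg (fun M => p.2.1 ⬝ᵥ (M *ᵥ p.2.1)) hgk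
  simp only [Matrix.add_mulVec, dotProduct_add, Matrix.zero_mulVec, dotProduct_zero] at h1
  have h2 : (A p.2.2 *ᵥ p.2.1) ⬝ᵥ (k p.2.2 *ᵥ (A p.2.2 *ᵥ p.2.1))
      = p.2.1 ⬝ᵥ (((A p.2.2)ᵀ * k p.2.2 * A p.2.2) *ᵥ p.2.1) := by
    rw [dotProduct_comm, dotProduct_mulVec_transpose, dotProduct_comm, Matrix.mulVec_mulVec,
      Matrix.mulVec_mulVec, Matrix.mul_assoc, dotProduct_comm]
  refine Prod.ext ?_ (Prod.ext ?_ rfl)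
  · simp only [fibredMap]
    rw [h2]
    linear_combination -h1
  · simp only [fibredMap]
    rw [Matrix.mulVec_mulVec, hAB, Matrix.one_mulVec]

/-- `fibredMap A g` as a biholomorphism over a set of `ζ` where `A` is invertible. -/
noncomputable def fibredEquiv (D : Set (Fin r → ℂ)) (hD : IsOpen D)
    (hA : ∀ ζ ∈ D, AnalyticAt ℂ A ζ) (hg : ∀ ζ ∈ D, AnalyticAt ℂ g ζ)
    (hu : ∀ ζ ∈ D, IsUnit (A ζ).det) :
    OpenPartialHomeomorph (ModelSpace s r) (ModelSpace s r) where
  toFun := fibredMap A g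
  -- The inverse is again fibred: the quadratic form is carried to the new coordinate and its sign
  -- reversed.
  invFun := fibredMap (fun ζ => (A ζ)⁻¹) fun ζ => -(((A ζ)⁻¹)ᵀ * g ζ * (A ζ)⁻¹)
  source := {p | p.2.2 ∈ D}
  target := {p | p.2.2 ∈ D}
  map_source' _ hp := hp
  map_target' _ hp := hp
  left_inv' p hp := by
    have hp' := hu p.2.2 hp
    refine fibredMap_fibredMap (Matrix.nonsing_inv_mul _ hp') ?_
    have e : (A p.2.2)ᵀ * ((A p.2.2)⁻¹)ᵀ = 1 := by
      rw [← Matrix.transpose_mul, Matrix.nonsing_inv_mul _ hp', Matrix.transpose_one]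
    rw [Matrix.mul_neg, Matrix.neg_mul, ← Matrix.mul_assoc, ← Matrix.mul_assoc, e, Matrix.one_mul,
      Matrix.mul_assoc, Matrix.nonsing_inv_mul _ hp', Matrix.mul_one, add_neg_cancel]
  right_inv' p hp := fibredMap_fibredMap (Matrix.mul_nonsing_inv _ (hu p.2.2 hp))
    (neg_add_cancel _)
  open_source := hD.preimage (continuous_snd.comp continuous_snd)
  open_target := hD.preimage (continuous_snd.comp continuous_snd)
  continuousOn_toFun p hp :=
    (analyticAt_fibredMap (hA _ hp) (hg _ hp)).continuousAt.continuousWithinAt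
  continuousOn_invFun p hp := by
    have hi := (hA _ hp).matrix_inv (hu _ hp)
    exact (analyticAt_fibredMap (p := p) hi
      ((hi.matrix_transpose.mul (hg _ hp)).mul hi).neg).continuousAt.continuousWithinAt

theorem locallyEquivalent_of_fibredMap {ρ ρ' : ModelSpace s r → ℝ} {D : Set (Fin r → ℂ)}
    (hD : IsOpen D) (h0 : 0 ∈ D) (hA : ∀ ζ ∈ D, AnalyticAt ℂ A ζ) (hg : ∀ ζ ∈ D, AnalyticAt ℂ g ζ)
    (hu : ∀ ζ ∈ D, IsUnit (A ζ).det)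
    (hρ : ∀ p : ModelSpace s r, p.2.2 ∈ D → ρ p = ρ' (fibredMap A g p)) :
    LocallyEquivalent ρ ρ' := by
  refine ⟨fibredEquiv D hD hA hg hu, h0, ?_, fun p hp => ?_, fun p hp => ?_, fun p hp => ?_⟩
  · have e : fibredMap A g 0 = 0 := by simp [fibredMap]
    exact e
  · exact (analyticAt_fibredMap (hA _ hp) (hg _ hp)).differentiableAt.differentiableWithinAt
  · have hi := (hA _ hp).matrix_inv (hu _ hp)
    exact (analyticAt_fibredMap (p := p) hi
      ((hi.matrix_transpose.mul (hg _ hp)).mul hi).neg).differentiableAt.differentiableWithinAt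
  · rw [hρ p hp]
    exact Iff.rfl

theorem IsTwoNondegenerateModel.exists_normal_form
    {H S : (Fin r → ℂ) → Matrix (Fin s) (Fin s) ℂ} (hM : IsTwoNondegenerateModel H S) :
    ∃ (H₀ : Matrix (Fin s) (Fin s) ℂ) (S₀ : (Fin r → ℂ) → Matrix (Fin s) (Fin s) ℂ),
      IsModelData H₀ S₀ ∧ LocallyEquivalent (modelDefiningFunction H S)
        (modelDefiningFunction (explicitH H₀ S₀) (explicitS H₀ S₀)) := by
  obtain ⟨h, σ, τ, hC⟩ := hM.exists_complexification
  refine ⟨H 0, normalizedS (H 0) σ, hM.isModelData_normalizedS hC, ?_⟩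
  have hU := hM.nondegenerate
  obtain ⟨ε, hε, hball⟩ := Metric.eventually_nhds_iff_ball.mp
    ((tendsto_prodMk_zero.eventually (hC.eventually_isRegular hU)).and
      (hM.eventually_modelFunction_eq hC))
  have hA : ∀ ζ ∈ Metric.ball 0 ε, AnalyticAt ℂ (fun ζ => ((H 0)⁻¹)ᵀ * (h (ζ, 0))ᵀ) ζ :=
    fun ζ hζ => analyticAt_const.mul
      (hball ζ hζ).1.analytic_h.comp_prodMk_zero.matrix_transpose
  have hg : ∀ ζ ∈ Metric.ball 0 ε, AnalyticAt ℂ (fun ζ => τ (ζ, 0)) ζ :=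
    fun ζ hζ => (hball ζ hζ).1.analytic_τ.comp_prodMk_zero
  have hu : ∀ ζ ∈ Metric.ball 0 ε, IsUnit (((H 0)⁻¹)ᵀ * (h (ζ, 0))ᵀ).det := by
    intro ζ hζ
    rw [Matrix.det_mul, Matrix.det_transpose, Matrix.det_transpose, Matrix.det_nonsing_inv]
    exact hU.ringInverse.mul (hball ζ hζ).1.unit
  refine locallyEquivalent_of_fibredMap Metric.isOpen_ball (Metric.mem_ball_self hε) hA hg hu
    fun p hp => ?_
  have e := (hball p.2.2 hp).2 p.2.1
  rw [modelDefiningFunction_eq, modelDefiningFunction_eq, graphFunction, graphFunction,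
    ← Prod.mk.eta (p := p.2), e, ← sub_sub]
  rfl

end LocalEquivalence

/-! ### The theorem -/

theorem theorem1p2 (s r : ℕ) (hr : 0 < r) :
    (∀ H S : (Fin r → ℂ) → Matrix (Fin s) (Fin s) ℂ, IsTwoNondegenerateModel H S →
      ∃ (H₀ : Matrix (Fin s) (Fin s) ℂ) (S₀ : (Fin r → ℂ) → Matrix (Fin s) (Fin s) ℂ),
        IsModelData H₀ S₀ ∧
        LocallyEquivalent (modelDefiningFunction H S)
          (modelDefiningFunction (explicitH H₀ S₀) (explicitS H₀ S₀))) ∧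
    (∀ (H₀ : Matrix (Fin s) (Fin s) ℂ) (S₀ : (Fin r → ℂ) → Matrix (Fin s) (Fin s) ℂ),
      IsModelData H₀ S₀ →
        IsTwoNondegenerateModel (explicitH H₀ S₀) (explicitS H₀ S₀) ∧
        ∃ (U : Set (ModelSpace s r)) (𝔤 : Set (ModelSpace s r → ModelSpace s r)),
          IsOpen U ∧ 0 ∈ U ∧
          (∀ ξ ∈ 𝔤, IsHolInfinitesimalSymmetry
            (modelDefiningFunction (explicitH H₀ S₀) (explicitS H₀ S₀)) U ξ) ∧
          ActsLocallyTransitivelyOnLeviLeaves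
            (modelDefiningFunction (explicitH H₀ S₀) (explicitS H₀ S₀)) 𝔤 U) := by
  exact ⟨fun _ _ hM => hM.exists_normal_form, fun _ _ h =>
    ⟨h.isTwoNondegenerateModel hr, h.exists_transitive_symmetries⟩⟩
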